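/- Let $\mathfrak g$ be a finite-dimensional complex semisimple Lie algebra with a triangular decomposition $\mathfrak g=\mathfrak n_-\oplus\mathfrak h\oplus\mathfrak n_+$ (given by a Cartan subalgebra $\mathfrak h$ and a base of its root system), let $U(\mathfrak g)$ be its enveloping algebra with comultiplication $\tilde\Delta$ and counit $\tilde\epsilon$, and let $Z$ be the centre of $U(\mathfrak g)$. Let $\mathcal O$ be the category of weight $\mathfrak g$-modules that are finitely generated over $U(\mathfrak n_-)$, and $\mathcal O_0$ its principal block: the modules $M\in\mathcal O$ such that every $z\in Z$ has a power of $z-\tilde\epsilon(z)$ annihilating $M$. For a $\mathfrak g$-module $M$ and a central character $\chi\colon Z\to\mathbb C$ let $M_\chi$ be the submodule of all $m\in M$ such that every $z\in Z$ has a power of $z-\chi(z)$ annihilating $m$, and write $M_0$ for $M_{\tilde\epsilon|_Z}$. If $M$ is the direct sum of $M_0$ and $\sum_{\chi\neq\tilde\epsilon|_Z}M_\chi$, let $\pi\colon M\to M_0$ be the corresponding projection and $\iota\colon M_0\to M$ the inclusion. Let $\Delta(0)$ be the Verma module of highest weight $0$ with highest weight vector $v$, and identify the simple module $L(0)$ with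 the trivial module $\mathbb C$. The formulas $$D(uv)=\tilde\Delta(u)(v\otimes v),\qquad E(uv)=\tilde\epsilon(u)\qquad(u\in U(\mathfrak g))$$ define homomorphisms $D\colon\Delta(0)\to\Delta(0)\otimes\Delta(0)$ and $E\colon\Delta(0)\to L(0)=\mathbb C$. **Theorem.** (1) For $N\in\mathcal O_0$ the module $\Delta(0)\otimes N$ is the direct sum of $(\Delta(0)\otimes N)_0$ and its parts for the other central characters, and $(\Delta(0)\otimes N)_0\in\mathcal O_0$. So $G_{\Delta(0)}N:=(\Delta(0)\otimes N)_0$, $G_{\Delta(0)}f:=(\mathrm{id}\otimes f)_0$ is an endofunctor of $\mathcal O_0$. Let $$\bar\Delta_N\colon G_{\Delta(0)}N\xrightarrow{\ \iota\ }\Delta(0)\otimes N\xrightarrow{D\otimes\mathrm{id}}\Delta(0)\otimes\Delta(0)\otimes N\xrightarrow{\mathrm{id}\otimes\pi}\Delta(0)\otimes G_{\Delta(0)}N\xrightarrow{\ \pi\ }G_{\Delta(0)}G_{\Delta(0)}N,$$ $$\bar\epsilon_N\colon G_{\Delta(0)}N\xrightarrow{\ \iota\ }\Delta(0)\otimes N\xrightarrow{E\otimes\mathrm{id}}L(0)\otimes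 N=N.$$ Then $(G_{\Delta(0)},\bar\Delta,\bar\epsilon)$ is a comonad on $\mathcal O_0$, every $\bar\Delta_N$ is injective and every $\bar\epsilon_N$ is surjective. (2) Let $\theta$ be a Chevalley anti-automorphism of $\mathfrak g$ (an anti-automorphism fixing $\mathfrak h$ pointwise), and for a weight module $M$ let $M^\star=\bigoplus_\lambda\mathrm{Hom}_{\mathbb C}(M_\lambda,\mathbb C)$ with $(xf)(m)=f(\theta(x)m)$; put $\nabla(0)=\Delta(0)^\star$. Then $\star$ preserves $\mathcal O_0$; for $N\in\mathcal O_0$ the module $\nabla(0)\otimes N$ is the direct sum of its parts as in (1) and $G_{\nabla(0)}N:=(\nabla(0)\otimes N)_0\in\mathcal O_0$, so that $G_{\nabla(0)}$ is an endofunctor of $\mathcal O_0$. The canonical pairings, given by evaluation and by $\langle f\otimes m,a\otimes n\rangle=f(a)\langle m,n\rangle$, give natural isomorphisms $$M\cong M^{\star\star},\qquad G_{\nabla(0)}M\cong(G_{\Delta(0)}M^\star)^\star,\qquad G_{\nabla(0)}G_{\nabla(0)}M\cong(G_{\Delta(0)}G_{\Delta(0)}M^\star)^\star\qquad(M\in\mathcal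 O_0).$$ Under these, the morphisms $\bar\nabla_M:=(\bar\Delta_{M^\star})^\star\colon G_{\nabla(0)}G_{\nabla(0)}M\to G_{\nabla(0)}M$ and $\bar\eta_M:=(\bar\epsilon_{M^\star})^\star\colon M\to G_{\nabla(0)}M$ form natural transformations such that $(G_{\nabla(0)},\bar\nabla,\bar\eta)$ is a monad on $\mathcal O_0$, every $\bar\nabla_M$ is surjective and every $\bar\eta_M$ is injective. -/

import Mathlib

open CategoryTheory TensorProduct

universe u

set_option linter.unusedVariables false
set_option linter.unusedSectionVars false

noncomputable section

namespace CategoryO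

attribute [local instance 100] LieRing.ofAssociativeRing

/-! ### The category of `g`-modules -/

/-- A module over the complex Lie algebra `g`, bundled with its carrier. -/
structure GMod (g : Type u) [LieRing g] [LieAlgebra ℂ g] where
  carrier : Type u
  [addCommGroup : AddCommGroup carrier]
  [module : Module ℂ carrier]
  [lieRingModule : LieRingModule g carrier]
  [lieModule : LieModule ℂ g carrier]

attribute [instance] GMod.addCommGroup GMod.module GMod.lieRingModule GMod.lieModule

variable {g : Type u} [LieRing g] [LieAlgebra ℂ g]

instance : CoeSort (GMod g) (Type u) := ⟨GMod.carrier⟩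

namespace GMod

/-- Morphisms of `g`-modules. -/
@[ext]
structure Hom (M N : GMod g) where
  hom : M →ₗ⁅ℂ,g⁆ N

instance : Category (GMod g) where
  Hom M N := Hom M N
  id M := ⟨LieModuleHom.id⟩
  comp f f' := ⟨f'.hom.comp f.hom⟩

@[ext]
lemma hom_ext {M N : GMod g} {f f' : M ⟶ N} (h : ∀ m, f.hom m = f'.hom m) : f = f' :=
  Hom.ext (LieModuleHom.ext h)

@[simp] lemma id_hom_apply (M : GMod g) (m : M) : Hom.hom (𝟙 M) m = m := rfl

@[simp] lemma comp_hom_apply {M N P : GMod g} (f : M ⟶ N) (f' : N ⟶ P) (m : M) :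
    (f ≫ f').hom m = f'.hom (f.hom m) := rfl

/-- The tensor product of two `g`-modules, with `x(m ⊗ n) = xm ⊗ n + m ⊗ xn`. -/
abbrev tensor (M N : GMod g) : GMod g := ⟨M ⊗[ℂ] N⟩

/-- The tensor product `φ ⊗ ψ` of two morphisms. -/
def tensorMap {M M' N N' : GMod g} (φ : M ⟶ M') (ψ : N ⟶ N') : tensor M N ⟶ tensor M' N' :=
  ⟨TensorProduct.LieModule.map φ.hom ψ.hom⟩

@[simp] lemma tensorMap_tmul {M M' N N' : GMod g} (φ : M ⟶ M') (ψ : N ⟶ N') (m : M) (n : N) :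
    (tensorMap φ ψ).hom (m ⊗ₜ n) = φ.hom m ⊗ₜ ψ.hom n := rfl

lemma tensor_hom_ext {M N P : GMod g} {f f' : tensor M N ⟶ P}
    (h : ∀ m n, f.hom (m ⊗ₜ n) = f'.hom (m ⊗ₜ n)) : f = f' := by
  ext t
  induction t using TensorProduct.induction_on with
  | zero => simp
  | tmul m n => exact h m n
  | add a b ha hb => rw [map_add, map_add, ha, hb]

/-- The functor `X ⊗ _` on `g`-modules. -/
@[simps]
def tensorLeft (X : GMod g) : GMod g ⥤ GMod g where
  obj N := tensor X N
  map φ := tensorMap (𝟙 X) φ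
  map_id N := tensor_hom_ext fun _ _ => rfl
  map_comp φ ψ := tensor_hom_ext fun _ _ => rfl

lemma tensorMap_exchange {M M' N N' : GMod g} (φ : M ⟶ M') (ψ : N ⟶ N') :
    tensorMap (𝟙 M) ψ ≫ tensorMap φ (𝟙 N') = tensorMap φ (𝟙 N) ≫ tensorMap (𝟙 M') ψ :=
  tensor_hom_ext fun _ _ => rfl

lemma tensorMap_comp_right (X : GMod g) {M N P : GMod g} (φ : M ⟶ N) (ψ : N ⟶ P) :
    tensorMap (𝟙 X) (φ ≫ ψ) = tensorMap (𝟙 X) φ ≫ tensorMap (𝟙 X) ψ :=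
  tensor_hom_ext fun _ _ => rfl

/-- The associativity map `(M ⊗ N) ⊗ P → M ⊗ (N ⊗ P)`. -/
def assoc (M N P : GMod g) : tensor (tensor M N) P ⟶ tensor M (tensor N P) where
  hom :=
    { (TensorProduct.assoc ℂ M N P : (M ⊗[ℂ] N) ⊗[ℂ] P →ₗ[ℂ] M ⊗[ℂ] (N ⊗[ℂ] P)) with
      map_lie' := by
        intro x t
        change (TensorProduct.assoc ℂ M N P) ⁅x, t⁆ = ⁅x, TensorProduct.assoc ℂ M N P t⁆
        induction t using TensorProduct.induction_on with
        | zero => simp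
        | add a b ha hb => rw [lie_add, map_add, map_add, lie_add, ha, hb]
        | tmul a p =>
          induction a using TensorProduct.induction_on with
          | zero => simp
          | add a b ha hb => rw [add_tmul, lie_add, map_add, map_add, lie_add, ha, hb]
          | tmul m n => simp [add_tmul, tmul_add, add_assoc] }

@[simp] lemma assoc_tmul {M N P : GMod g} (m : M) (n : N) (p : P) :
    (assoc M N P).hom (m ⊗ₜ n ⊗ₜ p) = m ⊗ₜ (n ⊗ₜ p) := rfl

lemma assoc_natural (M N : GMod g) {P P' : GMod g} (φ : P ⟶ P') :
    tensorMap (𝟙 (tensor M N)) φ ≫ assoc M N P' =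
      assoc M N P ≫ tensorMap (𝟙 M) (tensorMap (𝟙 N) φ) := by
  refine tensor_hom_ext fun t p => ?_
  induction t using TensorProduct.induction_on with
  | zero => simp
  | add a b ha hb => rw [add_tmul, map_add, map_add, ha, hb]
  | tmul m n => rfl

/-- The one-dimensional space `ℂ`, regarded as a trivial `g`-module. -/
def TrivialCarrier : Type u := ULift.{u} ℂ

instance : AddCommGroup TrivialCarrier.{u} := inferInstanceAs (AddCommGroup (ULift.{u} ℂ))

instance : Module ℂ TrivialCarrier.{u} := inferInstanceAs (Module ℂ (ULift.{u} ℂ))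

instance : LieRingModule g TrivialCarrier.{u} where
  bracket := fun _ _ => 0
  add_lie := by intros; exact (add_zero _).symm
  lie_add := by intros; exact (add_zero _).symm
  leibniz_lie := by intros; exact (add_zero _).symm

lemma trivial_lie (x : g) (c : TrivialCarrier.{u}) : ⁅x, c⁆ = 0 := rfl

instance : LieModule ℂ g TrivialCarrier.{u} where
  smul_lie := by intros; exact (smul_zero _).symm
  lie_smul := by intros; exact (smul_zero _).symm

/-- The linear identification of the trivial module with `ℂ`. -/
def trivialEquiv : TrivialCarrier.{u} ≃ₗ[ℂ] ℂ := ULift.moduleEquiv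

variable (g) in
/-- The one-dimensional trivial `g`-module `ℂ`; this is the simple highest weight
module `L(0)`, with highest weight vector `1`. -/
abbrev trivial : GMod g := ⟨TrivialCarrier.{u}⟩

/-- The identification `L(0) ⊗ M → M`, `c ⊗ m ↦ c m`. -/
def leftUnit (M : GMod g) : tensor (trivial g) M ⟶ M where
  hom :=
    { TensorProduct.lift ((LinearMap.lsmul ℂ M) ∘ₗ trivialEquiv.toLinearMap) with
      map_lie' := by
        intro x t
        change TensorProduct.lift ((LinearMap.lsmul ℂ M) ∘ₗ trivialEquiv.toLinearMap) ⁅x, t⁆ =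
          ⁅x, TensorProduct.lift ((LinearMap.lsmul ℂ M) ∘ₗ trivialEquiv.toLinearMap) t⁆
        induction t using TensorProduct.induction_on with
        | zero => simp
        | add a b ha hb => rw [lie_add, map_add, map_add, lie_add, ha, hb]
        | tmul c m =>
          rw [TensorProduct.LieModule.lie_tmul_right, trivial_lie, zero_tmul, zero_add]
          simp }

@[simp] lemma leftUnit_tmul {M : GMod g} (c : trivial g) (m : M) :
    (leftUnit M).hom (c ⊗ₜ m) = trivialEquiv c • m := rfl

lemma leftUnit_natural {M N : GMod g} (φ : M ⟶ N) :
    tensorMap (𝟙 (trivial g)) φ ≫ leftUnit N = leftUnit M ≫ φ :=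
  tensor_hom_ext fun c m => (map_smul φ.hom (trivialEquiv c) m).symm

end GMod

/-! ### The enveloping algebra, central characters and blocks -/

variable (g) in
/-- The enveloping algebra `U(g)`. -/
abbrev U : Type u := UniversalEnvelopingAlgebra ℂ g

variable (g) in
/-- The counit of `U(g)`: the algebra homomorphism with `x ↦ 0` for `x ∈ g`. -/
def counit : U g →ₐ[ℂ] ℂ := UniversalEnvelopingAlgebra.lift ℂ 0

variable (g) in
/-- The comultiplication of `U(g)`: the algebra homomorphism with
`x ↦ x ⊗ 1 + 1 ⊗ x` for `x ∈ g`. -/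
def comul : U g →ₐ[ℂ] U g ⊗[ℂ] U g :=
  UniversalEnvelopingAlgebra.lift ℂ
    { toFun := fun x => UniversalEnvelopingAlgebra.ι ℂ x ⊗ₜ 1 + 1 ⊗ₜ UniversalEnvelopingAlgebra.ι ℂ x
      map_add' := fun x y => by rw [map_add, add_tmul, tmul_add]; abel
      map_smul' := fun c x => by simp [smul_tmul']
      map_lie' := fun {x y} => by
        simp only [LieHom.map_lie, LieRing.of_associative_ring_bracket, mul_add, add_mul,
          Algebra.TensorProduct.tmul_mul_tmul, one_mul, mul_one, sub_tmul, tmul_sub]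
        abel }

lemma counit_ι (x : g) : counit g (UniversalEnvelopingAlgebra.ι ℂ x) = 0 :=
  UniversalEnvelopingAlgebra.lift_ι_apply ℂ _ x

lemma comul_ι (x : g) : comul g (UniversalEnvelopingAlgebra.ι ℂ x) =
    UniversalEnvelopingAlgebra.ι ℂ x ⊗ₜ 1 + 1 ⊗ₜ UniversalEnvelopingAlgebra.ι ℂ x :=
  UniversalEnvelopingAlgebra.lift_ι_apply ℂ _ x

/-- The action of `U(g)` on a `g`-module. -/
def act (M : GMod g) : U g →ₐ[ℂ] Module.End ℂ M :=
  UniversalEnvelopingAlgebra.lift ℂ (LieModule.toEnd ℂ g M)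

lemma act_ι (M : GMod g) (x : g) (m : M) :
    act M (UniversalEnvelopingAlgebra.ι ℂ x) m = ⁅x, m⁆ := by
  rw [act, UniversalEnvelopingAlgebra.lift_ι_apply]; rfl

lemma U_induction {p : U g → Prop} (u : U g) (hc : ∀ c : ℂ, p (algebraMap ℂ (U g) c))
    (hι : ∀ x, p (UniversalEnvelopingAlgebra.ι ℂ x)) (hadd : ∀ a b, p a → p b → p (a + b))
    (hmul : ∀ a b, p a → p b → p (a * b)) : p u := by
  let S : Subalgebra ℂ (U g) :=
    { carrier := {a | p a}
      mul_mem' := fun {a b} ha hb => hmul a b ha hb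
      add_mem' := fun {a b} ha hb => hadd a b ha hb
      algebraMap_mem' := hc }
  let f : g →ₗ⁅ℂ⁆ S :=
    { toFun := fun x => ⟨UniversalEnvelopingAlgebra.ι ℂ x, hι x⟩
      map_add' := fun x y => Subtype.ext (map_add _ x y)
      map_smul' := fun c x => Subtype.ext (map_smul _ c x)
      map_lie' := fun {x y} => Subtype.ext (by
        simp [LieRing.of_associative_ring_bracket, LieHom.map_lie]) }
  have h : S.val.comp (UniversalEnvelopingAlgebra.lift ℂ f) = AlgHom.id ℂ (U g) := by
    apply UniversalEnvelopingAlgebra.hom_ext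
    ext x
    change (UniversalEnvelopingAlgebra.lift ℂ f (UniversalEnvelopingAlgebra.ι ℂ x) : U g) = _
    rw [UniversalEnvelopingAlgebra.lift_ι_apply]
    rfl
  have h' := AlgHom.congr_fun h u
  change (UniversalEnvelopingAlgebra.lift ℂ f u : U g) = u at h'
  rw [← h']
  exact (UniversalEnvelopingAlgebra.lift ℂ f u).2

lemma act_map {M N : GMod g} (f : M ⟶ N) (u : U g) (m : M) :
    f.hom (act M u m) = act N u (f.hom m) := by
  induction u using U_induction generalizing m with
  | hc c => simp [Algebra.algebraMap_eq_smul_one]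
  | hι x => rw [act_ι, act_ι, LieModuleHom.map_lie]
  | hadd a b ha hb => simp [ha, hb]
  | hmul a b ha hb => simp [ha, hb]

variable (g) in
/-- Central characters: algebra homomorphisms `Z(g) → ℂ`, for `Z(g)` the centre of `U(g)`. -/
abbrev CentralChar : Type u := Subalgebra.center ℂ (U g) →ₐ[ℂ] ℂ

variable (g) in
/-- The central character of the trivial module `L(0)`. -/
def principalChar : CentralChar g := (counit g).comp (Subalgebra.center ℂ (U g)).val

/-- The part of `M` of generalised central character `χ`: all `m` such that each `z ∈ Z(g)`
satisfies `(z - χ(z))^k m = 0` for some `k`. -/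
def blockPart (χ : CentralChar g) (M : GMod g) : LieSubmodule ℂ g M where
  carrier := {m | ∀ z : Subalgebra.center ℂ (U g), ∃ k : ℕ,
    ((act M (z : U g) - algebraMap ℂ (Module.End ℂ M) (χ z)) ^ k) m = 0}
  zero_mem' z := ⟨0, map_zero _⟩
  add_mem' := by
    intro a b ha hb z
    obtain ⟨k, hk⟩ := ha z
    obtain ⟨l, hl⟩ := hb z
    refine ⟨k + l, ?_⟩
    rw [map_add, pow_add, Module.End.mul_apply, Module.End.mul_apply, hl, map_zero, add_zero,
      ← Module.End.mul_apply, ← pow_add, add_comm, pow_add, Module.End.mul_apply, hk, map_zero]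
  smul_mem' := by
    intro c a ha z
    obtain ⟨k, hk⟩ := ha z
    exact ⟨k, by rw [map_smul, hk, smul_zero]⟩
  lie_mem := by
    intro x m hm z
    obtain ⟨k, hk⟩ := hm z
    refine ⟨k, ?_⟩
    have hc : Commute (act M (UniversalEnvelopingAlgebra.ι ℂ x))
        (act M (z : U g) - algebraMap ℂ (Module.End ℂ M) (χ z)) := by
      refine Commute.sub_right ?_ (Algebra.commutes _ _).symm
      change _ * _ = _ * _
      rw [← map_mul, ← map_mul, Subalgebra.mem_center_iff.mp z.2]
    rw [← act_ι, ← Module.End.mul_apply, ← (hc.pow_right k).eq, Module.End.mul_apply, hk, map_zero]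

lemma map_mem_blockPart {χ : CentralChar g} {M N : GMod g} (f : M ⟶ N) {m : M}
    (hm : m ∈ blockPart χ M) : f.hom m ∈ blockPart χ N := by
  intro z
  obtain ⟨k, hk⟩ := hm z
  refine ⟨k, ?_⟩
  have : ∀ (k : ℕ) (m : M),
      ((act N (z : U g) - algebraMap ℂ (Module.End ℂ N) (χ z)) ^ k) (f.hom m) =
        f.hom (((act M (z : U g) - algebraMap ℂ (Module.End ℂ M) (χ z)) ^ k) m) := by
    intro k
    induction k with
    | zero => intro m; simp
    | succ k ih =>
      intro m
      rw [pow_succ, pow_succ, Module.End.mul_apply, Module.End.mul_apply, ← ih]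
      congr 1
      simp [Module.algebraMap_end_apply, act_map]
  rw [this, hk, map_zero]

/-- The part `M₀` of `M` belonging to the principal block. -/
abbrev principalPart (M : GMod g) : LieSubmodule ℂ g M := blockPart (principalChar g) M

/-- The sum of the parts of `M` belonging to the other blocks. -/
def otherPart (M : GMod g) : LieSubmodule ℂ g M :=
  ⨆ χ : {χ : CentralChar g // χ ≠ principalChar g}, blockPart χ.1 M

lemma map_mem_otherPart {M N : GMod g} (f : M ⟶ N) {m : M}
    (hm : m ∈ otherPart M) : f.hom m ∈ otherPart N := by
  have : otherPart M ≤ (otherPart N).comap f.hom := by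
    refine iSup_le fun χ m hm => ?_
    exact (le_iSup (fun χ : {χ : CentralChar g // χ ≠ principalChar g} => blockPart χ.1 N) χ)
      (map_mem_blockPart f hm)
  exact this hm

/-- `M₀` as a `g`-module. -/
abbrev proj0 (M : GMod g) : GMod g := ⟨principalPart M⟩

/-- The restriction `f₀ : M₀ → N₀` of `f : M → N`. -/
def proj0Map {M N : GMod g} (f : M ⟶ N) : proj0 M ⟶ proj0 N where
  hom :=
    { toFun := fun m => ⟨f.hom m, map_mem_blockPart f m.2⟩
      map_add' := fun a b => Subtype.ext (map_add _ _ _)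
      map_smul' := fun c a => Subtype.ext (map_smul _ _ _)
      map_lie' := fun {x a} => Subtype.ext (LieModuleHom.map_lie _ _ _) }

@[simp] lemma proj0Map_coe {M N : GMod g} (f : M ⟶ N) (m : proj0 M) :
    (((proj0Map f).hom m : proj0 N) : N) = f.hom (m : M) := rfl

/-- The natural inclusion `M₀ → M`. -/
def incl0 (M : GMod g) : proj0 M ⟶ M := ⟨(principalPart M).incl⟩

@[simp] lemma incl0_apply (M : GMod g) (m : proj0 M) : (incl0 M).hom m = (m : M) := rfl

/-- `M` is the direct sum of `M₀` and the sum of the parts in the other blocks. -/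
def Splits (M : GMod g) : Prop := IsCompl (principalPart M).toSubmodule (otherPart M).toSubmodule

lemma Splits.exists_add {M : GMod g} (h : Splits M) (m : M) :
    ∃ a ∈ principalPart M, ∃ b ∈ otherPart M, a + b = m :=
  Submodule.mem_sup.mp (h.sup_eq_top ▸ Submodule.mem_top (x := m))

/-- The natural projection `M → M₀` along the other blocks, for `M` which splits. -/
def pr0 (M : GMod g) (h : Splits M) : M ⟶ proj0 M where
  hom :=
    { Submodule.projectionOnto _ _ h with
      map_lie' := by
        intro x m
        apply Subtype.ext
        change ((Submodule.projectionOnto _ _ h ⁅x, m⁆ : principalPart M) : M) =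
          ⁅x, ((Submodule.projectionOnto _ _ h m : principalPart M) : M)⁆
        obtain ⟨a, ha, b, hb, rfl⟩ := h.exists_add m
        have e : ∀ a ∈ principalPart M, ∀ b ∈ otherPart M,
            ((Submodule.projectionOnto _ _ h (a + b) : principalPart M) : M) = a := by
          intro a ha b hb
          rw [map_add, Submodule.projectionOnto_apply_of_mem_left h ha,
            Submodule.projectionOnto_apply_of_mem_right h hb, add_zero]
        rw [lie_add, e _ (LieSubmodule.lie_mem _ ha) _ (LieSubmodule.lie_mem _ hb), e _ ha _ hb] }

lemma pr0_add {M : GMod g} (h : Splits M) {a b : M} (ha : a ∈ principalPart M)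
    (hb : b ∈ otherPart M) : (pr0 M h).hom (a + b) = ⟨a, ha⟩ := by
  change Submodule.projectionOnto _ _ h (a + b) = _
  rw [map_add, Submodule.projectionOnto_apply_of_mem_left h ha,
    Submodule.projectionOnto_apply_of_mem_right h hb, add_zero]

@[simp] lemma pr0_incl0 {M : GMod g} (h : Splits M) : incl0 M ≫ pr0 M h = 𝟙 _ := by
  refine GMod.hom_ext fun m => ?_
  have := pr0_add h m.2 (otherPart M).zero_mem
  rw [add_zero] at this
  exact this

@[simp] lemma proj0Map_incl0 {M N : GMod g} (f : M ⟶ N) :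
    proj0Map f ≫ incl0 N = incl0 M ≫ f := rfl

lemma pr0_natural {M N : GMod g} (f : M ⟶ N) (hM : Splits M) (hN : Splits N) :
    f ≫ pr0 N hN = pr0 M hM ≫ proj0Map f := by
  refine GMod.hom_ext fun m => ?_
  obtain ⟨a, ha, b, hb, rfl⟩ := hM.exists_add m
  rw [GMod.comp_hom_apply, GMod.comp_hom_apply, map_add f.hom, pr0_add hN (map_mem_blockPart f ha) (map_mem_otherPart f hb), pr0_add hM ha hb]
  rfl

/-! ### Triangular decomposition, category `O` and its principal block -/

section Semisimple

variable [FiniteDimensional ℂ g] [LieAlgebra.IsSemisimple ℂ g]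
  {H : LieSubalgebra ℂ g} [H.IsCartanSubalgebra]
  (b : (LieAlgebra.IsKilling.rootSystem H).Base)

/-- `n₊`, the subalgebra generated by the root spaces of the positive roots. -/
def nPlus : LieSubalgebra ℂ g :=
  LieSubalgebra.lieSpan ℂ g
    (⋃ i : {i // b.IsPos i},
      (LieAlgebra.rootSpace H ((LieAlgebra.IsKilling.rootSystem H).root i.1) : Set g))

/-- `n₋`, the subalgebra generated by the root spaces of the negative roots. -/
def nMinus : LieSubalgebra ℂ g :=
  LieSubalgebra.lieSpan ℂ g
    (⋃ i : {i // b.IsPos i},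
      (LieAlgebra.rootSpace H (-(LieAlgebra.IsKilling.rootSystem H).root i.1) : Set g))

/-- The weight space `M_lam`, for `lam` in the dual of the Cartan subalgebra `H`. -/
abbrev weightSpace (M : GMod g) (lam : Module.Dual ℂ H) : Submodule ℂ M :=
  (LieModule.weightSpace M (lam : H → ℂ)).toSubmodule

/-- Category `O`: weight modules that are finitely generated over `U(n₋)`. -/
def IsO (M : GMod g) : Prop :=
  (⨆ lam : Module.Dual ℂ H, weightSpace M lam) = ⊤ ∧
    ∃ S : Finset M, LieSubmodule.lieSpan ℂ (nMinus b) (S : Set M) = ⊤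

/-- The principal block: modules `M` in category `O` such that each `z ∈ Z(g)` has a power of
`z - χ(z)` annihilating `M`, where `χ` is the central character of `L(0)`. -/
def IsO0 : ObjectProperty (GMod g) := fun M =>
  IsO b M ∧ ∀ z : Subalgebra.center ℂ (U g), ∃ k : ℕ,
    (act M (z : U g) - algebraMap ℂ (Module.End ℂ M) (principalChar g z)) ^ k = 0

/-- The principal block as a category. -/
abbrev O0 := (IsO0 b).FullSubcategory

lemma IsO0.mem_principalPart {M : GMod g} (h : IsO0 b M) (m : M) : m ∈ principalPart M := by
  intro z
  obtain ⟨k, hk⟩ := h.2 z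
  exact ⟨k, by rw [hk]; rfl⟩

/-! ### The functors `G_X` -/

/-- Tensoring with `X` followed by projection to the principal block is defined on the principal
block: `X ⊗ N` is the direct sum of `(X ⊗ N)₀` and its parts in the other blocks, and
`(X ⊗ N)₀` belongs to the principal block. -/
structure ActsOnO0 (X : GMod g) : Prop where
  splits : ∀ N : O0 b, Splits (GMod.tensor X N.obj)
  mem : ∀ N : O0 b, IsO0 b (proj0 (GMod.tensor X N.obj))

variable {b}

/-- The endofunctor `G_X` of the principal block, `N ↦ (X ⊗ N)₀`, `f ↦ (id ⊗ f)₀`. -/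
def G {X : GMod g} (h : ActsOnO0 b X) : O0 b ⥤ O0 b where
  obj N := ⟨proj0 (GMod.tensor X N.obj), h.mem N⟩
  map f := ObjectProperty.homMk (proj0Map (GMod.tensorMap (𝟙 X) f.hom))
  map_id N := by
    apply ObjectProperty.hom_ext
    exact congrArg proj0Map ((GMod.tensorLeft X).map_id N.obj)
  map_comp f f' := by
    apply ObjectProperty.hom_ext
    exact congrArg proj0Map ((GMod.tensorLeft X).map_comp f.hom f'.hom)

/-- The inclusion of `G_X N` into `X ⊗ N`. -/
def inclG {X : GMod g} (h : ActsOnO0 b X) (N : O0 b) :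
    ((G h).obj N).obj ⟶ GMod.tensor X N.obj := incl0 _

/-- The projection of `X ⊗ N` onto `G_X N`. -/
def prG {X : GMod g} (h : ActsOnO0 b X) (N : O0 b) :
    GMod.tensor X N.obj ⟶ ((G h).obj N).obj := pr0 _ (h.splits N)

lemma G_map_eq {X : GMod g} (h : ActsOnO0 b X) {N N' : O0 b} (f : N ⟶ N') :
    ((G h).map f).hom = inclG h N ≫ GMod.tensorMap (𝟙 X) f.hom ≫ prG h N' := by
  change proj0Map _ = incl0 _ ≫ _ ≫ pr0 _ _
  rw [pr0_natural _ (h.splits N) (h.splits N'), ← Category.assoc, pr0_incl0, Category.id_comp]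

lemma G_map_inclG {X : GMod g} (h : ActsOnO0 b X) {N N' : O0 b} (f : N ⟶ N') :
    ((G h).map f).hom ≫ inclG h N' = inclG h N ≫ GMod.tensorMap (𝟙 X) f.hom := rfl

lemma prG_G_map {X : GMod g} (h : ActsOnO0 b X) {N N' : O0 b} (f : N ⟶ N') :
    prG h N ≫ ((G h).map f).hom = GMod.tensorMap (𝟙 X) f.hom ≫ prG h N' :=
  (pr0_natural _ (h.splits N) (h.splits N')).symm

end Semisimple

/-! ### Verma modules -/

instance (I : Submodule (U g) (U g)) : LieRingModule g (U g ⧸ I) where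
  bracket x q := UniversalEnvelopingAlgebra.ι ℂ x • q
  add_lie x y q := by
    rw [map_add, add_smul]
  lie_add x q q' := smul_add _ _ _
  leibniz_lie x y q := by
    change UniversalEnvelopingAlgebra.ι ℂ x • UniversalEnvelopingAlgebra.ι ℂ y • q =
      UniversalEnvelopingAlgebra.ι ℂ ⁅x, y⁆ • q +
        UniversalEnvelopingAlgebra.ι ℂ y • UniversalEnvelopingAlgebra.ι ℂ x • q
    rw [LieHom.map_lie, LieRing.of_associative_ring_bracket, sub_smul, mul_smul, mul_smul,
      sub_add_cancel]

lemma lie_quot {I : Submodule (U g) (U g)} (x : g) (q : U g ⧸ I) :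
    ⁅x, q⁆ = UniversalEnvelopingAlgebra.ι ℂ x • q := rfl

instance (I : Submodule (U g) (U g)) : LieModule ℂ g (U g ⧸ I) where
  smul_lie c x q := by rw [lie_quot, lie_quot, map_smul, smul_assoc]
  lie_smul c x q := by rw [lie_quot, lie_quot, smul_comm]

section Verma

variable [FiniteDimensional ℂ g] [LieAlgebra.IsSemisimple ℂ g]
  {H : LieSubalgebra ℂ g} [H.IsCartanSubalgebra]
  (b : (LieAlgebra.IsKilling.rootSystem H).Base)

/-- The left ideal of `U(g)` generated by `n₊` and all `h - lam(h)` for `h ∈ H`. -/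
def vermaIdeal (lam : Module.Dual ℂ H) : Submodule (U g) (U g) :=
  Submodule.span (U g)
    ({u | ∃ x ∈ nPlus b, u = UniversalEnvelopingAlgebra.ι ℂ x} ∪
      {u | ∃ h : H, u = UniversalEnvelopingAlgebra.ι ℂ (h : g) - algebraMap ℂ (U g) (lam h)})

/-- The Verma module `Δ(lam)`, the quotient of `U(g)` by `vermaIdeal b lam`. The class of `u`
is `u v`, for `v` the class of `1`, a highest weight vector. -/
abbrev verma (lam : Module.Dual ℂ H) : GMod g := ⟨U g ⧸ vermaIdeal b lam⟩

/-- The element `u v` of `Δ(lam)`. -/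
def vermaMk (lam : Module.Dual ℂ H) : U g →ₗ[ℂ] verma b lam :=
  (vermaIdeal b lam).mkQ.restrictScalars ℂ

/-- A linear map on `U(g)` that intertwines the left multiplication by `g` with the action of `g`
on `M` and is zero on `n₊` and on `h - lam(h)` for `h ∈ H` induces a morphism `Δ(lam) → M`. -/
def vermaLift (lam : Module.Dual ℂ H) (M : GMod g) (φ : U g →ₗ[ℂ] M)
    (hφ : ∀ (x : g) (u : U g), φ (UniversalEnvelopingAlgebra.ι ℂ x * u) = ⁅x, φ u⁆)
    (hn : ∀ x ∈ nPlus b, φ (UniversalEnvelopingAlgebra.ι ℂ x) = 0)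
    (hh : ∀ h : H, φ (UniversalEnvelopingAlgebra.ι ℂ (h : g)) = lam h • φ 1) :
    verma b lam ⟶ M where
  hom :=
    { ((vermaIdeal b lam).restrictScalars ℂ).liftQ φ (by
        have hact : ∀ a u : U g, φ (a * u) = act M a (φ u) := by
          intro a
          induction a using U_induction with
          | hc c => intro u; simp [Algebra.algebraMap_eq_smul_one]
          | hι x => intro u; rw [hφ, act_ι]
          | hadd a b ha hb => intro u; simp [add_mul, ha, hb]
          | hmul a b ha hb => intro u; rw [mul_assoc, ha, hb]; simp
        intro u hu
        change u ∈ vermaIdeal b lam at hu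
        change φ u = 0
        induction hu using Submodule.span_induction with
        | mem u hu =>
          rcases hu with ⟨x, hx, rfl⟩ | ⟨h, rfl⟩
          · exact hn x hx
          · rw [map_sub, hh, Algebra.algebraMap_eq_smul_one, map_smul, sub_self]
        | zero => exact map_zero φ
        | add a c _ _ ha hc => rw [map_add, ha, hc, add_zero]
        | smul a c _ hc => rw [smul_eq_mul, hact, hc, map_zero]) ∘ₗ
      (Submodule.Quotient.restrictScalarsEquiv ℂ (vermaIdeal b lam)).symm.toLinearMap with
      map_lie' := by
        intro x q
        obtain ⟨u, rfl⟩ := Submodule.Quotient.mk_surjective _ q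
        exact hφ x u }

lemma vermaLift_mk {lam : Module.Dual ℂ H} {M : GMod g} {φ : U g →ₗ[ℂ] M}
    {hφ : ∀ (x : g) (u : U g), φ (UniversalEnvelopingAlgebra.ι ℂ x * u) = ⁅x, φ u⁆}
    {hn : ∀ x ∈ nPlus b, φ (UniversalEnvelopingAlgebra.ι ℂ x) = 0}
    {hh : ∀ h : H, φ (UniversalEnvelopingAlgebra.ι ℂ (h : g)) = lam h • φ 1} (u : U g) :
    (vermaLift b lam M φ hφ hn hh).hom (vermaMk b lam u) = φ u := rfl

lemma lie_vermaMk (lam : Module.Dual ℂ H) (x : g) (u : U g) :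
    ⁅x, vermaMk b lam u⁆ = vermaMk b lam (UniversalEnvelopingAlgebra.ι ℂ x * u) := rfl

lemma vermaMk_nPlus (lam : Module.Dual ℂ H) {x : g} (hx : x ∈ nPlus b) :
    vermaMk b lam (UniversalEnvelopingAlgebra.ι ℂ x) = 0 :=
  (Submodule.Quotient.mk_eq_zero _).mpr (Submodule.subset_span (Or.inl ⟨x, hx, rfl⟩))

lemma vermaMk_cartan (lam : Module.Dual ℂ H) (h : H) :
    vermaMk b lam (UniversalEnvelopingAlgebra.ι ℂ (h : g)) = lam h • vermaMk b lam 1 := by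
  rw [← map_smul, ← Algebra.algebraMap_eq_smul_one, ← sub_eq_zero, ← map_sub]
  exact (Submodule.Quotient.mk_eq_zero _).mpr (Submodule.subset_span (Or.inr ⟨h, rfl⟩))

/-- The linear map `u ⊗ u' ↦ u v ⊗ u' v`. -/
def vermaMk₂ : U g ⊗[ℂ] U g →ₗ[ℂ] GMod.tensor (verma b 0) (verma b 0) :=
  TensorProduct.map (vermaMk b 0) (vermaMk b 0)

lemma vermaMk₂_comul_mul (x : g) (w : U g ⊗[ℂ] U g) :
    vermaMk₂ b (comul g (UniversalEnvelopingAlgebra.ι ℂ x) * w) = ⁅x, vermaMk₂ b w⁆ := by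
  induction w using TensorProduct.induction_on with
  | zero => simp
  | add a c ha hc => rw [mul_add, map_add, map_add, lie_add, ha, hc]
  | tmul a c =>
    rw [comul_ι, add_mul, Algebra.TensorProduct.tmul_mul_tmul, Algebra.TensorProduct.tmul_mul_tmul,
      one_mul, one_mul, map_add]
    change _ = ⁅x, vermaMk b 0 a ⊗ₜ[ℂ] vermaMk b 0 c⁆
    rw [TensorProduct.LieModule.lie_tmul_right]
    rfl

/-- The morphism `D : Δ(0) → Δ(0) ⊗ Δ(0)`, `u v ↦ Δ(u)(v ⊗ v)`, where `Δ(u)` is the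
comultiplication of `U(g)`. -/
def D : verma b 0 ⟶ GMod.tensor (verma b 0) (verma b 0) :=
  vermaLift b 0 _ (vermaMk₂ b ∘ₗ (comul g).toLinearMap)
    (fun x u => by simpa using vermaMk₂_comul_mul b x (comul g u))
    (fun x hx => by
      change vermaMk₂ b (comul g (UniversalEnvelopingAlgebra.ι ℂ x)) = 0
      rw [comul_ι, map_add]
      change vermaMk b 0 _ ⊗ₜ[ℂ] vermaMk b 0 1 + vermaMk b 0 1 ⊗ₜ[ℂ] vermaMk b 0 _ = 0
      rw [vermaMk_nPlus b 0 hx, zero_tmul, tmul_zero, add_zero])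
    (fun h => by
      change vermaMk₂ b (comul g (UniversalEnvelopingAlgebra.ι ℂ (h : g))) = _
      rw [comul_ι, map_add, LinearMap.zero_apply, zero_smul]
      change vermaMk b 0 _ ⊗ₜ[ℂ] vermaMk b 0 1 + vermaMk b 0 1 ⊗ₜ[ℂ] vermaMk b 0 _ = 0
      rw [vermaMk_cartan, LinearMap.zero_apply, zero_smul, zero_tmul, tmul_zero, add_zero])

/-- The morphism `E : Δ(0) → L(0) = ℂ`, `u v ↦ ε(u)`, where `ε` is the counit of `U(g)`. -/
def E : verma b 0 ⟶ GMod.trivial g :=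
  vermaLift b 0 _ (GMod.trivialEquiv.symm.toLinearMap ∘ₗ (counit g).toLinearMap)
    (fun x u => by
      rw [GMod.trivial_lie]
      simp [-UniversalEnvelopingAlgebra.ι_apply, counit_ι])
    (fun x hx => by simp [-UniversalEnvelopingAlgebra.ι_apply, counit_ι])
    (fun h => by simp [-UniversalEnvelopingAlgebra.ι_apply, counit_ι])

lemma D_mk (u : U g) : (D b).hom (vermaMk b 0 u) = vermaMk₂ b (comul g u) := rfl

lemma E_mk (u : U g) :
    GMod.trivialEquiv ((E b).hom (vermaMk b 0 u)) = counit g u := rfl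

/-! ### The comonad structure -/

variable {b}

/-- The comultiplication `G_{Δ(0)} N → G_{Δ(0)} G_{Δ(0)} N`: the inclusion into `Δ(0) ⊗ N`,
followed by `D ⊗ id` and by the projection of `Δ(0) ⊗ Δ(0) ⊗ N` onto `G_{Δ(0)} G_{Δ(0)} N`. -/
def delta (h : ActsOnO0 b (verma b 0)) : G h ⟶ G h ⋙ G h where
  app N := ObjectProperty.homMk
    (inclG h N ≫ GMod.tensorMap (D b) (𝟙 N.obj) ≫ GMod.assoc _ _ _ ≫
      GMod.tensorMap (𝟙 (verma b 0)) (prG h N) ≫ prG h ((G h).obj N))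
  naturality N N' f := by
    apply ObjectProperty.hom_ext
    change ((G h).map f).hom ≫ inclG h N' ≫ GMod.tensorMap (D b) (𝟙 N'.obj) ≫
        GMod.assoc _ _ _ ≫ GMod.tensorMap (𝟙 (verma b 0)) (prG h N') ≫ prG h ((G h).obj N') =
      (inclG h N ≫ GMod.tensorMap (D b) (𝟙 N.obj) ≫ GMod.assoc _ _ _ ≫
        GMod.tensorMap (𝟙 (verma b 0)) (prG h N) ≫ prG h ((G h).obj N)) ≫
        ((G h).map ((G h).map f)).hom
    rw [← Category.assoc, G_map_inclG]
    simp only [Category.assoc]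
    rw [prG_G_map, ← Category.assoc (GMod.tensorMap (𝟙 (verma b 0)) f.hom),
      GMod.tensorMap_exchange, Category.assoc,
      ← Category.assoc (GMod.tensorMap _ f.hom) (GMod.assoc _ _ _), GMod.assoc_natural,
      Category.assoc, ← Category.assoc (GMod.tensorMap _ (GMod.tensorMap _ f.hom)),
      ← GMod.tensorMap_comp_right, ← prG_G_map, GMod.tensorMap_comp_right, Category.assoc]

/-- The counit `G_{Δ(0)} N → N`: the inclusion into `Δ(0) ⊗ N` followed by
`E ⊗ id : Δ(0) ⊗ N → L(0) ⊗ N = N`. -/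
def epsilon (h : ActsOnO0 b (verma b 0)) : G h ⟶ 𝟭 (O0 b) where
  app N := ObjectProperty.homMk
    (inclG h N ≫ GMod.tensorMap (E b) (𝟙 N.obj) ≫ GMod.leftUnit N.obj)
  naturality N N' f := by
    apply ObjectProperty.hom_ext
    change ((G h).map f).hom ≫ inclG h N' ≫ GMod.tensorMap (E b) (𝟙 N'.obj) ≫
        GMod.leftUnit N'.obj =
      (inclG h N ≫ GMod.tensorMap (E b) (𝟙 N.obj) ≫ GMod.leftUnit N.obj) ≫ f.hom
    rw [← Category.assoc, G_map_inclG]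
    simp only [Category.assoc]
    rw [← Category.assoc (GMod.tensorMap (𝟙 (verma b 0)) f.hom),
      GMod.tensorMap_exchange, Category.assoc, GMod.leftUnit_natural]

end Verma

/-! ### The duality on `g`-modules -/

section Duality

variable [FiniteDimensional ℂ g] [LieAlgebra.IsSemisimple ℂ g]

/-- A Chevalley anti-automorphism of `g` with respect to `H`: an anti-automorphism that fixes `H`
pointwise. It exchanges the root spaces of `α` and `-α` for each root `α`, and it is
automatically an involution. -/
structure ChevalleyAntiAut (H : LieSubalgebra ℂ g) extends g ≃ₗ[ℂ] g where
  map_lie : ∀ x y, toFun ⁅x, y⁆ = ⁅toFun y, toFun x⁆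
  map_cartan : ∀ h ∈ H, toFun h = h

variable {H : LieSubalgebra ℂ g}

instance : CoeFun (ChevalleyAntiAut H) (fun _ => g → g) := ⟨fun θ => θ.toLinearEquiv⟩

lemma ChevalleyAntiAut.lie (θ : ChevalleyAntiAut H) (x y : g) : θ ⁅x, y⁆ = ⁅θ y, θ x⁆ :=
  θ.map_lie x y

variable [H.IsCartanSubalgebra]

variable (H) in
/-- The restricted dual `⨁ Hom(M_lam, ℂ)` of a weight module `M`, as the space of those
linear functionals on `M` that vanish on all but finitely many weight spaces. -/
def restrictedDual (M : GMod g) : Submodule ℂ (Module.Dual ℂ M) where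
  carrier := {f | {lam : Module.Dual ℂ H | ∃ m ∈ weightSpace M lam, f m ≠ 0}.Finite}
  zero_mem' := by simp
  add_mem' := by
    intro a b ha hb
    refine (ha.union hb).subset ?_
    rintro lam ⟨m, hm, h⟩
    by_contra hc
    simp only [Set.mem_union, Set.mem_ofPred_eq, not_or, not_exists, not_and, not_not] at hc
    exact h (by rw [LinearMap.add_apply, hc.1 m hm, hc.2 m hm, add_zero])
  smul_mem' := by
    intro c a ha
    refine ha.subset ?_
    rintro lam ⟨m, hm, h⟩
    exact ⟨m, hm, fun h0 => h (by rw [LinearMap.smul_apply, h0, smul_zero])⟩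

lemma lie_mem_weightSpace {M : GMod g} {α lam : Module.Dual ℂ H} {y : g} {m : M}
    (hy : y ∈ LieAlgebra.rootSpace H α) (hm : m ∈ weightSpace M lam) :
    ⁅y, m⁆ ∈ weightSpace M (lam + α) := by
  change m ∈ LieModule.weightSpace M (lam : H → ℂ) at hm
  change ⁅y, m⁆ ∈ LieModule.weightSpace M ((lam + α : Module.Dual ℂ H) : H → ℂ)
  rw [LieModule.mem_weightSpace] at hm ⊢
  intro h
  have h1 : ⁅(h : g), y⁆ = α h • y := LieAlgebra.IsKilling.lie_eq_smul_of_mem_rootSpace hy h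
  have h2 : ⁅(h : g), m⁆ = lam h • m := hm h
  change ⁅(h : g), ⁅y, m⁆⁆ = _
  rw [leibniz_lie, h1, h2, smul_lie, lie_smul, LinearMap.add_apply, add_smul, add_comm]

lemma comp_mem_restrictedDual {M : GMod g} {f : Module.Dual ℂ M} (hf : f ∈ restrictedDual H M)
    (y : g) : f ∘ₗ LieModule.toEnd ℂ g M y ∈ restrictedDual H M := by
  have hy : y ∈ (⨆ α : LieModule.Weight ℂ H g, LieAlgebra.rootSpace H α) := by
    rw [LieModule.iSup_genWeightSpace_eq_top']; trivial
  induction hy using LieSubmodule.iSup_induction' with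
  | mem α y hy =>
    refine (hf.image fun mu => mu - α.toLinear).subset ?_
    rintro lam ⟨m, hm, h⟩
    exact ⟨lam + α.toLinear, ⟨⁅y, m⁆, lie_mem_weightSpace (α := α.toLinear) hy hm, h⟩,
      add_sub_cancel_right _ _⟩
  | zero => rw [map_zero, LinearMap.comp_zero]; exact Submodule.zero_mem _
  | add x y _ _ hx hy => rw [map_add, LinearMap.comp_add]; exact Submodule.add_mem _ hx hy

/-- The carrier of the dual module `M^⋆` with respect to `θ`. -/
def DualCarrier (θ : ChevalleyAntiAut H) (M : GMod g) : Type u := restrictedDual H M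

namespace DualCarrier

variable (θ : ChevalleyAntiAut H) (M : GMod g)

instance : AddCommGroup (DualCarrier θ M) := inferInstanceAs (AddCommGroup (restrictedDual H M))

instance : Module ℂ (DualCarrier θ M) := inferInstanceAs (Module ℂ (restrictedDual H M))

variable {θ M}

/-- The linear functional on `M` underlying an element of `M^⋆`. -/
def toDual : DualCarrier θ M →ₗ[ℂ] Module.Dual ℂ M := (restrictedDual H M).subtype

lemma toDual_injective : Function.Injective (toDual (θ := θ) (M := M)) :=
  Subtype.val_injective

instance : Bracket g (DualCarrier θ M) :=
  ⟨fun x f => ⟨toDual f ∘ₗ LieModule.toEnd ℂ g M (θ x), comp_mem_restrictedDual f.2 _⟩⟩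

/-- The action of `g` on `M^⋆` is `(x f)(m) = f(θ(x) m)`. -/
lemma lie_apply (x : g) (f : DualCarrier θ M) (m : M) : toDual ⁅x, f⁆ m = toDual f ⁅θ x, m⁆ := rfl

lemma ext' {f f' : DualCarrier θ M} (h : ∀ m, toDual f m = toDual f' m) : f = f' :=
  toDual_injective (LinearMap.ext h)

instance : LieRingModule g (DualCarrier θ M) where
  add_lie x y f := ext' fun m => by
    rw [map_add, LinearMap.add_apply]; simp only [lie_apply]; rw [map_add, add_lie, map_add]
  lie_add x f f' := ext' fun m => by
    simp only [lie_apply, map_add, LinearMap.add_apply]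
  leibniz_lie x y f := ext' fun m => by
    rw [map_add, LinearMap.add_apply]
    simp only [lie_apply, ChevalleyAntiAut.lie]
    rw [← map_add, lie_lie, sub_add_cancel]

instance : LieModule ℂ g (DualCarrier θ M) where
  smul_lie c x f := ext' fun m => by
    rw [map_smul, LinearMap.smul_apply]; simp only [lie_apply]; rw [map_smul, smul_lie, map_smul]
  lie_smul c x f := ext' fun m => by
    simp only [lie_apply, map_smul, LinearMap.smul_apply]

end DualCarrier

/-- The dual module `M^⋆` with respect to `θ`. -/
abbrev dual (θ : ChevalleyAntiAut H) (M : GMod g) : GMod g := ⟨DualCarrier θ M⟩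

/-- The value `f(m)` for `f ∈ M^⋆` and `m ∈ M`. -/
abbrev eval {θ : ChevalleyAntiAut H} {M : GMod g} : dual θ M →ₗ[ℂ] Module.Dual ℂ M :=
  DualCarrier.toDual

/-- The linear map `φ ↦ φ ∘ f` from `N^⋆` to `M^⋆`, for `f : M → N`. -/
def dualMapLinear (θ : ChevalleyAntiAut H) {M N : GMod g} (f : M ⟶ N) :
    DualCarrier θ N →ₗ[ℂ] DualCarrier θ M :=
  LinearMap.restrict (p := restrictedDual H N) (q := restrictedDual H M)
    (f.hom : M →ₗ[ℂ] N).dualMap (by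
      intro φ hφ
      refine Set.Finite.subset hφ ?_
      rintro lam ⟨m, hm, h⟩
      refine ⟨f.hom m, ?_, h⟩
      change m ∈ LieModule.weightSpace M (lam : H → ℂ) at hm
      change f.hom m ∈ LieModule.weightSpace N (lam : H → ℂ)
      rw [LieModule.mem_weightSpace] at hm ⊢
      intro x
      have h2 : ⁅(x : g), m⁆ = lam x • m := hm x
      change ⁅(x : g), f.hom m⁆ = _
      rw [← LieModuleHom.map_lie, h2, map_smul])

/-- The transpose `f^⋆ : N^⋆ → M^⋆` of `f : M → N`. -/
def dualMap (θ : ChevalleyAntiAut H) {M N : GMod g} (f : M ⟶ N) : dual θ N ⟶ dual θ M where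
  hom :=
    { dualMapLinear θ f with
      map_lie' := fun {x a} => DualCarrier.ext' (θ := θ) fun m =>
        congrArg (eval a) (LieModuleHom.map_lie f.hom (θ x) m).symm }

lemma dualMap_apply {θ : ChevalleyAntiAut H} {M N : GMod g} (f : M ⟶ N) (φ : dual θ N) (m : M) :
    eval ((dualMap θ f).hom φ) m = eval φ (f.hom m) := rfl

variable (b : (LieAlgebra.IsKilling.rootSystem H).Base)

/-- The dual Verma module `∇(lam) = Δ(lam)^⋆`. -/
abbrev dualVerma (θ : ChevalleyAntiAut H) (lam : Module.Dual ℂ H) : GMod g := dual θ (verma b lam)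

/-- The duality preserves the principal block. -/
def PreservesO0 (θ : ChevalleyAntiAut H) : Prop := ∀ M : O0 b, IsO0 b (dual θ M.obj)

variable {b}

/-- The duality as a contravariant functor on the principal block. -/
def star {θ : ChevalleyAntiAut H} (hθ : PreservesO0 b θ) : (O0 b)ᵒᵖ ⥤ O0 b where
  obj M := ⟨dual θ M.unop.obj, hθ M.unop⟩
  map f := ObjectProperty.homMk (dualMap θ f.unop.hom)
  map_id M := rfl
  map_comp f f' := by
    apply ObjectProperty.hom_ext
    rfl

variable (b) in
/-- For a bilinear pairing `B` of `M` and `N`, the bilinear pairing of `∇(0) ⊗ M` and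
`Δ(0) ⊗ N` given by `⟨f ⊗ m, a ⊗ n⟩ = f(a) B(m, n)`. -/
def pairing (θ : ChevalleyAntiAut H) {M N : GMod g} (B : M →ₗ[ℂ] Module.Dual ℂ N) :
    GMod.tensor (dualVerma b θ 0) M →ₗ[ℂ] Module.Dual ℂ (GMod.tensor (verma b 0) N) :=
  TensorProduct.dualDistrib ℂ (verma b 0) N ∘ₗ TensorProduct.map eval B

lemma pairing_tmul (θ : ChevalleyAntiAut H) {M N : GMod g} (B : M →ₗ[ℂ] Module.Dual ℂ N)
    (f : dualVerma b θ 0) (m : M) (a : verma b 0) (n : N) :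
    pairing b θ B (f ⊗ₜ m) (a ⊗ₜ n) = eval f a * B m n := rfl

/-- The restriction of `pairing b θ B` to a pairing of `G_{∇(0)} M` and `G_{Δ(0)} N`. -/
def pairingG {θ : ChevalleyAntiAut H} (hD : ActsOnO0 b (verma b 0))
    (hN : ActsOnO0 b (dualVerma b θ 0)) {M N : O0 b} (B : M.obj →ₗ[ℂ] Module.Dual ℂ N.obj) :
    ((G hN).obj M).obj →ₗ[ℂ] Module.Dual ℂ ((G hD).obj N).obj :=
  ((inclG hD N).hom : _ →ₗ[ℂ] GMod.tensor (verma b 0) N.obj).dualMap ∘ₗ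
    pairing b θ B ∘ₗ (inclG hN M).hom

lemma pairingG_apply {θ : ChevalleyAntiAut H} (hD : ActsOnO0 b (verma b 0))
    (hN : ActsOnO0 b (dualVerma b θ 0)) {M N : O0 b} (B : M.obj →ₗ[ℂ] Module.Dual ℂ N.obj)
    (x : ((G hN).obj M).obj) (y : ((G hD).obj N).obj) :
    pairingG hD hN B x y = pairing b θ B ((inclG hN M).hom x) ((inclG hD N).hom y) := rfl

/-- The evaluation pairing of `M` and `M^⋆`. -/
def evalPairing {θ : ChevalleyAntiAut H} (hθ : PreservesO0 b θ) (M : O0 b) :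
    M.obj →ₗ[ℂ] Module.Dual ℂ ((star hθ).obj (Opposite.op M)).obj :=
  LinearMap.flip (eval (θ := θ) (M := M.obj))

end Duality

/-! ### Comonads and monads -/

section Monads

variable {C : Type*} [Category C]

/-- `(F, δ, ε)` is a comonad. -/
structure IsComonad (F : C ⥤ C) (δ : F ⟶ F ⋙ F) (ε : F ⟶ 𝟭 C) : Prop where
  coassoc : ∀ X, δ.app X ≫ F.map (δ.app X) = δ.app X ≫ δ.app (F.obj X)
  left_counit : ∀ X, δ.app X ≫ ε.app (F.obj X) = 𝟙 (F.obj X)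
  right_counit : ∀ X, δ.app X ≫ F.map (ε.app X) = 𝟙 (F.obj X)

/-- `(F, μ, η)` is a monad. -/
structure IsMonad (F : C ⥤ C) (μ : F ⋙ F ⟶ F) (η : 𝟭 C ⟶ F) : Prop where
  assoc : ∀ X, F.map (μ.app X) ≫ μ.app X = μ.app (F.obj X) ≫ μ.app X
  left_unit : ∀ X, η.app (F.obj X) ≫ μ.app X = 𝟙 (F.obj X)
  right_unit : ∀ X, F.map (η.app X) ≫ μ.app X = 𝟙 (F.obj X)

/-- The bundled comonad. -/
def IsComonad.toComonad {F : C ⥤ C} {δ : F ⟶ F ⋙ F} {ε : F ⟶ 𝟭 C} (h : IsComonad F δ ε) :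
    Comonad C where
  toFunctor := F
  δ := δ
  ε := ε
  coassoc := h.coassoc
  left_counit := h.left_counit
  right_counit := h.right_counit

/-- The bundled monad. -/
def IsMonad.toMonad {F : C ⥤ C} {μ : F ⋙ F ⟶ F} {η : 𝟭 C ⟶ F} (h : IsMonad F μ η) :
    Monad C where
  toFunctor := F
  μ := μ
  η := η
  assoc := h.assoc
  left_unit := h.left_unit
  right_unit := h.right_unit

end Monads

end CategoryO

end

noncomputable section

namespace CategoryO

attribute [local instance 100] LieRing.ofAssociativeRing

/-! ### Roots and heights -/

/-! The argument runs in a class larger than category `O`: the `IsBounded` modules, which are weight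
modules with finite-dimensional weight spaces and weights in finitely many cones `mu - posCone`. The
class contains `O` (`IsO.isBounded`), hence the Verma modules, and is closed under tensor products,
direct summands and duals. On a bounded module the centre of `U(g)` preserves the finite-dimensional
weight spaces. Simultaneous generalised eigenspaces there have central characters as eigenvalues, so
the module splits into blocks (`IsBounded.splits`).

Finite generation of the principal part is the harder point (`IsBounded.isO_of_principal`). On a
vector of weight `mu` that is singular modulo a submodule, the Casimir element acts modulo that
submodule by `(mu, mu) + mu(s)`. In the principal block this scalar must vanish if the vector is not
in the submodule. By Cauchy–Schwarz the quadratic term outgrows the linear one along a cone, so new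
generators occur only above a fixed height, where the weight spaces are finite in number and
finite-dimensional. Hence `G_X` is defined on the principal block for every bounded `X`, in
particular for `Δ(0)` and `∇(0)`.

The maps `D` and `E` make `Δ(0)` a coassociative counital coalgebra: `v` generates, and on it both
sides of each law are a tensor power of `v`. Morphisms respect block decompositions, so an inner
projection followed by inclusion can be dropped in front of an outer projection, and the coalgebra
laws become the comonad laws. Injectivity of the comultiplication follows from the counit law, and
surjectivity of the counit from `E(v) = 1`.

The dual statement is obtained through non-degenerate contravariant pairings (`IsContragredient`).
The anti-automorphism `θ` extends to `U(g)` and fixes the principal central character, so a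
principal part is orthogonal to all other blocks and the pairing restricts to principal parts.
Between bounded modules such a pairing identifies one module with the dual of the other. The
multiplication and unit are adjoint to the comultiplication and counit for every such pairing
(`pairingG_mu`, `pairingG_eta`), so the monad laws are the adjoints of the comonad laws. -/

lemma eq_iSup_fiber_of_iSupIndep {ι κ V : Type*} [AddCommGroup V] [Module ℂ V]
    {W : κ → Submodule ℂ V} (hW : iSupIndep W) {A : ι → Submodule ℂ V} {f : ι → κ}
    (hA : ∀ i, A i ≤ W (f i)) (htop : ⨆ i, A i = ⊤) (k : κ) :
    W k = ⨆ i : {i // f i = k}, A i := by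
  refine le_antisymm (fun m hm => ?_) (iSup_le fun i => (hA i).trans_eq (by rw [i.2]))
  -- Sorting the `A i` by whether `f i = k` splits `m` as `a + c`. The part `c` from the other
  -- indices again lies in `W k`, so independence kills it.
  have h : m ∈ (⨆ i : {i // f i = k}, A i) ⊔ ⨆ j, ⨆ (_ : j ≠ k), W j := by
    have : (⊤ : Submodule ℂ V) ≤ (⨆ i : {i // f i = k}, A i) ⊔ ⨆ j, ⨆ (_ : j ≠ k), W j := by
      rw [← htop]
      refine iSup_le fun i => ?_
      by_cases h : f i = k
      · exact le_sup_of_le_left (le_iSup (fun i : {i // f i = k} => A i) ⟨i, h⟩)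
      · exact le_sup_of_le_right ((hA i).trans (le_iSup₂_of_le (f i) h le_rfl))
    exact this trivial
  obtain ⟨a, ha, c, hc, rfl⟩ := Submodule.mem_sup.mp h
  have ha' : a ∈ W k := (iSup_le fun i => (hA i).trans_eq (by rw [i.2]) : ⨆ i : {i // f i = k}, A i ≤ W k) ha
  have hc' : c ∈ W k := by simpa using (W k).sub_mem hm ha'
  rw [Submodule.disjoint_def.mp (hW k) c hc' hc, add_zero]
  exact ha

section Semisimple

variable {g : Type u} [LieRing g] [LieAlgebra ℂ g] [FiniteDimensional ℂ g]
  [LieAlgebra.IsSemisimple ℂ g] {H : LieSubalgebra ℂ g} [H.IsCartanSubalgebra]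

open LieAlgebra LieAlgebra.IsKilling Module

lemma iSupIndep_weightSpace (M : GMod g) :
    iSupIndep fun lam : Dual ℂ H => weightSpace M lam := by
  have h := LieModule.iSupIndep_genWeightSpace ℂ H M
  rw [← LieSubmodule.iSupIndep_toSubmodule] at h
  have h' := h.comp (f := fun lam : Dual ℂ H => (lam : H → ℂ)) DFunLike.coe_injective
  exact h'.mono fun lam => LieModule.weightSpace_le_genWeightSpace M _

lemma mem_weightSpace_iff {M : GMod g} {lam : Dual ℂ H} {m : M} :
    m ∈ weightSpace M lam ↔ ∀ h : H, ⁅(h : g), m⁆ = lam h • m :=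
  LieModule.mem_weightSpace _ _

variable (b : (rootSystem H).Base)

/-- The element of the Cartan subalgebra on which all simple roots take the value `1`. -/
def rhoCheck : H := (Module.evalEquiv ℂ H).symm (b.toWeightBasis.constr ℂ fun _ => (1 : ℂ))

lemma apply_rhoCheck (lam : Dual ℂ H) :
    lam (rhoCheck b) = b.toWeightBasis.constr ℂ (fun _ => (1 : ℂ)) lam := by
  have := (Module.evalEquiv ℂ H).apply_symm_apply (b.toWeightBasis.constr ℂ fun _ => (1 : ℂ))
  exact LinearMap.congr_fun this lam

lemma root_rhoCheck_of_mem_support {i : H.root} (hi : i ∈ b.support) :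
    (rootSystem H).root i (rhoCheck b) = 1 := by
  rw [apply_rhoCheck]
  have := b.toWeightBasis.constr_basis ℂ (fun _ => (1 : ℂ)) ⟨i, hi⟩
  rwa [b.toWeightBasis_apply] at this

lemma root_rhoCheck (i : H.root) : (rootSystem H).root i (rhoCheck b) = b.height i := by
  obtain ⟨f, -, -, hf⟩ := b.exists_root_eq_sum_int i
  rw [RootPairing.Base.height_eq_sum hf, hf, LinearMap.sum_apply, Int.cast_sum]
  refine Finset.sum_congr rfl fun j hj => ?_
  rw [LinearMap.smul_apply, root_rhoCheck_of_mem_support b hj, zsmul_eq_mul, mul_one]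

/-- The nonnegative integral combinations of the simple roots. -/
def posCone : AddSubmonoid (Dual ℂ H) :=
  AddSubmonoid.closure ((rootSystem H).root '' b.support)

lemma exists_of_mem_posCone {nu : Dual ℂ H} (h : nu ∈ posCone b) :
    ∃ n : b.support → ℕ, nu = ∑ i, n i • (rootSystem H).root i := by
  induction h using AddSubmonoid.closure_induction with
  | mem x hx =>
    obtain ⟨i, hi, rfl⟩ := hx
    classical
    refine ⟨Pi.single ⟨i, hi⟩ 1, ?_⟩
    rw [Finset.sum_eq_single ⟨i, hi⟩]
    · simp
    · intro j _ hj; simp [Pi.single_eq_of_ne hj]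
    · simp
  | zero => exact ⟨0, by simp⟩
  | add x y _ _ hx hy =>
    obtain ⟨n, rfl⟩ := hx
    obtain ⟨k, rfl⟩ := hy
    exact ⟨n + k, by simp [add_smul, Finset.sum_add_distrib]⟩

lemma sum_smul_root_rhoCheck (n : b.support → ℕ) :
    (∑ i, n i • (rootSystem H).root i : Dual ℂ H) (rhoCheck b) = ((∑ i, n i : ℕ) : ℂ) := by
  rw [LinearMap.sum_apply, Nat.cast_sum]
  refine Finset.sum_congr rfl fun i _ => ?_
  rw [LinearMap.smul_apply, root_rhoCheck_of_mem_support b i.2, nsmul_eq_mul, mul_one]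

lemma exists_nat_of_mem_posCone {nu : Dual ℂ H} (h : nu ∈ posCone b) :
    ∃ n : ℕ, nu (rhoCheck b) = n := by
  obtain ⟨n, rfl⟩ := exists_of_mem_posCone b h
  exact ⟨_, sum_smul_root_rhoCheck b n⟩

lemma posCone_re_nonneg {nu : Dual ℂ H} (h : nu ∈ posCone b) : 0 ≤ (nu (rhoCheck b)).re := by
  obtain ⟨n, hn⟩ := exists_nat_of_mem_posCone b h
  rw [hn, Complex.natCast_re]
  positivity

/-- Simple roots have height one, so every coefficient is at most the height. -/
lemma posCone_finite (K : ℝ) : {nu ∈ posCone b | (nu (rhoCheck b)).re ≤ K}.Finite := by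
  refine ((Set.Finite.pi' fun _ : b.support => Set.finite_Iic ⌊K⌋₊).image
    fun (n : b.support → ℕ) => ∑ i, n i • (rootSystem H).root i).subset ?_
  rintro nu ⟨h, hK⟩
  obtain ⟨n, rfl⟩ := exists_of_mem_posCone b h
  refine ⟨n, fun i => ?_, rfl⟩
  rw [sum_smul_root_rhoCheck, Complex.natCast_re] at hK
  exact (Finset.single_le_sum (fun _ _ => Nat.zero_le _) (Finset.mem_univ i)).trans
    (Nat.le_floor hK)

lemma one_le_root_rhoCheck {i : H.root} (hi : b.IsPos i) :
    1 ≤ ((rootSystem H).root i (rhoCheck b)).re := by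
  rw [root_rhoCheck, Complex.intCast_re]
  exact_mod_cast hi

lemma root_mem_posCone {i : H.root} (hi : b.IsPos i) : (rootSystem H).root i ∈ posCone b := by
  rcases b.root_mem_or_neg_mem i with h | h
  · exact h
  -- A positive root has height at least one, whereas its negative, if in the cone, would have
  -- height at least zero.
  · have h1 := posCone_re_nonneg b h
    have h2 := one_le_root_rhoCheck b hi
    rw [LinearMap.neg_apply, Complex.neg_re] at h1
    linarith

lemma weight_trichotomy (α : LieModule.Weight ℂ H g) :
    α.toLinear = 0 ∨ (∃ i, b.IsPos i ∧ α.toLinear = (rootSystem H).root i) ∨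
      ∃ i, b.IsPos i ∧ α.toLinear = -(rootSystem H).root i := by
  by_cases h : α.IsZero
  · exact Or.inl (LieModule.Weight.coe_toLinear_eq_zero_iff.mpr h)
  · have hα : α ∈ H.root := by simpa using h
    let := (rootSystem H).indexNeg
    rcases RootPairing.Base.IsPos.or_neg b ⟨α, hα⟩ with hi | hi
    · exact Or.inr (Or.inl ⟨_, hi, rfl⟩)
    · refine Or.inr (Or.inr ⟨_, hi, ?_⟩)
      rw [RootPairing.indexNeg_neg, RootPairing.root_reflectionPerm, RootPairing.reflection_apply_self,
        neg_neg]
      rfl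

/-- Induction over the triangular decomposition. -/
lemma triangular_induction {p : g → Prop} (x : g) (hH : ∀ h : H, p h)
    (hpos : ∀ i, b.IsPos i → ∀ y ∈ rootSpace H ((rootSystem H).root i), p y)
    (hneg : ∀ i, b.IsPos i → ∀ y ∈ rootSpace H (-(rootSystem H).root i), p y)
    (hadd : ∀ y z, p y → p z → p (y + z)) : p x := by
  have hx : x ∈ (⨆ α : LieModule.Weight ℂ H g, rootSpace H α) := by
    rw [LieModule.iSup_genWeightSpace_eq_top']; trivial
  induction hx using LieSubmodule.iSup_induction' with
  | mem α y hy =>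
    rcases weight_trichotomy b α with h | ⟨i, hi, h⟩ | ⟨i, hi, h⟩
    · have h0 : (α : H → ℂ) = 0 := by rw [← LieModule.Weight.coe_coe, h]; rfl
      rw [h0] at hy
      rw [LieAlgebra.rootSpace_zero_eq] at hy
      exact hH ⟨y, hy⟩
    · refine hpos i hi y ?_
      rw [← h]; exact hy
    · refine hneg i hi y ?_
      have : (-(rootSystem H).root i : H → ℂ) = α := by
        rw [← LieModule.Weight.coe_coe, h]; rfl
      rw [this]; exact hy
  | zero => exact hH 0
  | add y z _ _ hy hz => exact hadd y z hy hz

lemma iSup_weightSpace_induction {M : GMod g} (hM : ⨆ lam : Dual ℂ H, weightSpace M lam = ⊤)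
    {p : M → Prop} (m : M) (hp : ∀ lam : Dual ℂ H, ∀ m ∈ weightSpace M lam, p m)
    (hadd : ∀ m n, p m → p n → p (m + n)) : p m := by
  have hm : m ∈ ⨆ lam : Dual ℂ H, weightSpace M lam := hM ▸ Submodule.mem_top
  induction hm using Submodule.iSup_induction' with
  | mem lam m hm => exact hp lam m hm
  | zero => exact hp 0 0 (Submodule.zero_mem _)
  | add m n _ _ hm hn => exact hadd m n hm hn

/-! ### Modules with bounded weights -/

/-- `M` is a weight module with finite-dimensional weight spaces and its weights lie in a finite
union of cones `mu - ℕ Φ⁺`. -/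
structure IsBounded (M : GMod g) : Prop where
  weight : ⨆ lam : Dual ℂ H, weightSpace M lam = ⊤
  finite : ∀ lam : Dual ℂ H, FiniteDimensional ℂ (weightSpace M lam)
  cone : ∃ T : Finset (Dual ℂ H), ∀ lam : Dual ℂ H, weightSpace M lam ≠ ⊥ →
    ∃ mu ∈ T, mu - lam ∈ posCone b

variable {b}

/-- Independence of the weight spaces forces each of them to be the sum of the `A i` of that weight.
A spanning family of weight subspaces thus suffices to test boundedness, even if its sum is not
direct. -/
lemma IsBounded.of_family {ι : Type*} {M : GMod g} (A : ι → Submodule ℂ M) (f : ι → Dual ℂ H)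
    (hA : ∀ i, A i ≤ weightSpace M (f i)) (htop : ⨆ i, A i = ⊤)
    (hfd : ∀ i, FiniteDimensional ℂ (A i))
    (hfin : ∀ lam, {i | A i ≠ ⊥ ∧ f i = lam}.Finite) (T : Finset (Dual ℂ H))
    (hT : ∀ i, A i ≠ ⊥ → ∃ mu ∈ T, mu - f i ∈ posCone b) : IsBounded b M where
  weight := top_le_iff.mp (htop ▸ iSup_le fun i => le_iSup_of_le (f i) (hA i))
  finite lam := by
    rw [eq_iSup_fiber_of_iSupIndep (iSupIndep_weightSpace M) hA htop lam]
    have : (⨆ i : {i // f i = lam}, A i) = ⨆ i : {i | A i ≠ ⊥ ∧ f i = lam}, A i := by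
      refine le_antisymm (iSup_le fun i => ?_)
        (iSup_le fun i => le_iSup (fun i : {i // f i = lam} => A i) ⟨i, i.2.2⟩)
      by_cases h : A i = ⊥
      · rw [h]; exact bot_le
      · exact le_iSup (fun i : {i | A i ≠ ⊥ ∧ f i = lam} => A i) ⟨i, h, i.2⟩
    rw [this]
    have := (hfin lam).to_subtype
    exact Submodule.finiteDimensional_iSup _
  cone := by
    refine ⟨T, fun lam hlam => ?_⟩
    rw [eq_iSup_fiber_of_iSupIndep (iSupIndep_weightSpace M) hA htop lam, Ne, iSup_eq_bot, not_forall] at hlam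
    obtain ⟨⟨i, rfl⟩, hi⟩ := hlam
    exact hT i hi

/-- Each of the finitely many cones has only finitely many elements above a given height. This
supplies maximal weights and finite-dimensional spaces of generators. -/
lemma IsBounded.finite_weights {M : GMod g} (hM : IsBounded b M) (r : ℝ) :
    {lam : Dual ℂ H | weightSpace M lam ≠ ⊥ ∧ r ≤ (lam (rhoCheck b)).re}.Finite := by
  obtain ⟨T, hT⟩ := hM.cone
  refine (T.finite_toSet.biUnion fun mu _ =>
    (posCone_finite b ((mu (rhoCheck b)).re - r)).image fun nu => mu - nu).subset ?_
  rintro lam ⟨h, hr⟩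
  obtain ⟨mu, hmu, hc⟩ := hT lam h
  refine Set.mem_biUnion hmu ⟨mu - lam, ⟨hc, ?_⟩, sub_sub_cancel _ _⟩
  rw [LinearMap.sub_apply, Complex.sub_re]
  linarith

end Semisimple

section Semisimple

variable {g : Type u} [LieRing g] [LieAlgebra ℂ g] [FiniteDimensional ℂ g]
  [LieAlgebra.IsSemisimple ℂ g] {H : LieSubalgebra ℂ g} [H.IsCartanSubalgebra]

open LieAlgebra LieAlgebra.IsKilling Module

variable (b : (rootSystem H).Base)

/-! ### The Casimir element -/

section Casimir

variable {ι : Type*} [Fintype ι] [DecidableEq ι] (e : Basis ι ℂ g)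

/-- The basis dual to `e` with respect to the Killing form. -/
def killingDual : Basis ι ℂ g :=
  LinearMap.BilinForm.dualBasis (killingForm ℂ g) (IsKilling.killingForm_nondegenerate ℂ g) e

lemma killingForm_killingDual (i j : ι) :
    killingForm ℂ g (killingDual e i) (e j) = if j = i then 1 else 0 :=
  LinearMap.BilinForm.apply_dualBasis_left _ _ _ _

lemma sum_killingDual (x : g) : ∑ i, killingForm ℂ g x (e i) • killingDual e i = x := by
  conv_rhs => rw [← (killingDual e).sum_repr x]
  refine Finset.sum_congr rfl fun i _ => ?_
  rw [killingDual, LinearMap.BilinForm.dualBasis_repr_apply]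

lemma sum_killingDual' (x : g) : ∑ i, killingForm ℂ g (killingDual e i) x • e i = x := by
  conv_rhs => rw [← e.sum_repr x]
  refine Finset.sum_congr rfl fun i _ => ?_
  congr 1
  conv_lhs => rw [← e.sum_repr x]
  rw [map_sum]
  simp_rw [map_smul, killingForm_killingDual]
  simp

/-- The Casimir element of `U(g)`. -/
def casimir : U g :=
  ∑ i, UniversalEnvelopingAlgebra.ι ℂ (e i) * UniversalEnvelopingAlgebra.ι ℂ (killingDual e i)

lemma killingForm_lie_left (x y z : g) :
    killingForm ℂ g ⁅x, y⁆ z = -killingForm ℂ g y ⁅x, z⁆ := by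
  exact LieModule.traceForm_apply_lie_apply' ℂ g g x y z

lemma sum_killingForm_mul_killingDual (x : g) :
    ∑ i, killingForm ℂ g x (e i) * killingForm ℂ g x (killingDual e i) = killingForm ℂ g x x := by
  have := congrArg (killingForm ℂ g x) (sum_killingDual e x)
  simpa only [map_sum, map_smul, smul_eq_mul] using this

/-- By invariance of the Killing form, the matrices of `ad x` in the two dual bases are negative
transposes of each other. -/
lemma casimir_mem_center : casimir e ∈ Subalgebra.center ℂ (U g) := by
  have key (x : g) : Commute (UniversalEnvelopingAlgebra.ι ℂ x) (casimir e) := by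
    have h (y z : g) : UniversalEnvelopingAlgebra.ι ℂ x *
        (UniversalEnvelopingAlgebra.ι ℂ y * UniversalEnvelopingAlgebra.ι ℂ z) -
        (UniversalEnvelopingAlgebra.ι ℂ y * UniversalEnvelopingAlgebra.ι ℂ z) *
          UniversalEnvelopingAlgebra.ι ℂ x =
        UniversalEnvelopingAlgebra.ι ℂ ⁅x, y⁆ * UniversalEnvelopingAlgebra.ι ℂ z +
          UniversalEnvelopingAlgebra.ι ℂ y * UniversalEnvelopingAlgebra.ι ℂ ⁅x, z⁆ := by
      simp only [LieHom.map_lie, LieRing.of_associative_ring_bracket]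
      noncomm_ring
    have h1 (i : ι) : UniversalEnvelopingAlgebra.ι ℂ ⁅x, e i⁆ =
        ∑ j, killingForm ℂ g (killingDual e j) ⁅x, e i⁆ • UniversalEnvelopingAlgebra.ι ℂ (e j) := by
      conv_lhs => rw [← sum_killingDual' e ⁅x, e i⁆]
      simp only [map_sum, map_smul]
    have h2 (j : ι) : UniversalEnvelopingAlgebra.ι ℂ ⁅x, killingDual e j⁆ =
        ∑ i, killingForm ℂ g ⁅x, killingDual e j⁆ (e i) •
          UniversalEnvelopingAlgebra.ι ℂ (killingDual e i) := by
      conv_lhs => rw [← sum_killingDual e ⁅x, killingDual e j⁆]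
      simp only [map_sum, map_smul]
    change _ * _ = _ * _
    rw [← sub_eq_zero, casimir, Finset.mul_sum, Finset.sum_mul, ← Finset.sum_sub_distrib]
    simp only [h, Finset.sum_add_distrib, h1, h2, Finset.sum_mul, Finset.mul_sum,
      smul_mul_assoc, mul_smul_comm]
    -- After exchanging the summations, both double sums run over the same products `e j *
    -- killingDual e i`, with opposite coefficients.
    rw [Finset.sum_comm, ← Finset.sum_add_distrib]
    refine Finset.sum_eq_zero fun j _ => ?_
    rw [← Finset.sum_add_distrib]
    refine Finset.sum_eq_zero fun i _ => ?_
    rw [killingForm_lie_left, neg_smul, add_neg_cancel]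
  refine Subalgebra.mem_center_iff.mpr fun u => ?_
  change Commute u _
  induction u using U_induction with
  | hc c => exact Algebra.commutes c _
  | hι x => exact key x
  | hadd a c ha hc => exact ha.add_left hc
  | hmul a c ha hc => exact ha.mul_left hc

lemma counit_casimir : counit g (casimir e) = 0 := by
  rw [casimir, map_sum]
  refine Finset.sum_eq_zero fun i _ => ?_
  rw [map_mul, counit_ι, zero_mul]

lemma act_casimir (M : GMod g) (m : M) :
    act M (casimir e) m = ∑ i, ⁅e i, ⁅killingDual e i, m⁆⁆ := by
  rw [casimir, map_sum, LinearMap.sum_apply]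
  refine Finset.sum_congr rfl fun i _ => ?_
  rw [map_mul, Module.End.mul_apply, act_ι, act_ι]

end Casimir

/-- The element of the Cartan subalgebra corresponding to a weight under the Killing form. -/
abbrev cartanOf : Dual ℂ H ≃ₗ[ℂ] H := (cartanEquivDual H).symm

lemma killingForm_cartanOf (mu : Dual ℂ H) (h : H) :
    killingForm ℂ g (cartanOf mu) h = mu h := by
  exact LinearMap.congr_fun ((cartanEquivDual H).apply_symm_apply mu) h

lemma cartanOf_comm (mu nu : Dual ℂ H) : mu (cartanOf nu) = nu (cartanOf mu) := by
  rw [← killingForm_cartanOf, ← killingForm_cartanOf, LieModule.traceForm_comm]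

lemma coe_mem_rootSpace_zero (h : H) : (h : g) ∈ rootSpace H (0 : H → ℂ) := by
  rw [rootSpace_zero_eq]; exact h.2

lemma weight_eq_of_toLinear {α : LieModule.Weight ℂ H g} {f : Dual ℂ H} (h : α.toLinear = f) :
    (α : H → ℂ) = f := by
  rw [← LieModule.Weight.coe_coe, h]

/-- For `α = 0` both factors act by scalars. For `α` positive, `x y m = y x m + ⁅x, y⁆ m`, where the
first term is in `W` and `⁅x, y⁆` lies in `H`, so `s = ⁅x, y⁆`. For `α` negative, `y m` is already
in `W`. The product of Killing values vanishes when `α ≠ 0`, which allows one formula for all cases.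
-/
lemma casimir_term (α : LieModule.Weight ℂ H g) {x y : g} (hx : x ∈ rootSpace H α)
    (hy : y ∈ rootSpace H (-α : H → ℂ)) : ∃ s : H, ∀ (M : GMod g) (W : LieSubmodule ℂ g M)
      (mu : Dual ℂ H) (m : M), m ∈ weightSpace M mu →
      (∀ i, b.IsPos i → ∀ z ∈ rootSpace H ((rootSystem H).root i), ⁅z, m⁆ ∈ W) →
      ⁅x, ⁅y, m⁆⁆ - (killingForm ℂ g (cartanOf mu) x * killingForm ℂ g (cartanOf mu) y +
        mu s) • m ∈ W := by
  have hxy : ⁅x, y⁆ ∈ rootSpace H (0 : H → ℂ) := by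
    have := lie_mem_genWeightSpace_of_mem_genWeightSpace hx hy
    rwa [add_neg_cancel] at this
  rw [rootSpace_zero_eq] at hxy
  have hk (mu : Dual ℂ H) (h : (α : H → ℂ) ≠ 0) : killingForm ℂ g (cartanOf mu) x = 0 :=
    killingForm_apply_eq_zero_of_mem_rootSpace_of_add_ne_zero ℂ g H
      (coe_mem_rootSpace_zero _) hx (by rwa [zero_add])
  by_cases h0 : (α : H → ℂ) = 0
  · rw [h0] at hx hy
    rw [neg_zero] at hy
    rw [rootSpace_zero_eq] at hx hy
    refine ⟨0, fun M W mu m hm _ => ?_⟩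
    rw [killingForm_cartanOf mu ⟨x, hx⟩, killingForm_cartanOf mu ⟨y, hy⟩]
    rw [mem_weightSpace_iff] at hm
    have h1 : ⁅x, m⁆ = mu ⟨x, hx⟩ • m := hm ⟨x, hx⟩
    have h2 : ⁅y, m⁆ = mu ⟨y, hy⟩ • m := hm ⟨y, hy⟩
    rw [h2, lie_smul, h1, map_zero, add_zero, smul_smul, mul_comm, sub_self]
    exact W.zero_mem
  · rcases weight_trichotomy b α with h | ⟨i, hi, h⟩ | ⟨i, hi, h⟩
    · exact absurd (weight_eq_of_toLinear h) h0
    · refine ⟨⟨⁅x, y⁆, hxy⟩, fun M W mu m hm hpos => ?_⟩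
      rw [mem_weightSpace_iff] at hm
      rw [hk mu h0, zero_mul, zero_add, ← hm, sub_eq_of_eq_add' (leibniz_lie x y m)]
      rw [weight_eq_of_toLinear h] at hx
      exact W.lie_mem (hpos i hi x hx)
    · refine ⟨0, fun M W mu m hm hpos => ?_⟩
      rw [hk mu h0, zero_mul, zero_add, map_zero, zero_smul, sub_zero]
      rw [weight_eq_of_toLinear h] at hy
      refine W.lie_mem (hpos i hi y ?_)
      convert hy using 2
      ext z
      simp

/-- Invariance of the Killing form makes `ad h` act on the dual vector by the negative eigenvalue.
-/
lemma killingDual_mem_rootSpace {ι : Type*} [Fintype ι] [DecidableEq ι] (e : Basis ι ℂ g)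
    {w : ι → LieModule.Weight ℂ H g} (he : ∀ a, e a ∈ rootSpace H (w a)) (a : ι) :
    killingDual e a ∈ rootSpace H (-w a : H → ℂ) := by
  refine LieModule.weightSpace_le_genWeightSpace g _ ?_
  rw [LieModule.mem_weightSpace]
  intro h
  change ⁅(h : g), killingDual e a⁆ = _
  rw [← sum_killingDual e ⁅(h : g), killingDual e a⁆, Finset.sum_eq_single a]
  · rw [killingForm_lie_left, show ⁅(h : g), e a⁆ = w a h • e a from
        lie_eq_smul_of_mem_rootSpace (he a) h, map_smul, killingForm_killingDual, if_pos rfl, smul_eq_mul, mul_one]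
    rfl
  · intro c _ hc
    rw [killingForm_lie_left, show ⁅(h : g), e c⁆ = w c h • e c from
        lie_eq_smul_of_mem_rootSpace (he c) h, map_smul, killingForm_killingDual, if_neg hc, smul_zero, neg_zero, zero_smul]
  · simp

lemma exists_basis_mem_rootSpace (H : LieSubalgebra ℂ g) [H.IsCartanSubalgebra] :
    ∃ (n : ℕ) (e : Basis (Fin n) ℂ g) (w : Fin n → LieModule.Weight ℂ H g),
      ∀ a, e a ∈ rootSpace H (w a) := by
  classical
  have hint : DirectSum.IsInternal
      fun α : LieModule.Weight ℂ H g => (rootSpace H α).toSubmodule := by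
    refine DirectSum.isInternal_submodule_of_iSupIndep_of_iSup_eq_top ?_ ?_
    · exact LieSubmodule.iSupIndep_toSubmodule.mpr (LieModule.iSupIndep_genWeightSpace' ℂ H g)
    · rw [← LieSubmodule.iSup_toSubmodule, LieModule.iSup_genWeightSpace_eq_top',
        LieSubmodule.top_toSubmodule]
  let e := hint.collectedBasis fun α => Module.finBasis ℂ (rootSpace H α).toSubmodule
  refine ⟨_, e.reindex (Fintype.equivFin _), fun a => ((Fintype.equivFin _).symm a).1, fun a => ?_⟩
  rw [Basis.reindex_apply]
  exact hint.collectedBasis_mem _ _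

/-- This is the eigenvalue of the Casimir element on highest weight vectors, with `s` the sum of the
brackets contributed by positive roots. It is taken modulo a submodule `W` because it will be
applied to vectors that are singular only in `M / W`. -/
lemma exists_casimir : ∃ (C : Subalgebra.center ℂ (U g)) (s : H), counit g C = 0 ∧
    ∀ (M : GMod g) (W : LieSubmodule ℂ g M) (mu : Dual ℂ H) (m : M), m ∈ weightSpace M mu →
      (∀ i, b.IsPos i → ∀ z ∈ rootSpace H ((rootSystem H).root i), ⁅z, m⁆ ∈ W) →
      act M (C : U g) m - (mu (cartanOf mu) + mu s) • m ∈ W := by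
  obtain ⟨n, e, w, he⟩ := exists_basis_mem_rootSpace H
  choose s hs using fun a => casimir_term b (w a) (he a) (killingDual_mem_rootSpace e he a)
  refine ⟨⟨casimir e, casimir_mem_center e⟩, ∑ a, s a, counit_casimir e,
    fun M W mu m hm hpos => ?_⟩
  have hsum : mu (cartanOf mu) + mu (∑ a, s a) =
      ∑ a, (killingForm ℂ g (cartanOf mu) (e a) *
        killingForm ℂ g (cartanOf mu) (killingDual e a) + mu (s a)) := by
    rw [Finset.sum_add_distrib, map_sum, ← killingForm_cartanOf mu (cartanOf mu),
      sum_killingForm_mul_killingDual]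
  change act M (casimir e) m - _ ∈ W
  rw [act_casimir, hsum, Finset.sum_smul, ← Finset.sum_sub_distrib]
  exact sum_mem fun a _ => hs a M W mu m hm hpos

/-! ### Growth of the Casimir eigenvalues -/

lemma killingForm_coe_eq_sum (x y : H) :
    killingForm ℂ g x y = ∑ i : H.root, (rootSystem H).root i x * (rootSystem H).root i y := by
  have := LinearMap.congr_fun₂ (restrict_killingForm_eq_sum (K := ℂ) (L := g) (H := H)) x y
  rw [← Finset.sum_coe_sort] at this
  rw [LinearMap.sum_apply, LinearMap.sum_apply] at this
  exact this

/-- Roots take integral values on coroots, and the root `j` corresponds to `c / 2` times its coroot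
with `c = (α_j, α_j)`. The norm of the coroot is `4 / c`, and it is also a sum of squares of
integers, so `c` is real. -/
lemma exists_real_root_cartanOf (i j : H.root) :
    ∃ r : ℝ, (rootSystem H).root i (cartanOf ((rootSystem H).root j)) = r := by
  have hint (k : H.root) : ∃ r : ℝ, (rootSystem H).root k (coroot j.1) = r := by
    exact ⟨(LieModule.chainBotCoeff j.1 k.1 - LieModule.chainTopCoeff j.1 k.1 : ℤ), by
      rw [Complex.ofReal_intCast]; exact apply_coroot_eq_cast j.1 k.1⟩
  choose r hr using hint
  set c := j.1 ((cartanEquivDual H).symm j.1.toLinear) with hc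
  have h1 : killingForm ℂ g (coroot j.1) (coroot j.1) = 4 * c⁻¹ := by
    have h2 : j.1 (coroot j.1) = 2 := root_apply_coroot (LieSubalgebra.isNonZero_coe_root j)
    have h3 := traceForm_coroot (K := ℂ) (L := g) (H := H) j.1 (coroot j.1)
    rw [h2] at h3
    refine Eq.trans h3 ?_
    rw [← hc, nsmul_eq_mul, smul_eq_mul]
    push_cast
    ring
  rw [killingForm_coe_eq_sum] at h1
  simp only [hr] at h1
  have hc0 : c ≠ 0 := root_apply_cartanEquivDual_symm_ne_zero (LieSubalgebra.isNonZero_coe_root j)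
  have h4 : cartanOf ((rootSystem H).root j) = (c / 2) • coroot j.1 := by
    rw [coroot, ← hc, ← Nat.cast_smul_eq_nsmul ℂ, smul_smul, smul_smul]
    have : c / 2 * ((2 : ℕ) : ℂ) * c⁻¹ = 1 := by push_cast; field_simp
    rw [this, one_smul]
    rfl
  have h5 : c = ((4 * (∑ k, r k * r k)⁻¹ : ℝ) : ℂ) := by
    push_cast
    rw [h1]
    field_simp
  refine ⟨4 * (∑ k, r k * r k)⁻¹ / 2 * r i, ?_⟩
  rw [h4, map_smul, smul_eq_mul, hr, h5]
  push_cast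
  ring

/-- The Cauchy–Schwarz inequality for a positive weight and `rhoCheck b`. -/
lemma exists_sq_le_apply_cartanOf : ∃ K : ℝ, 0 ≤ K ∧ ∀ nu ∈ posCone b,
    (nu (rhoCheck b)).re ^ 2 ≤ K * (nu (cartanOf nu)).re := by
  refine ⟨∑ i : H.root, (b.height i : ℝ) ^ 2, by positivity, fun nu hnu => ?_⟩
  have hreal (i : H.root) : ∃ r : ℝ, (rootSystem H).root i (cartanOf nu) = r := by
    obtain ⟨n, rfl⟩ := exists_of_mem_posCone b hnu
    choose r hr using fun j : b.support => exists_real_root_cartanOf (H := H) i j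
    refine ⟨∑ j, n j * r j, ?_⟩
    rw [map_sum, map_sum, Complex.ofReal_sum]
    refine Finset.sum_congr rfl fun j _ => ?_
    rw [map_nsmul, map_nsmul, hr, nsmul_eq_mul]
    push_cast
    rfl
  choose r hr using hreal
  have h1 : nu (cartanOf nu) = ((∑ i, r i ^ 2 : ℝ) : ℂ) := by
    rw [← killingForm_cartanOf, killingForm_coe_eq_sum]
    push_cast
    refine Finset.sum_congr rfl fun i _ => ?_
    rw [hr, sq]
  have h2 : nu (rhoCheck b) = ((∑ i, b.height i * r i : ℝ) : ℂ) := by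
    rw [← killingForm_cartanOf, killingForm_coe_eq_sum]
    push_cast
    refine Finset.sum_congr rfl fun i _ => ?_
    rw [hr, root_rhoCheck, mul_comm]
  rw [h1, h2, Complex.ofReal_re, Complex.ofReal_re]
  exact Finset.sum_mul_sq_le_sq_mul_sq _ _ _

lemma exists_abs_re_le (w : H) : ∃ K : ℝ, 0 ≤ K ∧ ∀ nu ∈ posCone b,
    |(nu w).re| ≤ K * (nu (rhoCheck b)).re := by
  refine ⟨∑ i : b.support, |((rootSystem H).root i w).re|, by positivity, fun nu hnu => ?_⟩
  obtain ⟨n, rfl⟩ := exists_of_mem_posCone b hnu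
  rw [sum_smul_root_rhoCheck, Complex.natCast_re, LinearMap.sum_apply, Complex.re_sum]
  refine (Finset.abs_sum_le_sum_abs _ _).trans ?_
  rw [Finset.sum_mul]
  refine Finset.sum_le_sum fun i _ => ?_
  rw [LinearMap.smul_apply, nsmul_eq_mul, ← Complex.ofReal_natCast, Complex.re_ofReal_mul, abs_mul,
    Nat.abs_cast, mul_comm]
  gcongr
  exact Finset.single_le_sum (f := n) (fun _ _ => Nat.zero_le _) (Finset.mem_univ i)

lemma exists_casimir_bound (s : H) (mu : Dual ℂ H) : ∃ K : ℝ, ∀ nu ∈ posCone b,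
    (mu - nu) (cartanOf (mu - nu)) + (mu - nu) s = 0 → (nu (rhoCheck b)).re ≤ K := by
  obtain ⟨A, hA, hA'⟩ := exists_sq_le_apply_cartanOf b
  obtain ⟨B, hB, hB'⟩ := exists_abs_re_le b (2 • cartanOf mu + s)
  set d := (mu (cartanOf mu) + mu s).re
  -- With `t` the height of `nu`, the vanishing of the eigenvalue gives `t ^ 2 ≤ A * (B * t + |d|)`.
  -- The summand `1` makes `t > 1` in the contrary case, so that `A * |d| ≤ A * |d| * t`.
  refine ⟨A * B + A * |d| + 1, fun nu hnu h => ?_⟩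
  have h1 : nu (cartanOf nu) = nu (2 • cartanOf mu + s) - (mu (cartanOf mu) + mu s) := by
    have h2 := cartanOf_comm mu nu
    simp only [map_sub, LinearMap.sub_apply] at h
    rw [h2] at h
    rw [map_add, map_nsmul, nsmul_eq_mul]
    push_cast
    linear_combination h
  have h3 := hA' nu hnu
  rw [h1, Complex.sub_re] at h3
  set t := (nu (rhoCheck b)).re
  have h4 := (le_abs_self _).trans (hB' nu hnu)
  have h5 := neg_abs_le d
  have h6 : t ^ 2 ≤ A * (B * t + |d|) := h3.trans (by gcongr; linarith)
  by_contra! hc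
  have h7 : 0 ≤ A * B := by positivity
  have h8 : 0 ≤ A * |d| := by positivity
  nlinarith

end Semisimple

section Semisimple

variable {g : Type u} [LieRing g] [LieAlgebra ℂ g] [FiniteDimensional ℂ g]
  [LieAlgebra.IsSemisimple ℂ g] {H : LieSubalgebra ℂ g} [H.IsCartanSubalgebra]

open LieAlgebra LieAlgebra.IsKilling Module

/-! ### Generation over `n₋` -/

variable (b : (rootSystem H).Base)

lemma rootSpace_neg_le_nMinus {i : H.root} (hi : b.IsPos i) {y : g}
    (hy : y ∈ rootSpace H (-(rootSystem H).root i)) : y ∈ nMinus b :=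
  LieSubalgebra.subset_lieSpan (Set.mem_iUnion.mpr ⟨⟨i, hi⟩, hy⟩)

lemma rootSpace_le_nPlus {i : H.root} (hi : b.IsPos i) {y : g}
    (hy : y ∈ rootSpace H ((rootSystem H).root i)) : y ∈ nPlus b :=
  LieSubalgebra.subset_lieSpan (Set.mem_iUnion.mpr ⟨⟨i, hi⟩, hy⟩)

lemma lie_mem_of_mem_nMinus {M : GMod g} {N : Submodule ℂ M}
    (hN : ∀ i, b.IsPos i → ∀ y ∈ rootSpace H (-(rootSystem H).root i), ∀ m ∈ N, ⁅y, m⁆ ∈ N)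
    {x : g} (hx : x ∈ nMinus b) {m : M} (hm : m ∈ N) : ⁅x, m⁆ ∈ N := by
  induction hx using LieSubalgebra.lieSpan_induction generalizing m with
  | mem y hy =>
    obtain ⟨⟨i, hi⟩, hy⟩ := Set.mem_iUnion.mp hy
    exact hN i hi y hy m hm
  | zero => rw [zero_lie]; exact N.zero_mem
  | add y z _ _ hy hz => rw [add_lie]; exact N.add_mem (hy hm) (hz hm)
  | smul c y _ hy => rw [smul_lie]; exact N.smul_mem c (hy hm)
  | lie y z _ _ hy hz => rw [lie_lie]; exact N.sub_mem (hy (hz hm)) (hz (hy hm))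

/-- The `n₋`-submodule generated by a subspace stable under the Cartan subalgebra and under the
positive root spaces is stable under `g`. -/
lemma exists_lieSubmodule_eq_lieSpan {M : GMod g} {V : Submodule ℂ M}
    (hH : ∀ h : H, ∀ m ∈ V, ⁅(h : g), m⁆ ∈ V)
    (hpos : ∀ i, b.IsPos i → ∀ y ∈ rootSpace H ((rootSystem H).root i), ∀ m ∈ V, ⁅y, m⁆ ∈ V) :
    ∃ W : LieSubmodule ℂ g M,
      W.toSubmodule = (LieSubmodule.lieSpan ℂ (nMinus b) (V : Set M)).toSubmodule := by
  set W := LieSubmodule.lieSpan ℂ (nMinus b) (V : Set M)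
  have hneg (x : g) (hx : x ∈ nMinus b) (m : M) (hm : m ∈ W) : ⁅x, m⁆ ∈ W :=
    W.lie_mem (x := ⟨x, hx⟩) hm
  have key (m : M) (hm : m ∈ W) : ∀ x : g, ⁅x, m⁆ ∈ W := by
    induction hm using LieSubmodule.lieSpan_induction with
    | mem m hm =>
      intro x
      induction x using triangular_induction b with
      | hH h => exact LieSubmodule.subset_lieSpan (hH h m hm)
      | hpos i hi y hy => exact LieSubmodule.subset_lieSpan (hpos i hi y hy m hm)
      | hneg i hi y hy =>
        exact hneg y (rootSpace_neg_le_nMinus b hi hy) m (LieSubmodule.subset_lieSpan hm)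
      | hadd y z hy hz => rw [add_lie]; exact W.add_mem hy hz
    | zero => intro x; rw [lie_zero]; exact W.zero_mem
    | add m n _ _ hm hn => intro x; rw [lie_add]; exact W.add_mem (hm x) (hn x)
    | smul c m _ hm => intro x; rw [lie_smul]; exact W.smul_mem c (hm x)
    | lie y m hm' hm =>
      intro x
      change ⁅x, ⁅(y : g), m⁆⁆ ∈ W
      -- The induction hypothesis on `m` covers all of `g`, so it applies to `⁅x, y⁆` as well as to
      -- `x`.
      rw [leibniz_lie]
      exact W.add_mem (hm _) (hneg y y.2 _ (hm x))
  exact ⟨{ W.toSubmodule with lie_mem := fun {x m} hm => key m hm x }, rfl⟩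

/-- The span of all `y₁ ⋯ yₖ v` for `yⱼ` in the root spaces of the negatives of the given roots. -/
def wordSpace {M : GMod g} (v : M) : List {i // b.IsPos i} → Submodule ℂ M
  | [] => Submodule.span ℂ {v}
  | i :: l => Submodule.map₂ (LieModule.toEnd ℂ g M : g →ₗ[ℂ] Module.End ℂ M)
      (rootSpace H (-(rootSystem H).root i.1)).toSubmodule (wordSpace v l)

/-- The weight of `wordSpace`. -/
def wordWeight (l : List {i // b.IsPos i}) : Dual ℂ H :=
  (l.map fun i => (rootSystem H).root i.1).sum

lemma wordSpace_le {M : GMod g} {v : M} {mu : Dual ℂ H} (hv : v ∈ weightSpace M mu)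
    (l : List {i // b.IsPos i}) : wordSpace b v l ≤ weightSpace M (mu - wordWeight b l) := by
  induction l with
  | nil => simpa [wordSpace, wordWeight] using hv
  | cons i l ih =>
    refine Submodule.map₂_le.mpr fun y hy m hm => ?_
    have := lie_mem_weightSpace (α := -(rootSystem H).root i.1) hy (ih hm)
    have h : mu - wordWeight b (i :: l) =
        mu - wordWeight b l + -(rootSystem H).root i.1 := by
      simp only [wordWeight, List.map_cons, List.sum_cons]
      abel
    rw [h]
    exact this

lemma wordSpace_finite {M : GMod g} (v : M) (l : List {i // b.IsPos i}) :
    FiniteDimensional ℂ (wordSpace b v l) := by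
  induction l with
  | nil => exact FiniteDimensional.span_singleton ℂ v
  | cons i l ih =>
    refine Module.Finite.iff_fg.mpr (Submodule.FG.map₂ _ ?_ (Module.Finite.iff_fg.mp ih))
    exact Module.Finite.iff_fg.mp inferInstance

lemma wordWeight_mem (l : List {i // b.IsPos i}) : wordWeight b l ∈ posCone b := by
  refine AddSubmonoid.list_sum_mem _ fun x hx => ?_
  obtain ⟨i, _, rfl⟩ := List.mem_map.mp hx
  exact root_mem_posCone b i.2

lemma length_le_wordWeight (l : List {i // b.IsPos i}) :
    (l.length : ℝ) ≤ (wordWeight b l (rhoCheck b)).re := by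
  induction l with
  | nil => simp [wordWeight]
  | cons i l ih =>
    simp only [wordWeight, List.map_cons, List.sum_cons, List.length_cons, LinearMap.add_apply,
      Complex.add_re] at ih ⊢
    push_cast
    linarith [one_le_root_rhoCheck b i.2]

/-! ### Modules in category `O` are bounded. -/

lemma exists_finset_weight_vectors {M : GMod g} (hM : ⨆ lam : Dual ℂ H, weightSpace M lam = ⊤)
    (m : M) : ∃ F : Finset M, (∀ x ∈ F, ∃ lam : Dual ℂ H, x ∈ weightSpace M lam) ∧
      m ∈ Submodule.span ℂ (F : Set M) := by
  classical
  induction m using iSup_weightSpace_induction hM with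
  | hp lam m hm =>
    exact ⟨{m}, fun x hx => ⟨lam, (Finset.mem_singleton.mp hx) ▸ hm⟩,
      Submodule.subset_span (by simp)⟩
  | hadd m n hm hn =>
    obtain ⟨F, hF, hm⟩ := hm
    obtain ⟨F', hF', hn⟩ := hn
    refine ⟨F ∪ F', fun x hx => (Finset.mem_union.mp hx).elim (hF x) (hF' x), ?_⟩
    exact Submodule.add_mem _ (Submodule.span_mono (by simp) hm) (Submodule.span_mono (by simp) hn)

/-- The generators may be replaced by finitely many weight vectors. Words in negative root vectors
applied to them span the module, and each word lowers the weight by an element of the cone.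
Arbitrary words suffice; they need be neither ordered nor linearly independent. -/
lemma IsO.isBounded {M : GMod g} (hM : IsO b M) : IsBounded b M := by
  classical
  obtain ⟨hw, S, hS⟩ := hM
  choose F hF hmF using exists_finset_weight_vectors hw
  let S' : Finset M := S.biUnion F
  have hS' (s : S') : ∃ lam : Dual ℂ H, (s : M) ∈ weightSpace M lam := by
    obtain ⟨m, _, hm⟩ := Finset.mem_biUnion.mp s.2
    exact hF m s hm
  choose lam hlam using hS'
  let A : S' × List {i // b.IsPos i} → Submodule ℂ M := fun p => wordSpace b (p.1 : M) p.2
  have hstable : ∀ i, b.IsPos i → ∀ y ∈ rootSpace H (-(rootSystem H).root i),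
      ∀ m ∈ ⨆ p, A p, ⁅y, m⁆ ∈ ⨆ p, A p := by
    intro i hi y hy m hm
    induction hm using Submodule.iSup_induction' with
    | mem p m hm =>
      exact Submodule.mem_iSup_of_mem (p.1, ⟨i, hi⟩ :: p.2) (Submodule.apply_mem_map₂ _ hy hm)
    | zero => rw [lie_zero]; exact Submodule.zero_mem _
    | add m n _ _ hm hn => rw [lie_add]; exact Submodule.add_mem _ hm hn
  let N : LieSubmodule ℂ (nMinus b) M :=
    { (⨆ p, A p) with lie_mem := fun {x m} hm => lie_mem_of_mem_nMinus b hstable x.2 hm }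
  have htop : ⨆ p, A p = ⊤ := by
    have : N = ⊤ := by
      rw [← top_le_iff, ← hS, LieSubmodule.lieSpan_le]
      intro m hm
      change m ∈ ⨆ p, A p
      refine Submodule.span_le.mpr ?_ (hmF m)
      intro x hx
      refine Submodule.mem_iSup_of_mem (⟨x, Finset.mem_biUnion.mpr ⟨m, hm, hx⟩⟩, []) ?_
      exact Submodule.mem_span_singleton_self x
    exact congrArg LieSubmodule.toSubmodule this
  refine IsBounded.of_family A (fun p => lam p.1 - wordWeight b p.2)
    (fun p => wordSpace_le b (hlam p.1) p.2) htop (fun p => wordSpace_finite b _ _) (fun mu => ?_)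
    (Finset.univ.image lam) (fun p _ => ⟨lam p.1, by simp, ?_⟩)
  -- Every letter has height at least one, so the words that lead from `lam s` to `mu` have length
  -- at most the height of `lam s - mu`.
  · refine (Set.finite_iUnion fun s : S' => ((List.finite_length_le {i // b.IsPos i}
      ⌊((lam s - mu) (rhoCheck b)).re⌋₊).image fun l => (s, l))).subset ?_
    rintro ⟨s, l⟩ ⟨-, rfl⟩
    refine Set.mem_iUnion.mpr ⟨s, l, ?_, rfl⟩
    refine Nat.le_floor ?_
    rw [sub_sub_cancel]
    exact length_le_wordWeight b l
  · rw [sub_sub_cancel]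
    exact wordWeight_mem b _

/-- The sum of the weight spaces as a submodule. -/
def weightPart (H : LieSubalgebra ℂ g) [H.IsCartanSubalgebra] (M : GMod g) : LieSubmodule ℂ g M :=
  { (⨆ lam : Dual ℂ H, weightSpace M lam) with
    lie_mem := fun {x m} hm => by
      change ⁅x, m⁆ ∈ ⨆ lam : Dual ℂ H, weightSpace M lam
      have hx : x ∈ (⨆ α : LieModule.Weight ℂ H g, rootSpace H α) := by
        rw [LieModule.iSup_genWeightSpace_eq_top']; trivial
      replace hm : m ∈ ⨆ lam : Dual ℂ H, weightSpace M lam := hm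
      induction hm using Submodule.iSup_induction' with
      | mem lam m hm =>
        induction hx using LieSubmodule.iSup_induction' with
        | mem α y hy =>
          exact Submodule.mem_iSup_of_mem (lam + α.toLinear)
            (lie_mem_weightSpace (α := α.toLinear) hy hm)
        | zero => rw [zero_lie]; exact Submodule.zero_mem _
        | add y z _ _ hy hz => rw [add_lie]; exact Submodule.add_mem _ hy hz
      | zero => rw [lie_zero]; exact Submodule.zero_mem _
      | add m n _ _ hm hn => rw [lie_add]; exact Submodule.add_mem _ hm hn }

/-! ### Verma modules belong to category `O`. -/

lemma act_mem {M : GMod g} (N : LieSubmodule ℂ g M) (u : U g) {m : M} (hm : m ∈ N) :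
    act M u m ∈ N := by
  induction u using U_induction generalizing m with
  | hc c => rw [AlgHom.commutes, Module.algebraMap_end_apply]; exact N.smul_mem c hm
  | hι x => rw [act_ι]; exact N.lie_mem hm
  | hadd a c ha hc => rw [map_add, LinearMap.add_apply]; exact N.add_mem (ha hm) (hc hm)
  | hmul a c ha hc => rw [map_mul, Module.End.mul_apply]; exact ha (hc hm)

lemma act_vermaMk (lam : Dual ℂ H) (u w : U g) :
    act (verma b lam) u (vermaMk b lam w) = vermaMk b lam (u * w) := by
  induction u using U_induction generalizing w with
  | hc c => simp [Algebra.algebraMap_eq_smul_one]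
  | hι x => rw [act_ι]; rfl
  | hadd a c ha hc => rw [map_add, LinearMap.add_apply, ha, hc, add_mul, map_add]
  | hmul a c ha hc => rw [map_mul, Module.End.mul_apply, hc, ha, mul_assoc]

lemma verma_eq_top {lam : Dual ℂ H} {N : LieSubmodule ℂ g (verma b lam)}
    (h : vermaMk b lam 1 ∈ N) : N = ⊤ := by
  refine eq_top_iff.mpr fun q _ => ?_
  obtain ⟨u, rfl⟩ := Submodule.Quotient.mk_surjective _ q
  have := act_mem N u h
  rwa [act_vermaMk, mul_one] at this

lemma vermaMk_one_mem (lam : Dual ℂ H) : vermaMk b lam 1 ∈ weightSpace (verma b lam) lam := by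
  rw [mem_weightSpace_iff]
  intro h
  rw [lie_vermaMk, mul_one, vermaMk_cartan]

/-- The line through the highest weight vector is stable under `H` and the positive root spaces, so
its `n₋`-span is a `g`-submodule containing the generator. -/
lemma isO_verma (lam : Dual ℂ H) : IsO b (verma b lam) := by
  refine ⟨congrArg LieSubmodule.toSubmodule (verma_eq_top b (N := weightPart H _)
    (Submodule.mem_iSup_of_mem lam (vermaMk_one_mem b lam))), {vermaMk b lam 1}, ?_⟩
  obtain ⟨W, hW⟩ := exists_lieSubmodule_eq_lieSpan b (M := verma b lam)
    (V := Submodule.span ℂ {vermaMk b lam 1})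
    (fun h m hm => by
      obtain ⟨c, rfl⟩ := Submodule.mem_span_singleton.mp hm
      rw [lie_smul, (mem_weightSpace_iff.mp (vermaMk_one_mem b lam)) h]
      exact Submodule.smul_mem _ _ (Submodule.smul_mem _ _ (Submodule.mem_span_singleton_self _)))
    (fun i hi y hy m hm => by
      obtain ⟨c, rfl⟩ := Submodule.mem_span_singleton.mp hm
      rw [lie_smul, lie_vermaMk, mul_one, vermaMk_nPlus b lam (rootSpace_le_nPlus b hi hy),
        smul_zero]
      exact Submodule.zero_mem _)
  have h1 : vermaMk b lam 1 ∈ W := by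
    rw [← LieSubmodule.mem_toSubmodule, hW]
    exact LieSubmodule.subset_lieSpan (Submodule.mem_span_singleton_self _)
  rw [verma_eq_top b h1] at hW
  refine eq_top_iff.mpr fun q _ => ?_
  have hq : q ∈ (LieSubmodule.lieSpan ℂ (nMinus b)
      ((Submodule.span ℂ {vermaMk b lam 1} : Submodule ℂ _) : Set (verma b lam))).toSubmodule :=
    hW ▸ Submodule.mem_top
  refine LieSubmodule.lieSpan_le.mpr ?_ hq
  intro m hm
  obtain ⟨c, rfl⟩ := Submodule.mem_span_singleton.mp hm
  exact (LieSubmodule.lieSpan ℂ (nMinus b) _).smul_mem c (LieSubmodule.subset_lieSpan (by simp))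

/-! ### Tensor products of bounded modules. -/

lemma tmul_mem_weightSpace {M N : GMod g} {lam mu : Dual ℂ H} {m : M} {n : N}
    (hm : m ∈ weightSpace M lam) (hn : n ∈ weightSpace N mu) :
    m ⊗ₜ[ℂ] n ∈ weightSpace (GMod.tensor M N) (lam + mu) := by
  rw [mem_weightSpace_iff] at *
  intro h
  rw [TensorProduct.LieModule.lie_tmul_right, hm, hn, LinearMap.add_apply, add_smul,
    smul_tmul', tmul_smul]

variable {b}

lemma IsBounded.tensor {M N : GMod g} (hM : IsBounded b M) (hN : IsBounded b N) :
    IsBounded b (GMod.tensor M N) := by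
  classical
  have hfM := hM.finite
  have hfN := hN.finite
  obtain ⟨S, hS⟩ := hM.cone
  obtain ⟨T, hT⟩ := hN.cone
  have hne (p : Dual ℂ H × Dual ℂ H)
      (hp : Submodule.map₂ (TensorProduct.mk ℂ M N) (weightSpace M p.1) (weightSpace N p.2) ≠ ⊥) :
      (∃ mu ∈ S, mu - p.1 ∈ posCone b) ∧ ∃ mu ∈ T, mu - p.2 ∈ posCone b := by
    refine ⟨hS _ fun h => hp ?_, hT _ fun h => hp ?_⟩
    · rw [h, Submodule.map₂_bot_left]
    · rw [h, Submodule.map₂_bot_right]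
  refine IsBounded.of_family (ι := Dual ℂ H × Dual ℂ H)
    (fun p => Submodule.map₂ (TensorProduct.mk ℂ M N) (weightSpace M p.1) (weightSpace N p.2))
    (fun p => p.1 + p.2) (fun p => Submodule.map₂_le.mpr fun m hm n hn =>
      tmul_mem_weightSpace hm hn) ?_ (fun p => ?_) (fun lam => ?_)
    (Finset.image₂ (· + ·) S T) (fun p hp => ?_)
  · refine eq_top_iff.mpr fun t _ => ?_
    induction t using TensorProduct.induction_on with
    | zero => exact Submodule.zero_mem _
    | add s t hs ht => exact Submodule.add_mem _ (hs trivial) (ht trivial)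
    | tmul m n =>
      induction m using iSup_weightSpace_induction hM.weight with
      | hadd m m' hm hm' => rw [add_tmul]; exact Submodule.add_mem _ (hm trivial) (hm' trivial)
      | hp lam m hm =>
        induction n using iSup_weightSpace_induction hN.weight with
        | hadd n n' hn hn' => rw [tmul_add]; exact Submodule.add_mem _ (hn trivial) (hn' trivial)
        | hp mu n hn =>
          exact Submodule.mem_iSup_of_mem (lam, mu) (Submodule.apply_mem_map₂ _ hm hn)
  · exact Module.Finite.iff_fg.mpr (Submodule.FG.map₂ _ (Module.Finite.iff_fg.mp (hfM _))
      (Module.Finite.iff_fg.mp (hfN _)))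
  -- If weights `p.1` and `p.2` sum to `lam`, then `mu - p.1` and `nu - p.2` lie in the cone and
  -- their heights add up to that of `mu + nu - lam`. Each of them is therefore one of finitely
  -- many.
  · refine ((S.finite_toSet.prod T.finite_toSet).biUnion fun p _ =>
      ((posCone_finite b (((p.1 + p.2 - lam) (rhoCheck b)).re)).prod
        (posCone_finite b (((p.1 + p.2 - lam) (rhoCheck b)).re))).image
          fun q => (p.1 - q.1, p.2 - q.2)).subset ?_
    rintro p ⟨hp, rfl⟩
    obtain ⟨⟨mu, hmu, h1⟩, nu, hnu, h2⟩ := hne p hp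
    have h1' := posCone_re_nonneg b h1
    have h2' := posCone_re_nonneg b h2
    refine Set.mem_biUnion (x := (mu, nu)) ⟨hmu, hnu⟩
      ⟨(mu - p.1, nu - p.2), ⟨⟨h1, ?_⟩, ⟨h2, ?_⟩⟩, by simp⟩
    all_goals
      simp only [LinearMap.sub_apply, LinearMap.add_apply, Complex.sub_re, Complex.add_re]
        at h1' h2' ⊢
      linarith
  · obtain ⟨⟨mu, hmu, h1⟩, nu, hnu, h2⟩ := hne p hp
    refine ⟨mu + nu, Finset.mem_image₂_of_mem hmu hnu, ?_⟩
    rw [add_sub_add_comm]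
    exact add_mem h1 h2

end Semisimple

section Semisimple

variable {g : Type u} [LieRing g] [LieAlgebra ℂ g] [FiniteDimensional ℂ g]
  [LieAlgebra.IsSemisimple ℂ g] {H : LieSubalgebra ℂ g} [H.IsCartanSubalgebra]

open LieAlgebra LieAlgebra.IsKilling Module

/-! ### Decomposition into blocks -/

/-- The difference of the two commuting nilpotents is the scalar `c - d`, up to sign, and a
nilpotent scalar on a nonzero space is zero. -/
lemma eq_of_isNilpotent_sub {P : Type*} [AddCommGroup P] [Module ℂ P] [Nontrivial P]
    {T : Module.End ℂ P} {c d : ℂ} (hc : IsNilpotent (T - algebraMap ℂ (Module.End ℂ P) c))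
    (hd : IsNilpotent (T - algebraMap ℂ (Module.End ℂ P) d)) : c = d := by
  have hcomm : Commute (T - algebraMap ℂ (Module.End ℂ P) d)
      (T - algebraMap ℂ (Module.End ℂ P) c) :=
    ((Commute.refl T).sub_right (Algebra.commutes c T).symm).sub_left
      (Algebra.commutes d _)
  have h := hcomm.isNilpotent_sub hd hc
  rw [sub_sub_sub_cancel_left, ← map_sub] at h
  have h2 : IsNilpotent (c - d) :=
    (IsNilpotent.map_iff (FaithfulSMul.algebraMap_injective ℂ (Module.End ℂ P))).mp h
  exact sub_eq_zero.mp h2.eq_zero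

/-- Simultaneous generalised eigenspaces are indexed by arbitrary functions. Uniqueness of the
generalised eigenvalue makes such a function an algebra homomorphism, so only central characters
contribute. -/
lemma exists_algHom_of_isNilpotent_sub {A P : Type*} [CommRing A] [Algebra ℂ A] [AddCommGroup P]
    [Module ℂ P] [Nontrivial P] (r : A →ₐ[ℂ] Module.End ℂ P) (χ : A → ℂ)
    (h : ∀ z, IsNilpotent (r z - algebraMap ℂ (Module.End ℂ P) (χ z))) :
    ∃ ψ : A →ₐ[ℂ] ℂ, ∀ z, ψ z = χ z := by
  have hr (z z' : A) : Commute (r z) (r z') := by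
    change _ * _ = _ * _
    rw [← map_mul, ← map_mul, mul_comm]
  have hC (z : A) (c : ℂ) (T : Module.End ℂ P) : Commute T (algebraMap ℂ (Module.End ℂ P) c) :=
    (Algebra.commutes c T).symm
  have hadd (z z' : A) : χ (z + z') = χ z + χ z' := by
    refine eq_of_isNilpotent_sub (h _) ?_
    have hcomm : Commute (r z - algebraMap ℂ (Module.End ℂ P) (χ z))
        (r z' - algebraMap ℂ (Module.End ℂ P) (χ z')) :=
      ((hr z z').sub_right (hC z _ _)).sub_left (hC z _ _).symm
    have := hcomm.isNilpotent_add (h z) (h z')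
    rwa [← add_sub_add_comm, ← map_add, ← map_add] at this
  have hmul (z z' : A) : χ (z * z') = χ z * χ z' := by
    refine eq_of_isNilpotent_sub (h _) ?_
    have e : r (z * z') - algebraMap ℂ (Module.End ℂ P) (χ z * χ z') =
        (r z - algebraMap ℂ (Module.End ℂ P) (χ z)) * r z' +
          algebraMap ℂ (Module.End ℂ P) (χ z) *
            (r z' - algebraMap ℂ (Module.End ℂ P) (χ z')) := by
      rw [map_mul, map_mul]
      noncomm_ring
    rw [e]
    have h1 : Commute (r z - algebraMap ℂ (Module.End ℂ P) (χ z)) (r z') :=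
      (hr z z').sub_left (hC z _ _).symm
    have h2 : Commute (r z - algebraMap ℂ (Module.End ℂ P) (χ z))
        (r z' - algebraMap ℂ (Module.End ℂ P) (χ z')) := h1.sub_right (hC z _ _)
    have h3 : Commute (r z') (r z' - algebraMap ℂ (Module.End ℂ P) (χ z')) :=
      (Commute.refl _).sub_right (hC z _ _)
    refine Commute.isNilpotent_add ?_ (h1.isNilpotent_mul_right (h z))
      ((hC z _ _).symm.isNilpotent_mul_left (h z'))
    exact (((hC z _ _).mul_right h2)).mul_left ((hC z _ _).mul_right h3)
  have hcomm (c : ℂ) : χ (algebraMap ℂ A c) = c := by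
    refine eq_of_isNilpotent_sub (h _) ?_
    rw [AlgHom.commutes, sub_self]
    exact IsNilpotent.zero
  exact ⟨{ toFun := χ
           map_one' := by simpa using hcomm 1
           map_mul' := hmul
           map_zero' := by simpa using hcomm 0
           map_add' := hadd
           commutes' := hcomm }, fun _ => rfl⟩

lemma act_center_commute (M : GMod g) (z : Subalgebra.center ℂ (U g)) (u : U g) :
    Commute (act M (z : U g)) (act M u) := by
  change _ * _ = _ * _
  rw [← map_mul, ← map_mul, Subalgebra.mem_center_iff.mp z.2]

lemma act_center_lie (M : GMod g) (z : Subalgebra.center ℂ (U g)) (x : g) (m : M) :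
    act M (z : U g) ⁅x, m⁆ = ⁅x, act M (z : U g) m⁆ := by
  rw [← act_ι, ← act_ι]
  exact LinearMap.congr_fun (act_center_commute M z _) m

lemma act_center_mem_weightSpace {M : GMod g} (z : Subalgebra.center ℂ (U g)) {lam : Dual ℂ H}
    {m : M} (hm : m ∈ weightSpace M lam) : act M (z : U g) m ∈ weightSpace M lam := by
  rw [mem_weightSpace_iff] at *
  intro h
  rw [← act_center_lie, hm, map_smul]

lemma mem_blockPart_iff {χ : CentralChar g} {M : GMod g} {m : M} :
    m ∈ blockPart χ M ↔ m ∈ ⨅ z : Subalgebra.center ℂ (U g),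
      (act M (z : U g)).maxGenEigenspace (χ z) := by
  rw [Module.End.mem_iInf_maxGenEigenspace_iff]
  simp only [← Algebra.algebraMap_eq_smul_one]
  rfl

lemma iSupIndep_blockPart (M : GMod g) :
    iSupIndep fun χ : CentralChar g => (blockPart χ M).toSubmodule := by
  have h := Module.End.independent_iInf_maxGenEigenspace_of_forall_mapsTo
    (fun z : Subalgebra.center ℂ (U g) => act M (z : U g))
    (fun z z' φ => Module.End.mapsTo_maxGenEigenspace_of_comm
      (act_center_commute M z' (z : U g)) φ)
  have h' := h.comp (f := fun χ : CentralChar g => (χ : Subalgebra.center ℂ (U g) → ℂ))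
    DFunLike.coe_injective
  exact h'.mono fun χ m hm => mem_blockPart_iff.mp hm

lemma otherPart_toSubmodule (M : GMod g) : (otherPart M).toSubmodule =
    ⨆ χ : {χ : CentralChar g // χ ≠ principalChar g}, (blockPart χ.1 M).toSubmodule :=
  LieSubmodule.iSup_toSubmodule _

lemma disjoint_principalPart_otherPart (M : GMod g) :
    Disjoint (principalPart M).toSubmodule (otherPart M).toSubmodule := by
  rw [otherPart_toSubmodule,
    iSup_subtype (f := fun χ : {χ : CentralChar g // χ ≠ principalChar g} =>
      (blockPart χ.1 M).toSubmodule)]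
  exact iSupIndep_blockPart M (principalChar g)

/-- Commuting operators on a finite-dimensional complex space decompose it into simultaneous
generalised eigenspaces. Each nonzero one belongs to a central character. -/
lemma finite_le_iSup_blockPart {M : GMod g} {V : Submodule ℂ M} [FiniteDimensional ℂ V]
    (hV : ∀ z : Subalgebra.center ℂ (U g), ∀ m ∈ V, act M (z : U g) m ∈ V) :
    V ≤ ⨆ χ : CentralChar g, (blockPart χ M).toSubmodule := by
  let f : Subalgebra.center ℂ (U g) → Module.End ℂ V := fun z => (act M (z : U g)).restrict (hV z)
  have hf : ⨆ χ : Subalgebra.center ℂ (U g) → ℂ, ⨅ z, (f z).maxGenEigenspace (χ z) = ⊤ := by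
    refine Module.End.iSup_iInf_maxGenEigenspace_eq_top_of_iSup_maxGenEigenspace_eq_top_of_commute
      f (fun z z' _ => ?_) fun z => Module.End.iSup_maxGenEigenspace_eq_top _
    refine LinearMap.ext fun m => Subtype.ext ?_
    exact LinearMap.congr_fun (act_center_commute M z (z' : U g)) (m : M)
  have hmap : V = ⨆ χ : Subalgebra.center ℂ (U g) → ℂ,
      V ⊓ ⨅ z : Subalgebra.center ℂ (U g), (act M (z : U g)).maxGenEigenspace (χ z) := by
    conv_lhs => rw [← V.map_subtype_top, ← hf, Submodule.map_iSup]
    refine iSup_congr fun χ => ?_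
    exact (Submodule.inf_iInf_maxGenEigenspace_of_forall_mapsTo
      (fun z : Subalgebra.center ℂ (U g) => act M (z : U g)) V hV).symm
  rw [hmap]
  refine iSup_le fun χ => ?_
  set P := V ⊓ ⨅ z : Subalgebra.center ℂ (U g), (act M (z : U g)).maxGenEigenspace (χ z)
    with hP
  by_cases hbot : P = ⊥
  · rw [hbot]; exact bot_le
  have : Nontrivial P := (Submodule.nontrivial_iff_ne_bot).mpr hbot
  have : FiniteDimensional ℂ P := Submodule.finiteDimensional_of_le (inf_le_left : P ≤ V)
  have hPz (z : Subalgebra.center ℂ (U g)) : ∀ m ∈ P, act M (z : U g) m ∈ P := by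
    rintro m ⟨hm, hm'⟩
    refine ⟨hV z m hm, ?_⟩
    rw [SetLike.mem_coe, Submodule.mem_iInf] at hm' ⊢
    exact fun z' => Module.End.mapsTo_maxGenEigenspace_of_comm
      (act_center_commute M z' (z : U g)) _ (hm' z')
  let r : Subalgebra.center ℂ (U g) →ₐ[ℂ] Module.End ℂ P :=
    { toFun := fun z => (act M (z : U g)).restrict (hPz z)
      map_one' := LinearMap.ext fun m => Subtype.ext (by simp)
      map_mul' := fun z z' => LinearMap.ext fun m => Subtype.ext (by simp)
      map_zero' := LinearMap.ext fun m => Subtype.ext (by simp)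
      map_add' := fun z z' => LinearMap.ext fun m => Subtype.ext (by simp)
      commutes' := fun c => LinearMap.ext fun m => Subtype.ext (by
        simp [Algebra.algebraMap_eq_smul_one]) }
  have hr (z) : IsNilpotent (r z - algebraMap ℂ (Module.End ℂ P) (χ z)) := by
    rw [Module.End.isNilpotent_iff_of_finite]
    intro m
    have hm := (Submodule.mem_iInf _).mp m.2.2 z
    rw [Module.End.mem_maxGenEigenspace] at hm
    obtain ⟨k, hk⟩ := hm
    refine ⟨k, Subtype.ext ?_⟩
    have : ∀ (k : ℕ) (m : P), (((r z - algebraMap ℂ (Module.End ℂ P) (χ z)) ^ k) m : M) =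
        ((act M (z : U g) - χ z • 1) ^ k) (m : M) := by
      intro k
      induction k with
      | zero => intro m; rfl
      | succ k ih =>
        intro m
        rw [pow_succ, pow_succ, Module.End.mul_apply, Module.End.mul_apply, ih]
        rfl
    rw [this, hk]
    rfl
  obtain ⟨ψ, hψ⟩ := exists_algHom_of_isNilpotent_sub r χ hr
  refine le_iSup_of_le ψ fun m hm => ?_
  refine mem_blockPart_iff.mpr ?_
  simp only [hψ]
  exact hm.2

variable {b : (rootSystem H).Base}

lemma IsBounded.splits {M : GMod g} (hM : IsBounded b M) : Splits M := by
  refine ⟨disjoint_principalPart_otherPart M, codisjoint_iff_le_sup.mpr ?_⟩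
  rw [← hM.weight]
  refine iSup_le fun lam => ?_
  have := hM.finite lam
  refine (finite_le_iSup_blockPart fun z m hm => act_center_mem_weightSpace z hm).trans ?_
  refine iSup_le fun χ => ?_
  by_cases h : χ = principalChar g
  · rw [h]; exact le_sup_left
  · rw [otherPart_toSubmodule]
    exact le_sup_of_le_right
      (le_iSup (fun χ : {χ : CentralChar g // χ ≠ principalChar g} =>
        (blockPart χ.1 M).toSubmodule) ⟨χ, h⟩)

/-! ### Membership in the principal block -/

lemma sub_pow_apply_mem {M : GMod g} {N : LieSubmodule ℂ g M} {T : Module.End ℂ M} {c : ℂ} {m : M}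
    (hT : ∀ m ∈ N, T m ∈ N) (h : T m - c • m ∈ N) (k : ℕ) : (T ^ k) m - c ^ k • m ∈ N := by
  induction k with
  | zero => simp
  | succ k ih =>
    have e : (T ^ (k + 1)) m - c ^ (k + 1) • m =
        T ((T ^ k) m - c ^ k • m) + c ^ k • (T m - c • m) := by
      rw [pow_succ' T, Module.End.mul_apply, map_sub, map_smul, smul_sub, smul_smul, pow_succ]
      abel
    rw [e]
    exact N.add_mem (hT _ ih) (N.smul_mem _ h)

lemma IsBounded.exists_lower_bound {M : GMod g} (hM : IsBounded b M) (s : H) :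
    ∃ r : ℝ, ∀ lam : Dual ℂ H, weightSpace M lam ≠ ⊥ → lam (cartanOf lam) + lam s = 0 →
      r ≤ (lam (rhoCheck b)).re := by
  obtain ⟨T, hT⟩ := hM.cone
  choose K hK using exists_casimir_bound b s
  -- A crude bound that serves all apexes `mu ∈ T` at once: the cone of `mu` by itself gives `(mu
  -- (rhoCheck b)).re - K mu`.
  refine ⟨-∑ mu ∈ T, |(mu (rhoCheck b)).re - K mu|, fun lam hlam h => ?_⟩
  obtain ⟨mu, hmu, hc⟩ := hT lam hlam
  have h1 := hK mu (mu - lam) hc (by rwa [sub_sub_cancel])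
  have h2 := Finset.single_le_sum (f := fun mu => |(mu (rhoCheck b)).re - K mu|)
    (fun _ _ => abs_nonneg _) hmu
  have h3 := neg_abs_le ((mu (rhoCheck b)).re - K mu)
  rw [LinearMap.sub_apply, Complex.sub_re] at h1
  linarith

/-- The weights above the bound `r` for vanishing Casimir eigenvalues are finite in number, and
their weight spaces generate: a weight of maximal height outside the generated submodule would give
a vector singular modulo it, with nonzero Casimir eigenvalue, which the principal block excludes. -/
lemma IsBounded.isO_of_principal {M : GMod g} (hM : IsBounded b M)
    (h0 : ∀ m : M, m ∈ principalPart M) : IsO b M := by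
  classical
  refine ⟨hM.weight, ?_⟩
  obtain ⟨C, s, hC0, hC⟩ := exists_casimir b
  obtain ⟨r, hr⟩ := hM.exists_lower_bound s
  have hfd := hM.finite
  have hfin := (hM.finite_weights r).to_subtype
  let V : Submodule ℂ M := ⨆ lam : {lam : Dual ℂ H | weightSpace M lam ≠ ⊥ ∧
    r ≤ (lam (rhoCheck b)).re}, weightSpace M lam.1
  have hVfd : FiniteDimensional ℂ V := Submodule.finiteDimensional_iSup _
  have hVle (lam : Dual ℂ H) (hlam : r ≤ (lam (rhoCheck b)).re) : weightSpace M lam ≤ V := by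
    by_cases h : weightSpace M lam = ⊥
    · rw [h]; exact bot_le
    · exact le_iSup (fun lam : {lam : Dual ℂ H | weightSpace M lam ≠ ⊥ ∧
        r ≤ (lam (rhoCheck b)).re} => weightSpace M lam.1) ⟨lam, h, hlam⟩
  obtain ⟨W, hW⟩ := exists_lieSubmodule_eq_lieSpan b (V := V)
    (fun h m hm => by
      induction hm using Submodule.iSup_induction' with
      | mem lam m hm =>
        rw [mem_weightSpace_iff.mp hm]
        exact V.smul_mem _ (hVle _ lam.2.2 hm)
      | zero => rw [lie_zero]; exact V.zero_mem
      | add m n _ _ hm hn => rw [lie_add]; exact V.add_mem hm hn)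
    (fun i hi y hy m hm => by
      induction hm using Submodule.iSup_induction' with
      | mem lam m hm =>
        refine hVle _ ?_ (lie_mem_weightSpace hy hm)
        have h1 := one_le_root_rhoCheck b hi
        have h2 : r ≤ (lam.1 (rhoCheck b)).re := lam.2.2
        rw [LinearMap.add_apply, Complex.add_re]
        linarith
      | zero => rw [lie_zero]; exact V.zero_mem
      | add m n _ _ hm hn => rw [lie_add]; exact V.add_mem hm hn)
  have hVW : V ≤ W.toSubmodule := by
    rw [hW]
    exact fun m hm => LieSubmodule.subset_lieSpan hm
  have htop : ∀ lam : Dual ℂ H, weightSpace M lam ≤ W.toSubmodule := by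
    by_contra! hcon
    obtain ⟨lam₀, h₀⟩ := hcon
    have hne {lam : Dual ℂ H} (h : ¬ weightSpace M lam ≤ W.toSubmodule) :
        weightSpace M lam ≠ ⊥ := fun h' => h (h' ▸ bot_le)
    have hfin' : {lam : Dual ℂ H | ¬ weightSpace M lam ≤ W.toSubmodule ∧
        (lam₀ (rhoCheck b)).re ≤ (lam (rhoCheck b)).re}.Finite :=
      (hM.finite_weights (lam₀ (rhoCheck b)).re).subset fun lam h => ⟨hne h.1, h.2⟩
    -- Restricting to heights at least that of `lam₀` leaves a finite set, so a maximum exists.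
    -- Positive root vectors raise the height and thus send this weight space into `W`.
    obtain ⟨lam, ⟨hlam, hle⟩, hmax⟩ := Set.exists_max_image _
      (fun lam : Dual ℂ H => (lam (rhoCheck b)).re) hfin' ⟨lam₀, h₀, le_rfl⟩
    obtain ⟨m, hm, hmW⟩ := SetLike.not_le_iff_exists.mp hlam
    have hpos : ∀ i, b.IsPos i → ∀ z ∈ rootSpace H ((rootSystem H).root i), ⁅z, m⁆ ∈ W := by
      intro i hi z hz
      by_contra hzW
      have h1 := one_le_root_rhoCheck b hi
      have h2 := hmax (lam + (rootSystem H).root i)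
        ⟨fun hle => hzW (hle (lie_mem_weightSpace hz hm)), by
          rw [LinearMap.add_apply, Complex.add_re]; linarith⟩
      rw [LinearMap.add_apply, Complex.add_re] at h2
      linarith
    have hcas := hC M W lam m hm hpos
    obtain ⟨k, hk⟩ := h0 m C
    have hχ : principalChar g C = 0 := hC0
    rw [hχ, map_zero, sub_zero] at hk
    have h3 := sub_pow_apply_mem (fun m hm => act_mem W (C : U g) hm) hcas k
    rw [hk, zero_sub, neg_mem_iff] at h3
    -- Some power of the Casimir eigenvalue times `m` lies in `W`. A zero eigenvalue puts `lam`
    -- above `r`, hence `m` in `V`; a nonzero one can be inverted. Both contradict `m ∉ W`.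
    refine hmW (hVle lam (hr lam (hne hlam) ?_) hm |> fun h => hVW h)
    by_contra hc
    refine hmW ?_
    have := W.smul_mem ((lam (cartanOf lam) + lam s) ^ k)⁻¹ h3
    rwa [smul_smul, inv_mul_cancel₀ (pow_ne_zero _ hc), one_smul] at this
  have hWtop : W.toSubmodule = ⊤ := top_le_iff.mp (hM.weight ▸ iSup_le htop)
  obtain ⟨S, hS⟩ := Module.Finite.iff_fg.mp hVfd
  refine ⟨S, eq_top_iff.mpr fun m _ => ?_⟩
  have hm : m ∈ LieSubmodule.lieSpan ℂ (nMinus b) (V : Set M) := by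
    rw [← LieSubmodule.mem_toSubmodule, ← hW, hWtop]
    trivial
  refine LieSubmodule.lieSpan_le.mpr ?_ hm
  rw [← hS]
  exact LieSubmodule.submodule_span_le_lieSpan

/-- Central elements commute with `n₋`, so the largest exponent needed on a finite generating set
works everywhere. -/
lemma exists_pow_eq_zero {M : GMod g} (hM : IsO b M) (h0 : ∀ m : M, m ∈ principalPart M)
    (z : Subalgebra.center ℂ (U g)) : ∃ k : ℕ,
      (act M (z : U g) - algebraMap ℂ (Module.End ℂ M) (principalChar g z)) ^ k = 0 := by
  obtain ⟨-, S, hS⟩ := hM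
  choose k hk using fun m => h0 m z
  set T := act M (z : U g) - algebraMap ℂ (Module.End ℂ M) (principalChar g z) with hT
  have hTx (x : g) : Commute T (act M (UniversalEnvelopingAlgebra.ι ℂ x)) :=
    (act_center_commute M z _).sub_left (Algebra.commutes _ _)
  refine ⟨S.sup k, LinearMap.ext fun m => ?_⟩
  have hm : m ∈ LieSubmodule.lieSpan ℂ (nMinus b) (S : Set M) := hS ▸ LieSubmodule.mem_top m
  change (T ^ S.sup k) m = 0
  induction hm using LieSubmodule.lieSpan_induction with
  | mem m hm =>
    obtain ⟨l, hl⟩ := Nat.exists_eq_add_of_le (Finset.le_sup (f := k) hm)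
    rw [hl, add_comm, pow_add, Module.End.mul_apply, hk, map_zero]
  | zero => exact map_zero _
  | add m n _ _ hm hn => rw [map_add, hm, hn, add_zero]
  | smul c m _ hm => rw [map_smul, hm, smul_zero]
  | lie x m _ hm =>
    change (T ^ S.sup k) ⁅(x : g), m⁆ = 0
    rw [← act_ι, ← Module.End.mul_apply, ((hTx x).pow_left _).eq, Module.End.mul_apply, hm, map_zero]

lemma IsBounded.isO0 {M : GMod g} (hM : IsBounded b M) (h0 : ∀ m : M, m ∈ principalPart M) :
    IsO0 b M :=
  ⟨hM.isO_of_principal h0, exists_pow_eq_zero (hM.isO_of_principal h0) h0⟩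

lemma act_coe {M : GMod g} (N : LieSubmodule ℂ g M) (u : U g) (m : N) :
    ((act (⟨N⟩ : GMod g) u m : N) : M) = act M u (m : M) :=
  act_map (M := ⟨N⟩) (N := M) ⟨N.incl⟩ u m

lemma mem_principalPart_proj0 {M : GMod g} (m : proj0 M) : m ∈ principalPart (proj0 M) := by
  intro z
  obtain ⟨k, hk⟩ := m.2 z
  refine ⟨k, Subtype.ext ?_⟩
  have : ∀ (k : ℕ) (m : proj0 M), (((act (proj0 M) (z : U g) -
      algebraMap ℂ (Module.End ℂ (proj0 M)) (principalChar g z)) ^ k) m).1 =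
        ((act M (z : U g) - algebraMap ℂ (Module.End ℂ M) (principalChar g z)) ^ k) m.1 := by
    intro k
    induction k with
    | zero => intro m; rfl
    | succ k ih =>
      intro m
      rw [pow_succ, pow_succ, Module.End.mul_apply, Module.End.mul_apply, ih]
      congr 1
      exact congrArg (· - principalChar g z • m.1) (act_coe _ _ m)
  rw [this, hk]
  rfl

/-- Bounded modules are stable under direct summands. -/
lemma IsBounded.of_retract {M N : GMod g} (hM : IsBounded b M) (i : N ⟶ M) (p : M ⟶ N)
    (h : i ≫ p = 𝟙 N) : IsBounded b N := by
  have hip (n : N) : p.hom (i.hom n) = n := congrArg (fun f : N ⟶ N => f.hom n) h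
  have hmap {M N : GMod g} (f : M ⟶ N) (lam : Dual ℂ H) (m : M) (hm : m ∈ weightSpace M lam) :
      f.hom m ∈ weightSpace N lam := by
    rw [mem_weightSpace_iff] at *
    intro x
    rw [← LieModuleHom.map_lie, hm, map_smul]
  have hinj : Function.Injective (i.hom : N →ₗ[ℂ] M) := fun x y hxy => by
    have := congrArg p.hom hxy
    rwa [LieModuleHom.coe_toLinearMap, hip, hip] at this
  refine ⟨eq_top_iff.mpr fun n _ => ?_, fun lam => ?_, ?_⟩
  · rw [← hip n]
    generalize i.hom n = m
    induction m using iSup_weightSpace_induction hM.weight with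
    | hp lam m hm => exact Submodule.mem_iSup_of_mem lam (hmap p lam m hm)
    | hadd m m' hm hm' => rw [map_add]; exact Submodule.add_mem _ hm hm'
  · have := hM.finite lam
    exact FiniteDimensional.of_injective ((i.hom : N →ₗ[ℂ] M).restrict (hmap i lam))
      fun x y hxy => Subtype.ext (hinj (congrArg Subtype.val hxy))
  · obtain ⟨T, hT⟩ := hM.cone
    refine ⟨T, fun lam hlam => hT lam fun h => hlam ?_⟩
    rw [Submodule.eq_bot_iff] at h ⊢
    exact fun n hn => hinj (by rw [map_zero]; exact h _ (hmap i lam n hn))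

lemma IsBounded.proj0 {M : GMod g} (hM : IsBounded b M) : IsBounded b (proj0 M) :=
  hM.of_retract (incl0 M) (pr0 M hM.splits) (pr0_incl0 hM.splits)

/-- No membership of `X` in a block, or in `O`, is needed. The same statement therefore serves
`Δ(0)` and its dual. -/
lemma IsBounded.actsOnO0 {X : GMod g} (hX : IsBounded b X) : ActsOnO0 b X where
  splits N := (hX.tensor (IsO.isBounded b N.property.1)).splits
  mem N := (hX.tensor (IsO.isBounded b N.property.1)).proj0.isO0 mem_principalPart_proj0

end Semisimple

section Semisimple

variable {g : Type u} [LieRing g] [LieAlgebra ℂ g] [FiniteDimensional ℂ g]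
  [LieAlgebra.IsSemisimple ℂ g] {H : LieSubalgebra ℂ g} [H.IsCartanSubalgebra]

open LieAlgebra LieAlgebra.IsKilling Module

/-! ### The comonad -/

/-- A morphism sends the other blocks of `M` into those of `N`, so what the first projection
discards would be discarded by the last one anyway. -/
lemma pr0_incl0_assoc {M N : GMod g} (f : M ⟶ N) (hM : Splits M) (hN : Splits N) :
    pr0 M hM ≫ incl0 M ≫ f ≫ pr0 N hN = f ≫ pr0 N hN := by
  rw [pr0_natural f hM hN, ← Category.assoc (incl0 M), pr0_incl0, Category.id_comp]

/-- The discarded part is mapped into the intersection of the principal part with the other blocks,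
which is zero. -/
lemma pr0_incl0_of_principal {M N : GMod g} (f : M ⟶ N) (hM : Splits M)
    (hN : ∀ n : N, n ∈ principalPart N) : pr0 M hM ≫ incl0 M ≫ f = f := by
  refine GMod.hom_ext fun m => ?_
  obtain ⟨a, ha, c, hc, rfl⟩ := hM.exists_add m
  rw [GMod.comp_hom_apply, GMod.comp_hom_apply, pr0_add hM ha hc, incl0_apply, map_add f.hom,
    Submodule.disjoint_def.mp (disjoint_principalPart_otherPart N) _ (hN _)
      (map_mem_otherPart f hc), add_zero]

variable (b : (rootSystem H).Base)

lemma verma_hom_ext {lam : Dual ℂ H} {M : GMod g} {f f' : verma b lam ⟶ M}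
    (h : f.hom (vermaMk b lam 1) = f'.hom (vermaMk b lam 1)) : f = f' := by
  refine GMod.hom_ext fun q => ?_
  obtain ⟨u, rfl⟩ := Submodule.Quotient.mk_surjective _ q
  change f.hom (vermaMk b lam u) = f'.hom (vermaMk b lam u)
  rw [← mul_one u, ← act_vermaMk, act_map, act_map, h]

lemma D_one : (D b).hom (vermaMk b 0 1) = vermaMk b 0 1 ⊗ₜ vermaMk b 0 1 := by
  rw [D_mk, map_one]
  rfl

lemma E_one : GMod.trivialEquiv ((E b).hom (vermaMk b 0 1)) = 1 := by
  rw [E_mk, map_one]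

/-- Both sides are morphisms that send the generator `v` to `v ⊗ (v ⊗ v)`. -/
lemma D_coassoc : D b ≫ GMod.tensorMap (D b) (𝟙 _) ≫ GMod.assoc _ _ _ =
    D b ≫ GMod.tensorMap (𝟙 _) (D b) := by
  refine verma_hom_ext b ?_
  change (GMod.assoc _ _ _).hom ((GMod.tensorMap (D b) (𝟙 (verma b 0))).hom
    ((D b).hom (vermaMk b 0 1))) =
      (GMod.tensorMap (𝟙 (verma b 0)) (D b)).hom ((D b).hom (vermaMk b 0 1))
  rw [D_one]
  change (GMod.assoc _ _ _).hom ((D b).hom (vermaMk b 0 1) ⊗ₜ vermaMk b 0 1) =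
    vermaMk b 0 1 ⊗ₜ (D b).hom (vermaMk b 0 1)
  rw [D_one]
  rfl

lemma D_left_counit (N : GMod g) : GMod.tensorMap (D b) (𝟙 N) ≫ GMod.assoc _ _ _ ≫
    GMod.tensorMap (E b) (𝟙 _) ≫ GMod.leftUnit _ = 𝟙 _ := by
  have h : D b ≫ GMod.tensorMap (E b) (𝟙 _) ≫ GMod.leftUnit _ = 𝟙 _ := by
    refine verma_hom_ext b ?_
    change (GMod.leftUnit _).hom ((GMod.tensorMap (E b) (𝟙 (verma b 0))).hom
      ((D b).hom (vermaMk b 0 1))) = vermaMk b 0 1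
    rw [D_one]
    change GMod.trivialEquiv ((E b).hom (vermaMk b 0 1)) • vermaMk b 0 1 = _
    rw [E_one, one_smul]
  refine GMod.tensor_hom_ext fun t n => ?_
  have h' := congrArg (fun f => GMod.Hom.hom f t ⊗ₜ[ℂ] n) h
  refine Eq.trans ?_ h'
  change (GMod.leftUnit _).hom ((GMod.tensorMap (E b) (𝟙 (GMod.tensor (verma b 0) N))).hom
    ((GMod.assoc _ _ _).hom ((D b).hom t ⊗ₜ[ℂ] n))) =
      (GMod.leftUnit _).hom ((GMod.tensorMap (E b) (𝟙 (verma b 0))).hom ((D b).hom t)) ⊗ₜ[ℂ] n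
  generalize (D b).hom t = w
  induction w using TensorProduct.induction_on with
  | zero => rw [zero_tmul, map_zero, map_zero, map_zero, map_zero, map_zero, zero_tmul]
  | tmul x y => rfl
  | add x y hx hy =>
    rw [add_tmul, map_add, map_add, map_add, hx, hy, map_add, map_add, add_tmul]

/-- The contraction `φ` of the second tensor factor by `E` is a morphism because `E` vanishes on
`⁅x, n⁆`. Then `D b ≫ φ` fixes the generator, and tensoring with `N` gives the claim. -/
lemma D_right_counit (N : GMod g) : GMod.tensorMap (D b) (𝟙 N) ≫ GMod.assoc _ _ _ ≫
    GMod.tensorMap (𝟙 _) (GMod.tensorMap (E b) (𝟙 _) ≫ GMod.leftUnit _) = 𝟙 _ := by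
  let Φ : GMod.tensor (verma b 0) (verma b 0) →ₗ[ℂ] verma b 0 :=
    TensorProduct.lift ((LinearMap.lsmul ℂ (verma b 0)).flip.compl₂
      (GMod.trivialEquiv.toLinearMap ∘ₗ ((E b).hom : _ →ₗ[ℂ] GMod.trivial g)))
  have hΦ (x : g) (w : GMod.tensor (verma b 0) (verma b 0)) : Φ ⁅x, w⁆ = ⁅x, Φ w⁆ := by
    induction w using TensorProduct.induction_on with
    | zero => simp
    | tmul m n =>
      rw [TensorProduct.LieModule.lie_tmul_right, map_add]
      have e : (E b).hom ⁅x, n⁆ = 0 := by rw [LieModuleHom.map_lie]; rfl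
      simp [Φ, e]
    | add m n hm hn => rw [lie_add, map_add, map_add, lie_add, hm, hn]
  let φ : GMod.tensor (verma b 0) (verma b 0) ⟶ verma b 0 := ⟨{ Φ with map_lie' := hΦ _ _ }⟩
  have hφ : D b ≫ φ = 𝟙 _ := by
    refine verma_hom_ext b ?_
    rw [GMod.comp_hom_apply, D_one]
    change GMod.trivialEquiv ((E b).hom (vermaMk b 0 1)) • vermaMk b 0 1 = _
    rw [E_one, one_smul]
    rfl
  refine GMod.tensor_hom_ext fun t n => ?_
  have h' := congrArg (fun f => GMod.Hom.hom f t ⊗ₜ[ℂ] n) hφ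
  refine Eq.trans ?_ h'
  change (GMod.tensorMap (𝟙 (verma b 0)) (GMod.tensorMap (E b) (𝟙 N) ≫ GMod.leftUnit _)).hom
    ((GMod.assoc _ _ _).hom ((D b).hom t ⊗ₜ[ℂ] n)) = Φ ((D b).hom t) ⊗ₜ[ℂ] n
  generalize (D b).hom t = w
  induction w using TensorProduct.induction_on with
  | zero => rw [zero_tmul, map_zero, map_zero, map_zero, zero_tmul]
  | tmul x y =>
    change x ⊗ₜ[ℂ] (GMod.trivialEquiv ((E b).hom y) • n) =
      (GMod.trivialEquiv ((E b).hom y) • x) ⊗ₜ[ℂ] n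
    rw [tmul_smul, smul_tmul']
  | add x y hx hy => rw [add_tmul, map_add, map_add, hx, hy, map_add, add_tmul]

lemma pentagon (M N P Q : GMod g) : GMod.assoc (GMod.tensor M N) P Q ≫ GMod.assoc M N _ =
    GMod.tensorMap (GMod.assoc M N P) (𝟙 Q) ≫ GMod.assoc _ _ _ ≫
      GMod.tensorMap (𝟙 M) (GMod.assoc N P Q) := by
  refine GMod.tensor_hom_ext fun t q => ?_
  induction t using TensorProduct.induction_on with
  | zero => simp
  | add a c ha hc => rw [add_tmul, map_add, map_add, ha, hc]
  | tmul t p =>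
    induction t using TensorProduct.induction_on with
    | zero => simp
    | add a c ha hc => rw [add_tmul, add_tmul, map_add, map_add, ha, hc]
    | tmul m n => rfl

lemma assoc_natural_left {M M' : GMod g} (N P : GMod g) (φ : M ⟶ M') :
    GMod.tensorMap (GMod.tensorMap φ (𝟙 N)) (𝟙 P) ≫ GMod.assoc M' N P =
      GMod.assoc M N P ≫ GMod.tensorMap φ (𝟙 _) := by
  refine GMod.tensor_hom_ext fun t p => ?_
  induction t using TensorProduct.induction_on with
  | zero => simp
  | add a c ha hc => rw [add_tmul, map_add, map_add, ha, hc]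
  | tmul m n => rfl

lemma assoc_natural_middle (M : GMod g) {N N' : GMod g} (P : GMod g) (φ : N ⟶ N') :
    GMod.tensorMap (GMod.tensorMap (𝟙 M) φ) (𝟙 P) ≫ GMod.assoc M N' P =
      GMod.assoc M N P ≫ GMod.tensorMap (𝟙 M) (GMod.tensorMap φ (𝟙 P)) := by
  refine GMod.tensor_hom_ext fun t p => ?_
  induction t using TensorProduct.induction_on with
  | zero => simp
  | add a c ha hc => rw [add_tmul, map_add, map_add, ha, hc]
  | tmul m n => rfl

lemma tensorMap_comp_left {M N P : GMod g} (X : GMod g) (φ : M ⟶ N) (ψ : N ⟶ P) :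
    GMod.tensorMap (φ ≫ ψ) (𝟙 X) = GMod.tensorMap φ (𝟙 X) ≫ GMod.tensorMap ψ (𝟙 X) :=
  GMod.tensor_hom_ext fun _ _ => rfl

/-- The pentagon and the naturality of the associator collect all the associators at the end,
leaving `D_coassoc` tensored with `N`. -/
lemma D_coassoc_tensor (N : GMod g) :
    GMod.tensorMap (D b) (𝟙 N) ≫ GMod.assoc _ _ _ ≫ GMod.tensorMap (D b) (𝟙 _) ≫
      GMod.assoc _ _ _ =
    GMod.tensorMap (D b) (𝟙 N) ≫ GMod.assoc _ _ _ ≫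
      GMod.tensorMap (𝟙 _) (GMod.tensorMap (D b) (𝟙 N) ≫ GMod.assoc _ _ _) := by
  rw [← Category.assoc (GMod.assoc _ _ _), ← assoc_natural_left, Category.assoc, pentagon,
    GMod.tensorMap_comp_right, ← Category.assoc (GMod.assoc _ _ _), ← assoc_natural_middle]
  simp only [← Category.assoc, ← tensorMap_comp_left]
  rw [Category.assoc (D b), D_coassoc]

variable {b}

section

variable (hD : ActsOnO0 b (verma b 0))

/-- The morphism `(id ⊗ π)(D ⊗ id)` from `Δ(0) ⊗ N` to `Δ(0) ⊗ G N`. -/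
def comulTensor (N : O0 b) :
    GMod.tensor (verma b 0) N.obj ⟶ GMod.tensor (verma b 0) ((G hD).obj N).obj :=
  GMod.tensorMap (D b) (𝟙 N.obj) ≫ GMod.assoc _ _ _ ≫ GMod.tensorMap (𝟙 (verma b 0)) (prG hD N)

lemma delta_app_hom (N : O0 b) : ((delta hD).app N).hom =
    inclG hD N ≫ comulTensor hD N ≫ prG hD ((G hD).obj N) := by
  simp only [comulTensor, Category.assoc]
  rfl

lemma prG_epsilon (N : O0 b) : prG hD N ≫ ((epsilon hD).app N).hom =
    GMod.tensorMap (E b) (𝟙 N.obj) ≫ GMod.leftUnit N.obj :=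
  pr0_incl0_of_principal _ (hD.splits N) (IsO0.mem_principalPart b N.property)

lemma prG_delta (N : O0 b) : prG hD N ≫ ((delta hD).app N).hom =
    comulTensor hD N ≫ prG hD ((G hD).obj N) := by
  rw [delta_app_hom]
  exact pr0_incl0_assoc _ (hD.splits N) (hD.splits _)

lemma inclG_prG {X : GMod g} (hX : ActsOnO0 b X) (N : O0 b) : inclG hX N ≫ prG hX N = 𝟙 _ :=
  pr0_incl0 _

theorem isComonad : IsComonad (G hD) (delta hD) (epsilon hD) where
  coassoc N := by
    apply ObjectProperty.hom_ext
    change ((delta hD).app N).hom ≫ ((G hD).map ((delta hD).app N)).hom =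
      ((delta hD).app N).hom ≫ ((delta hD).app ((G hD).obj N)).hom
    rw [delta_app_hom hD N]
    simp only [Category.assoc]
    -- The inner projections are absorbed, so both sides become inclusion, a morphism of full tensor
    -- products, and projection. The middle morphisms agree by coassociativity.
    rw [prG_G_map, prG_delta]
    congr 1
    simp only [← Category.assoc]
    congr 1
    simp only [comulTensor, Category.assoc]
    rw [← GMod.tensorMap_comp_right, prG_delta, comulTensor, ← Category.assoc (GMod.tensorMap _ (prG hD N)),
      GMod.tensorMap_exchange]
    simp only [Category.assoc]
    rw [← Category.assoc (GMod.tensorMap _ (prG hD N)), GMod.assoc_natural]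
    have := congrArg (· ≫ GMod.tensorMap (𝟙 (verma b 0)) (GMod.tensorMap (𝟙 (verma b 0)) (prG hD N)) ≫
      GMod.tensorMap (𝟙 (verma b 0)) (prG hD ((G hD).obj N))) (D_coassoc_tensor b N.obj)
    simpa only [Category.assoc, GMod.tensorMap_comp_right] using this.symm
  left_counit N := by
    apply ObjectProperty.hom_ext
    change ((delta hD).app N).hom ≫ ((epsilon hD).app ((G hD).obj N)).hom = 𝟙 _
    rw [delta_app_hom]
    simp only [Category.assoc]
    rw [prG_epsilon]
    simp only [comulTensor, Category.assoc]
    rw [← Category.assoc (GMod.tensorMap _ (prG hD N)), GMod.tensorMap_exchange, Category.assoc,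
      show GMod.tensorMap (𝟙 (GMod.trivial g)) (prG hD N) ≫ GMod.leftUnit ((G hD).obj N).obj =
        GMod.leftUnit _ ≫ prG hD N from GMod.leftUnit_natural _]
    have := D_left_counit b N.obj
    -- The identity of `G N` is read as inclusion followed by projection, which frames the counit
    -- law on `Δ(0) ⊗ N`.
    rw [← inclG_prG hD N]
    congr 1
    simp only [← Category.assoc] at this ⊢
    rw [this, Category.id_comp]
  right_counit N := by
    apply ObjectProperty.hom_ext
    change ((delta hD).app N).hom ≫ ((G hD).map ((epsilon hD).app N)).hom = 𝟙 _
    rw [delta_app_hom]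
    simp only [Category.assoc]
    rw [prG_G_map]
    simp only [comulTensor, Category.assoc]
    rw [← Category.assoc (GMod.tensorMap _ (prG hD N)), ← GMod.tensorMap_comp_right, prG_epsilon]
    have := D_right_counit b N.obj
    rw [← inclG_prG hD N]
    congr 1
    simp only [← Category.assoc] at this ⊢
    rw [this, Category.id_comp]
    rfl

/-- The left counit law exhibits a left inverse. -/
lemma delta_injective (N : O0 b) : Function.Injective ((delta hD).app N).hom.hom := by
  intro x y h
  have h1 (x) : ((epsilon hD).app ((G hD).obj N)).hom.hom (((delta hD).app N).hom.hom x) = x :=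
    congrArg (fun f => f.hom.hom x) ((isComonad hD).left_counit N)
  rw [← h1 x, h, h1]

lemma epsilon_surjective (N : O0 b) : Function.Surjective ((epsilon hD).app N).hom.hom := by
  intro n
  -- As `N` lies in the principal block, projecting `v ⊗ n` does not change its image under `E ⊗
  -- id`, which is `n`.
  refine ⟨(prG hD N).hom (vermaMk b 0 1 ⊗ₜ n), ?_⟩
  have h := congrArg (fun f => f.hom (vermaMk b 0 1 ⊗ₜ n)) (prG_epsilon hD N)
  refine Eq.trans h ?_
  change GMod.trivialEquiv ((E b).hom (vermaMk b 0 1)) • n = n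
  rw [E_one, one_smul]

end

end Semisimple

section Semisimple

variable {g : Type u} [LieRing g] [LieAlgebra ℂ g] [FiniteDimensional ℂ g]
  [LieAlgebra.IsSemisimple ℂ g] {H : LieSubalgebra ℂ g} [H.IsCartanSubalgebra]

open LieAlgebra LieAlgebra.IsKilling Module

/-! ### Chevalley anti-automorphisms -/

namespace ChevalleyAntiAut

variable (θ : ChevalleyAntiAut H)

lemma apply_cartan (h : H) : θ (h : g) = h := θ.map_cartan h h.2

lemma apply_mem_rootSpace {α : H → ℂ} {x : g} (hx : x ∈ rootSpace H α) :
    θ x ∈ rootSpace H (-α) := by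
  refine LieModule.weightSpace_le_genWeightSpace g _ ?_
  rw [LieModule.mem_weightSpace]
  intro h
  change ⁅(h : g), θ x⁆ = -α h • θ x
  have h1 : ⁅(h : g), x⁆ = α h • x := lie_eq_smul_of_mem_rootSpace hx h
  have h2 := θ.lie h x
  rw [h1, apply_cartan, map_smul] at h2
  rw [← lie_skew, ← h2, neg_smul]

/-- Root spaces are lines, so in an `sl₂`-triple `θ e = c f` and `θ f = d e`. Applying `θ` to `⁅e,
f⁆ = h`, with `h` fixed, gives `d * c = 1`. -/
lemma apply_apply_rootSpace (α : LieModule.Weight ℂ H g) (hα : α.IsNonZero) {x : g}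
    (hx : x ∈ rootSpace H α) : θ (θ x) = x := by
  obtain ⟨h, e, f, ht, he, hf⟩ := exists_isSl2Triple_of_weight_isNonZero hα
  have hspan (β : LieModule.Weight ℂ H g) (hβ : β.IsNonZero) (e : rootSpace H β) (h0 : (e : g) ≠ 0)
      {y : g} (hy : y ∈ rootSpace H β) : ∃ c : ℂ, y = c • (e : g) := by
    obtain ⟨c, hc⟩ := (finrank_eq_one_iff_of_nonzero' e (by simpa using h0)).mp
      (finrank_rootSpace_eq_one β hβ) ⟨y, hy⟩
    exact ⟨c, (congrArg Subtype.val hc).symm⟩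
  have hneg : (-α).IsNonZero := LieModule.Weight.IsNonZero.neg hα
  have hf' : f ∈ rootSpace H (-α : LieModule.Weight ℂ H g) := hf
  obtain ⟨c, hc⟩ := hspan (-α) hneg ⟨f, hf'⟩ ht.f_ne_zero (θ.apply_mem_rootSpace he)
  obtain ⟨d, hd⟩ := hspan α hα ⟨e, he⟩ ht.e_ne_zero
    (by simpa using θ.apply_mem_rootSpace hf)
  simp only at hc hd
  have hh : h = coroot α := ht.h_eq_coroot hα he hf
  have h1 := θ.lie e f
  rw [ht.lie_e_f, hc, hd, smul_lie, lie_smul, ht.lie_e_f, hh, apply_cartan, smul_smul, ← hh] at h1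
  have h2 : d * c = 1 := by
    have : (1 - d * c) • h = 0 := by rw [sub_smul, one_smul, ← h1, sub_self]
    rcases smul_eq_zero.mp this with h | h
    · linear_combination -h
    · exact absurd h ht.h_ne_zero
  obtain ⟨a, rfl⟩ := hspan α hα ⟨e, he⟩ ht.e_ne_zero hx
  simp only
  rw [map_smul, map_smul, hc, map_smul, hd, smul_smul c, mul_comm c, h2, one_smul]

/-- A Chevalley anti-automorphism is an involution. -/
lemma apply_apply (x : g) : θ (θ x) = x := by
  have hx : x ∈ (⨆ α : LieModule.Weight ℂ H g, rootSpace H α) := by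
    rw [LieModule.iSup_genWeightSpace_eq_top']; trivial
  induction hx using LieSubmodule.iSup_induction' with
  | mem α y hy =>
    by_cases hα : α.IsZero
    · have h0 : (α : H → ℂ) = 0 := hα
      rw [h0] at hy
      rw [rootSpace_zero_eq] at hy
      rw [θ.apply_cartan ⟨y, hy⟩, θ.apply_cartan ⟨y, hy⟩]
    · exact θ.apply_apply_rootSpace α hα hy
  | zero => rw [map_zero, map_zero]
  | add y z _ _ hy hz => rw [map_add, map_add, hy, hz]

/-- The extension of `θ` to an algebra homomorphism from `U(g)` to its opposite algebra. -/
def mapOp : U g →ₐ[ℂ] (U g)ᵐᵒᵖ :=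
  UniversalEnvelopingAlgebra.lift ℂ
    { toFun := fun x => MulOpposite.op (UniversalEnvelopingAlgebra.ι ℂ (θ x))
      map_add' := fun x y => by rw [map_add, map_add, MulOpposite.op_add]
      map_smul' := fun c x => by rw [map_smul, map_smul, MulOpposite.op_smul]; rfl
      map_lie' := fun {x y} => by
        rw [θ.lie, LieHom.map_lie, LieRing.of_associative_ring_bracket,
          LieRing.of_associative_ring_bracket, MulOpposite.op_sub, MulOpposite.op_mul,
          MulOpposite.op_mul] }

/-- The extension of `θ` to an anti-automorphism of `U(g)`. -/
def envMap (u : U g) : U g := (θ.mapOp u).unop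

lemma envMap_ι (x : g) : θ.envMap (UniversalEnvelopingAlgebra.ι ℂ x) =
    UniversalEnvelopingAlgebra.ι ℂ (θ x) := by
  rw [envMap, mapOp, UniversalEnvelopingAlgebra.lift_ι_apply]
  rfl

lemma envMap_mul (u w : U g) : θ.envMap (u * w) = θ.envMap w * θ.envMap u := by
  rw [envMap, map_mul, MulOpposite.unop_mul]
  rfl

lemma envMap_add (u w : U g) : θ.envMap (u + w) = θ.envMap u + θ.envMap w := by
  rw [envMap, map_add, MulOpposite.unop_add]
  rfl

lemma envMap_algebraMap (c : ℂ) : θ.envMap (algebraMap ℂ (U g) c) = algebraMap ℂ (U g) c := by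
  rw [envMap, AlgHom.commutes]
  rfl

lemma envMap_envMap (u : U g) : θ.envMap (θ.envMap u) = u := by
  induction u using U_induction with
  | hc c => rw [envMap_algebraMap, envMap_algebraMap]
  | hι x => rw [envMap_ι, envMap_ι, apply_apply]
  | hadd a c ha hc => rw [envMap_add, envMap_add, ha, hc]
  | hmul a c ha hc => rw [envMap_mul, envMap_mul, ha, hc]

/-- Consequently the principal central character is invariant under `θ`, which is what makes duality
and restriction of pairings compatible with the principal block. -/
lemma counit_envMap (u : U g) : counit g (θ.envMap u) = counit g u := by
  induction u using U_induction with
  | hc c => rw [envMap_algebraMap]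
  | hι x => rw [envMap_ι, counit_ι, counit_ι]
  | hadd a c ha hc => rw [envMap_add, map_add, map_add, ha, hc]
  | hmul a c ha hc => rw [envMap_mul, map_mul, map_mul, ha, hc, mul_comm]

/-- The action of `θ` on the centre of `U(g)`. -/
def mapCenter (z : Subalgebra.center ℂ (U g)) : Subalgebra.center ℂ (U g) :=
  ⟨θ.envMap z, Subalgebra.mem_center_iff.mpr fun u => by
    conv_lhs => rw [← θ.envMap_envMap u]
    conv_rhs => rw [← θ.envMap_envMap u]
    rw [← envMap_mul, ← envMap_mul, Subalgebra.mem_center_iff.mp z.2]⟩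

end ChevalleyAntiAut

/-! ### Contravariant pairings -/

/-- A non-degenerate pairing of `M` and `N` which is contravariant with respect to `θ`. -/
structure IsContragredient (θ : ChevalleyAntiAut H) {M N : GMod g}
    (B : M →ₗ[ℂ] Module.Dual ℂ N) : Prop where
  lie : ∀ (x : g) (m : M) (n : N), B ⁅x, m⁆ n = B m ⁅θ x, n⁆
  left : ∀ m, (∀ n, B m n = 0) → m = 0
  right : ∀ n, (∀ m, B m n = 0) → n = 0

variable {θ : ChevalleyAntiAut H}

namespace IsContragredient

variable {M N : GMod g} {B : M →ₗ[ℂ] Module.Dual ℂ N}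

lemma flip (hB : IsContragredient θ B) :
    IsContragredient θ (M := N) (N := M) (LinearMap.flip B) where
  lie x n m := by
    change B m ⁅x, n⁆ = B ⁅θ x, m⁆ n
    rw [hB.lie, θ.apply_apply]
  left := hB.right
  right := hB.left

lemma act (hB : IsContragredient θ B) (u : U g) (m : M) (n : N) :
    B (act M u m) n = B m (CategoryO.act N (θ.envMap u) n) := by
  induction u using U_induction generalizing m n with
  | hc c => rw [θ.envMap_algebraMap, AlgHom.commutes, AlgHom.commutes]; simp
  | hι x => rw [act_ι, θ.envMap_ι, act_ι, hB.lie]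
  | hadd a c ha hc =>
    rw [θ.envMap_add, map_add, map_add, LinearMap.add_apply, map_add, LinearMap.add_apply, ha, hc,
      LinearMap.add_apply, map_add]
  | hmul a c ha hc =>
    rw [θ.envMap_mul, map_mul, map_mul, Module.End.mul_apply, ha, hc, Module.End.mul_apply]

/-- Take `z` on which the characters differ. Its adjoint `θ(z)` has the principal value `c` on `m`,
by invariance. The powers of `X - c` and `X - χ(z)` that annihilate `m` (through `θ(z)`) and `n`
(through `z`) are coprime, so `n` is a combination on which only the first power survives; moved
across the pairing, it kills `m`. -/
lemma eq_zero_of_blockPart (hB : IsContragredient θ B) {χ : CentralChar g}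
    (hχ : χ ≠ principalChar g) {m : M} (hm : m ∈ principalPart M) {n : N}
    (hn : n ∈ blockPart χ N) : B m n = 0 := by
  obtain ⟨z, hz⟩ : ∃ z, χ z ≠ principalChar g z := by
    by_contra! h
    exact hχ (AlgHom.ext h)
  obtain ⟨l, hl⟩ := hn z
  obtain ⟨k, hk⟩ := hm (θ.mapCenter z)
  set T := CategoryO.act N (z : U g) with hT
  set c := principalChar g z with hc
  have hc' : principalChar g (θ.mapCenter z) = c := θ.counit_envMap _
  rw [hc'] at hk
  have hadj : ∀ (k : ℕ) (m : M) (n : N),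
      B (((CategoryO.act M (θ.mapCenter z : U g) - algebraMap ℂ (Module.End ℂ M) c) ^ k) m) n =
        B m (((T - algebraMap ℂ (Module.End ℂ N) c) ^ k) n) := by
    intro k
    induction k with
    | zero => intro m n; rfl
    | succ k ih =>
      intro m n
      rw [pow_succ, pow_succ', Module.End.mul_apply, Module.End.mul_apply, ih,
        LinearMap.sub_apply, LinearMap.sub_apply, map_sub, map_sub, LinearMap.sub_apply, hB.act]
      change B m (CategoryO.act N (θ.envMap (θ.envMap z)) _) - _ = _
      rw [θ.envMap_envMap]
      simp [Module.algebraMap_end_apply, T]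
  open Polynomial in
  have hcop : IsCoprime ((X - C c : ℂ[X]) ^ k) ((X - C (χ z)) ^ l) :=
    (Polynomial.isCoprime_X_sub_C_of_isUnit_sub (sub_ne_zero.mpr hz.symm).isUnit).pow
  obtain ⟨p, q, hpq⟩ := hcop
  have h1 := LinearMap.congr_fun (congrArg (Polynomial.aeval T) hpq) n
  rw [mul_comm p] at h1
  simp only [map_add, map_mul, map_pow, map_sub, Polynomial.aeval_X, Polynomial.aeval_C, map_one,
    LinearMap.add_apply, Module.End.mul_apply, Module.End.one_apply] at h1
  rw [hl, map_zero, add_zero] at h1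
  rw [← h1, ← hadj, hk, map_zero, LinearMap.zero_apply]

lemma eq_zero_of_otherPart (hB : IsContragredient θ B) {m : M} (hm : m ∈ principalPart M) {n : N}
    (hn : n ∈ otherPart N) : B m n = 0 := by
  rw [← LieSubmodule.mem_toSubmodule, otherPart_toSubmodule] at hn
  induction hn using Submodule.iSup_induction' with
  | mem χ n hn => exact hB.eq_zero_of_blockPart χ.2 hm hn
  | zero => exact map_zero _
  | add n n' _ _ hn hn' => rw [map_add, hn, hn', add_zero]

lemma eq_zero_of_otherPart' (hB : IsContragredient θ B) {m : M} (hm : m ∈ otherPart M) {n : N}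
    (hn : n ∈ principalPart N) : B m n = 0 :=
  hB.flip.eq_zero_of_otherPart hn hm

/-- The restriction to the principal parts of a contravariant non-degenerate pairing. -/
lemma proj0 (hB : IsContragredient θ B) (hM : Splits M) (hN : Splits N)
    {B₀ : proj0 M →ₗ[ℂ] Module.Dual ℂ (proj0 N)} (hB₀ : ∀ x y, B₀ x y = B x.1 y.1) :
    IsContragredient θ B₀ where
  lie x m n := by rw [hB₀, hB₀]; exact hB.lie x m.1 n.1
  left m hm := by
    refine Subtype.ext (hB.left _ fun n => ?_)
    -- An arbitrary test vector may be replaced by its principal component, the rest being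
    -- orthogonal to `m`.
    obtain ⟨a, ha, c, hc, rfl⟩ := hN.exists_add n
    rw [map_add, hB.eq_zero_of_otherPart m.2 hc, add_zero, ← hm ⟨a, ha⟩, hB₀]
  right n hn := by
    refine Subtype.ext (hB.right _ fun m => ?_)
    obtain ⟨a, ha, c, hc, rfl⟩ := hM.exists_add m
    rw [map_add, LinearMap.add_apply, hB.eq_zero_of_otherPart' hc n.2, add_zero, ← hn ⟨a, ha⟩, hB₀]

/-- Elements of `H` are self-adjoint because `θ` fixes them, so different eigenvalues force
orthogonality. -/
lemma apply_eq_zero_of_ne (hB : IsContragredient θ B) {lam mu : Module.Dual ℂ H} (h : lam ≠ mu)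
    {m : M} (hm : m ∈ weightSpace M lam) {n : N} (hn : n ∈ weightSpace N mu) : B m n = 0 := by
  rw [mem_weightSpace_iff] at hm hn
  obtain ⟨x, hx⟩ : ∃ x, lam x ≠ mu x := by
    by_contra! h'
    exact h (LinearMap.ext h')
  have h1 := hB.lie x m n
  rw [θ.apply_cartan, hm, hn, map_smul, map_smul, LinearMap.smul_apply, smul_eq_mul, smul_eq_mul,
    ← sub_eq_zero, ← sub_mul] at h1
  exact (mul_eq_zero.mp h1).resolve_left (sub_ne_zero.mpr hx)

lemma mem_restrictedDual (hB : IsContragredient θ B)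
    (hM : ⨆ lam : Module.Dual ℂ H, weightSpace M lam = ⊤) (m : M) :
    B m ∈ restrictedDual H N := by
  induction m using iSup_weightSpace_induction hM with
  | hp lam m hm =>
    refine (Set.finite_singleton lam).subset ?_
    rintro mu ⟨n, hn, h⟩
    by_contra hne
    exact h (hB.apply_eq_zero_of_ne (fun h => hne h.symm) hm hn)
  | hadd m m' hm hm' => rw [map_add]; exact Submodule.add_mem _ hm hm'

/-- The morphism `M → N^⋆` given by a contravariant pairing. -/
def toDualHom (hB : IsContragredient θ B)
    (hM : ⨆ lam : Module.Dual ℂ H, weightSpace M lam = ⊤) : M ⟶ dual θ N where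
  hom :=
    { toFun := fun m => ⟨B m, hB.mem_restrictedDual hM m⟩
      map_add' := fun m m' => Subtype.ext (map_add B m m')
      map_smul' := fun c m => Subtype.ext (map_smul B c m)
      map_lie' := fun {x m} => DualCarrier.ext' (θ := θ) fun n => hB.lie x m n }

lemma eval_toDualHom (hB : IsContragredient θ B)
    (hM : ⨆ lam : Module.Dual ℂ H, weightSpace M lam = ⊤) (m : M) :
    eval ((hB.toDualHom hM).hom m) = B m := rfl

end IsContragredient

/-! ### Duals of bounded modules -/

section WeightProj

variable {M : GMod g} (hM : ⨆ lam : Module.Dual ℂ H, weightSpace M lam = ⊤)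

include hM

lemma isCompl_weightSpace (lam : Module.Dual ℂ H) :
    IsCompl (weightSpace M lam) (⨆ mu, ⨆ (_ : mu ≠ lam), weightSpace M mu) := by
  refine ⟨iSupIndep_weightSpace M lam, codisjoint_iff_le_sup.mpr ?_⟩
  rw [← hM]
  refine iSup_le fun mu => ?_
  by_cases h : mu = lam
  · rw [h]; exact le_sup_left
  · exact le_sup_of_le_right (le_iSup₂_of_le mu h le_rfl)

/-- The projection onto a weight space. -/
def weightProj (lam : Module.Dual ℂ H) : M →ₗ[ℂ] M :=
  (weightSpace M lam).subtype ∘ₗ Submodule.projectionOnto _ _ (isCompl_weightSpace hM lam)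

lemma weightProj_apply {lam : Module.Dual ℂ H} {m : M} (hm : m ∈ weightSpace M lam) :
    weightProj hM lam m = m := by
  rw [weightProj, LinearMap.comp_apply, Submodule.projectionOnto_apply_of_mem_left _ hm]
  rfl

lemma weightProj_apply_of_ne {lam mu : Module.Dual ℂ H} (h : mu ≠ lam) {m : M}
    (hm : m ∈ weightSpace M mu) : weightProj hM lam m = 0 := by
  rw [weightProj, LinearMap.comp_apply, Submodule.projectionOnto_apply_of_mem_right]
  · exact map_zero _
  · exact Submodule.mem_iSup_of_mem mu (Submodule.mem_iSup_of_mem h hm)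

lemma linearMap_ext_weightSpace {V : Type*} [AddCommGroup V] [Module ℂ V] {f f' : M →ₗ[ℂ] V}
    (h : ∀ lam : Module.Dual ℂ H, ∀ m ∈ weightSpace M lam, f m = f' m) : f = f' := by
  refine LinearMap.ext fun m => ?_
  induction m using iSup_weightSpace_induction hM with
  | hp lam m hm => exact h lam m hm
  | hadd m m' hm hm' => rw [map_add, map_add, hm, hm']

/-- The element of `M^⋆` obtained by composing a linear functional with the projection onto a
weight space. -/
def dualOfWeight (θ : ChevalleyAntiAut H) (lam : Module.Dual ℂ H) (f : Module.Dual ℂ M) :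
    dual θ M :=
  ⟨f ∘ₗ weightProj hM lam, by
    refine (Set.finite_singleton lam).subset ?_
    rintro mu ⟨m, hm, h⟩
    by_contra hne
    exact h (by rw [LinearMap.comp_apply, weightProj_apply_of_ne hM hne hm, map_zero])⟩

lemma eval_dualOfWeight (lam : Module.Dual ℂ H) (f : Module.Dual ℂ M) (m : M) :
    eval (dualOfWeight hM θ lam f) m = f (weightProj hM lam m) := rfl

lemma eq_zero_of_weightProj {m : M} (h : ∀ lam, weightProj hM lam m = 0) : m = 0 := by
  classical
  have key : ∃ S : Finset (Module.Dual ℂ H), m = ∑ lam ∈ S, weightProj hM lam m := by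
    -- Allowing every larger index set makes the induction work: the expansions of two summands are
    -- compared over the union of their supports.
    have : ∃ S : Finset (Module.Dual ℂ H), ∀ T, S ⊆ T → m = ∑ lam ∈ T, weightProj hM lam m := by
      clear h
      induction m using iSup_weightSpace_induction hM with
      | hp lam m hm =>
        refine ⟨{lam}, fun T hT => ?_⟩
        rw [Finset.sum_eq_single_of_mem lam (hT (Finset.mem_singleton_self _)),
          weightProj_apply hM hm]
        intro mu _ hmu
        exact weightProj_apply_of_ne hM hmu.symm hm
      | hadd m m' hm hm' =>
        obtain ⟨S, hS⟩ := hm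
        obtain ⟨S', hS'⟩ := hm'
        refine ⟨S ∪ S', fun T hT => ?_⟩
        simp only [map_add, Finset.sum_add_distrib]
        rw [← hS T (Finset.union_subset_left hT), ← hS' T (Finset.union_subset_right hT)]
    obtain ⟨S, hS⟩ := this
    exact ⟨S, hS S subset_rfl⟩
  obtain ⟨S, hS⟩ := key
  rw [hS]
  exact Finset.sum_eq_zero fun lam _ => h lam

lemma isContragredient_eval (θ : ChevalleyAntiAut H) :
    IsContragredient θ (eval (θ := θ) (M := M)) where
  lie x f m := rfl
  left f hf := DualCarrier.ext' hf
  right m hm := by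
    refine eq_zero_of_weightProj hM fun lam => ?_
    rw [← Module.forall_dual_apply_eq_zero_iff ℂ]
    exact fun f => hm (dualOfWeight hM θ lam f)

/-- Since `θ` fixes `H`, dualising does not negate weights: the functionals of weight `lam` are
those supported on `M_lam`. -/
lemma mem_weightSpace_dual {lam : Module.Dual ℂ H} {f : dual θ M} :
    f ∈ weightSpace (dual θ M) lam ↔
      ∀ mu, mu ≠ lam → ∀ m ∈ weightSpace M mu, eval f m = 0 := by
  refine ⟨fun hf mu hmu m hm =>
    (isContragredient_eval hM θ).apply_eq_zero_of_ne hmu.symm hf hm, fun hf => ?_⟩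
  rw [mem_weightSpace_iff]
  refine fun h => DualCarrier.toDual_injective (θ := θ) (linearMap_ext_weightSpace hM fun mu m hm => ?_)
  rw [DualCarrier.lie_apply, θ.apply_cartan, mem_weightSpace_iff.mp hm, map_smul, map_smul,
    LinearMap.smul_apply]
  by_cases hmu : mu = lam
  · rw [hmu]
  · rw [hf mu hmu m hm, smul_zero, smul_zero]

lemma iSup_weightSpace_dual : ⨆ lam : Module.Dual ℂ H, weightSpace (dual θ M) lam = ⊤ := by
  refine eq_top_iff.mpr fun f _ => ?_
  have hfin : {lam : Module.Dual ℂ H | ∃ m ∈ weightSpace M lam, eval f m ≠ 0}.Finite := f.2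
  -- Finite support is exactly what lets `f` be recovered as a finite sum of its restrictions to
  -- weight spaces.
  have hf : f = ∑ lam ∈ hfin.toFinset, dualOfWeight hM θ lam (eval f) := by
    refine DualCarrier.toDual_injective (θ := θ) (linearMap_ext_weightSpace hM fun mu m hm => ?_)
    rw [map_sum, LinearMap.sum_apply]
    change eval f m = ∑ lam ∈ hfin.toFinset, eval f (weightProj hM lam m)
    by_cases hmu : mu ∈ hfin.toFinset
    · rw [Finset.sum_eq_single_of_mem mu hmu, weightProj_apply hM hm]
      intro lam _ hlam
      rw [weightProj_apply_of_ne hM hlam.symm hm, map_zero]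
    · rw [Finset.sum_eq_zero]
      · by_contra h
        exact hmu (hfin.mem_toFinset.mpr ⟨m, hm, h⟩)
      · intro lam hlam
        rw [weightProj_apply_of_ne hM (fun h : mu = lam => hmu (h ▸ hlam)) hm, map_zero]
  rw [hf]
  refine Submodule.sum_mem _ fun lam _ => Submodule.mem_iSup_of_mem lam ?_
  rw [mem_weightSpace_dual hM]
  intro mu hmu m hm
  rw [eval_dualOfWeight, weightProj_apply_of_ne hM hmu hm, map_zero]

end WeightProj

variable {b : (rootSystem H).Base}

/-- Restriction embeds the weight space of the dual into the dual of the weight space, so no new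
weights appear and the same apexes serve. -/
lemma IsBounded.dual {M : GMod g} (hM : IsBounded b M) (θ : ChevalleyAntiAut H) :
    IsBounded b (dual θ M) := by
  have hinj (lam : Module.Dual ℂ H) (f : CategoryO.dual θ M)
      (hf : f ∈ weightSpace (CategoryO.dual θ M) lam)
      (h : ∀ m ∈ weightSpace M lam, eval f m = 0) : f = 0 := by
    refine DualCarrier.toDual_injective (θ := θ) (linearMap_ext_weightSpace hM.weight fun mu m hm => ?_)
    rw [map_zero, LinearMap.zero_apply]
    by_cases hmu : mu = lam
    · exact h m (hmu ▸ hm)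
    · exact (mem_weightSpace_dual hM.weight).mp hf mu hmu m hm
  refine ⟨iSup_weightSpace_dual hM.weight, fun lam => ?_, ?_⟩
  · have := hM.finite lam
    let R : weightSpace (CategoryO.dual θ M) lam →ₗ[ℂ] Module.Dual ℂ (weightSpace M lam) :=
      (weightSpace M lam).subtype.dualMap ∘ₗ eval ∘ₗ
        (weightSpace (CategoryO.dual θ M) lam).subtype
    refine FiniteDimensional.of_injective R ((injective_iff_map_eq_zero R).mpr fun f hf => ?_)
    exact Subtype.ext (hinj lam f.1 f.2 fun m hm => LinearMap.congr_fun hf ⟨m, hm⟩)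
  · obtain ⟨T, hT⟩ := hM.cone
    refine ⟨T, fun lam hlam => hT lam fun h => hlam ?_⟩
    rw [Submodule.eq_bot_iff] at h ⊢
    exact fun f hf => hinj lam f hf fun m hm => by rw [h m hm, map_zero]

/-- Powers of `z - c` on the dual are transposes of powers of `θ(z) - c`, where `c` is the common
principal value. Finite generation of the dual over `n₋` then comes from boundedness through
`IsBounded.isO0`. -/
lemma preservesO0 (θ : ChevalleyAntiAut H) : PreservesO0 b θ := by
  intro M
  have hM := IsO.isBounded b M.property.1
  refine (hM.dual θ).isO0 fun f z => ?_
  obtain ⟨k, hk⟩ := M.property.2 (θ.mapCenter z)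
  have hc' : principalChar g (θ.mapCenter z) = principalChar g z := θ.counit_envMap _
  rw [hc'] at hk
  refine ⟨k, DualCarrier.toDual_injective (θ := θ) (LinearMap.ext fun m => ?_)⟩
  have hadj : ∀ (k : ℕ) (f : dual θ M.obj) (m : M.obj),
      eval (((act (dual θ M.obj) (z : U g) -
        algebraMap ℂ (Module.End ℂ (dual θ M.obj)) (principalChar g z)) ^ k) f) m =
      eval f (((act M.obj (θ.mapCenter z : U g) -
        algebraMap ℂ (Module.End ℂ M.obj) (principalChar g z)) ^ k) m) := by
    intro k
    induction k with
    | zero => intro f m; rfl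
    | succ k ih =>
      intro f m
      rw [pow_succ, pow_succ', Module.End.mul_apply, Module.End.mul_apply, ih,
        LinearMap.sub_apply, LinearMap.sub_apply, map_sub, map_sub, LinearMap.sub_apply,
        (isContragredient_eval hM.weight θ).act]
      simp only [Module.algebraMap_end_apply, map_smul, LinearMap.smul_apply]
      rfl
  rw [hadj, hk, LinearMap.zero_apply, map_zero, map_zero, LinearMap.zero_apply]

/-- Different weights are orthogonal, so everything happens in one weight at a time. There
non-degeneracy on both sides gives equal finite dimensions, and the injection into the dual is onto.
-/
lemma IsContragredient.bijective {M N : GMod g} {B : M →ₗ[ℂ] Module.Dual ℂ N}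
    (hB : IsContragredient θ B) (hM : IsBounded b M) (hN : IsBounded b N) :
    Function.Bijective (hB.toDualHom hM.weight).hom := by
  refine ⟨(injective_iff_map_eq_zero _).mpr fun m hm => hB.left m fun n => ?_, fun f => ?_⟩
  · rw [← hB.eval_toDualHom hM.weight, hm, map_zero, LinearMap.zero_apply]
  induction f using iSup_weightSpace_induction (iSup_weightSpace_dual (θ := θ) hN.weight) with
  | hadd f f' hf hf' =>
    obtain ⟨m, rfl⟩ := hf
    obtain ⟨m', rfl⟩ := hf'
    exact ⟨m + m', map_add _ _ _⟩
  | hp lam f hf =>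
    have := hM.finite lam
    have := hN.finite lam
    -- General in the pairing, so that it applies both to `B` and to its flip.
    have key {M N : GMod g} {B : M →ₗ[ℂ] Module.Dual ℂ N} (hB : IsContragredient θ B)
        (hN : IsBounded b N) : Function.Injective ((weightSpace N lam).subtype.dualMap ∘ₗ B ∘ₗ
          (weightSpace M lam).subtype) := by
      refine (injective_iff_map_eq_zero _).mpr fun m hm => Subtype.ext (hB.left _ fun n => ?_)
      induction n using iSup_weightSpace_induction hN.weight with
      | hadd n n' hn hn' => rw [map_add, hn, hn', add_zero]
      | hp mu n hn =>
        by_cases h : lam = mu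
        · exact LinearMap.congr_fun hm ⟨n, h ▸ hn⟩
        · exact hB.apply_eq_zero_of_ne h m.2 hn
    have h1 := key hB hN
    have h2 := key hB.flip hM
    have hdim : finrank ℂ (weightSpace M lam) =
        finrank ℂ (Module.Dual ℂ (weightSpace N lam)) := by
      refine le_antisymm (LinearMap.finrank_le_finrank_of_injective h1) ?_
      rw [Subspace.dual_finrank_eq, ← Subspace.dual_finrank_eq (V := weightSpace M lam)]
      exact LinearMap.finrank_le_finrank_of_injective h2
    obtain ⟨m, hm⟩ := (LinearMap.injective_iff_surjective_of_finrank_eq_finrank hdim).mp h1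
      ((weightSpace N lam).subtype.dualMap (eval f))
    refine ⟨m, DualCarrier.toDual_injective (θ := θ) (linearMap_ext_weightSpace hN.weight fun mu n hn => ?_)⟩
    by_cases h : lam = mu
    · exact LinearMap.congr_fun hm ⟨n, h ▸ hn⟩
    · rw [(mem_weightSpace_dual hN.weight).mp hf mu (fun h' => h h'.symm) n hn]
      exact hB.apply_eq_zero_of_ne h m.2 hn

/-! ### Pairings of tensor products. -/

lemma tensor_left_nondegenerate {M M' N N' : Type*} [AddCommGroup M] [AddCommGroup M']
    [AddCommGroup N] [AddCommGroup N'] [Module ℂ M] [Module ℂ M'] [Module ℂ N] [Module ℂ N']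
    {B : M →ₗ[ℂ] Module.Dual ℂ N} {B' : M' →ₗ[ℂ] Module.Dual ℂ N'}
    {T : M ⊗[ℂ] M' →ₗ[ℂ] Module.Dual ℂ (N ⊗[ℂ] N')}
    (hT : ∀ m m' n n', T (m ⊗ₜ m') (n ⊗ₜ n') = B m n * B' m' n')
    (hB : ∀ m, (∀ n, B m n = 0) → m = 0) (hB' : ∀ m, (∀ n, B' m n = 0) → m = 0)
    (t : M ⊗[ℂ] M') (ht : ∀ s, T t s = 0) : t = 0 := by
  classical
  -- With `t = ∑ mᵢ ⊗ eᵢ`, pairing the first factor with a fixed `n` leaves `∑ B(mᵢ, n) eᵢ`, which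
  -- is zero by non-degeneracy of `B'`. Independence of the basis then gives `B(mᵢ, n) = 0` for all
  -- `n`.
  let e := Module.Basis.ofVectorSpace ℂ M'
  obtain ⟨x, rfl⟩ := (TensorProduct.equivFinsuppOfBasisRight e).symm.surjective t
  suffices x = 0 by rw [this, map_zero]
  rw [TensorProduct.equivFinsuppOfBasisRight_symm_apply] at ht
  have h1 (n : N) : x.sum (fun i m => B m n • e i) = 0 := by
    refine hB' _ fun n' => ?_
    rw [← ht (n ⊗ₜ n')]
    simp only [Finsupp.sum, map_sum, LinearMap.sum_apply, hT, map_smul, LinearMap.smul_apply,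
      smul_eq_mul]
  ext i
  refine hB _ fun n => ?_
  have h2 : Finsupp.linearCombination ℂ e (x.mapRange (fun m => B m n) (by simp)) = 0 := by
    rw [← h1 n, Finsupp.linearCombination_apply, Finsupp.sum_mapRange_index (by simp)]
  have h3 := DFunLike.congr_fun
    ((linearIndependent_iff.mp e.linearIndependent) _ h2) i
  simpa using h3

lemma isContragredient_pairing (hX : ⨆ lam : Module.Dual ℂ H, weightSpace (verma b 0) lam = ⊤)
    {M N : GMod g} {B : M →ₗ[ℂ] Module.Dual ℂ N} (hB : IsContragredient θ B) :
    IsContragredient θ (pairing b θ B) where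
  lie x t s := by
    induction t using TensorProduct.induction_on with
    | zero => rw [lie_zero, map_zero]; rfl
    | add t t' ht ht' => rw [lie_add, map_add, map_add, LinearMap.add_apply, ht, ht']; rfl
    | tmul f m =>
      induction s using TensorProduct.induction_on with
      | zero => rw [lie_zero, map_zero, map_zero]
      | add s s' hs hs' => rw [lie_add, map_add, map_add, hs, hs']
      | tmul a n =>
        rw [TensorProduct.LieModule.lie_tmul_right, TensorProduct.LieModule.lie_tmul_right,
          map_add, LinearMap.add_apply, map_add, pairing_tmul, pairing_tmul, pairing_tmul,
          pairing_tmul, hB.lie]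
        rfl
  left := tensor_left_nondegenerate (pairing_tmul θ B)
    (isContragredient_eval hX θ).left hB.left
  right := tensor_left_nondegenerate (T := LinearMap.flip (pairing b θ B))
    (B := LinearMap.flip (eval (θ := θ) (M := verma b 0))) (B' := LinearMap.flip B)
    (fun m m' n n' => pairing_tmul θ B n n' m m') (isContragredient_eval hX θ).right hB.right

end Semisimple

section Semisimple

variable {g : Type u} [LieRing g] [LieAlgebra ℂ g] [FiniteDimensional ℂ g]
  [LieAlgebra.IsSemisimple ℂ g] {H : LieSubalgebra ℂ g} [H.IsCartanSubalgebra]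

open LieAlgebra LieAlgebra.IsKilling Module

variable {θ : ChevalleyAntiAut H} {b : (rootSystem H).Base}

/-! ### The monad -/

/-- A bijective morphism of `g`-modules is an isomorphism. -/
def isoOfBijective {M N : GMod g} (f : M ⟶ N) (hf : Function.Bijective f.hom) : M ≅ N where
  hom := f
  inv := ⟨{ (LinearEquiv.ofBijective (f.hom : M →ₗ[ℂ] N) hf).symm with
    map_lie' := fun {x n} => by
      obtain ⟨m, rfl⟩ := hf.2 n
      apply hf.1
      have h (n : N) : f.hom ((LinearEquiv.ofBijective (f.hom : M →ₗ[ℂ] N) hf).symm n) = n :=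
        (LinearEquiv.ofBijective (f.hom : M →ₗ[ℂ] N) hf).apply_symm_apply n
      refine (h _).trans ?_
      rw [LieModuleHom.map_lie]
      exact congrArg _ (h _).symm }⟩
  hom_inv_id := GMod.hom_ext fun m =>
    (LinearEquiv.ofBijective (f.hom : M →ₗ[ℂ] N) hf).symm_apply_apply m
  inv_hom_id := GMod.hom_ext fun n =>
    (LinearEquiv.ofBijective (f.hom : M →ₗ[ℂ] N) hf).apply_symm_apply n

lemma O0.isBounded (M : O0 b) : IsBounded b M.obj := IsO.isBounded b M.property.1

lemma isBounded_verma (lam : Module.Dual ℂ H) : IsBounded b (verma b lam) :=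
  (isO_verma b lam).isBounded

lemma actsOnO0_verma : ActsOnO0 b (verma b 0) := (isBounded_verma 0).actsOnO0

lemma actsOnO0_dualVerma (θ : ChevalleyAntiAut H) : ActsOnO0 b (dualVerma b θ 0) :=
  ((isBounded_verma 0).dual θ).actsOnO0

lemma eval_injective {M : GMod g} : Function.Injective (eval (θ := θ) (M := M)) :=
  DualCarrier.toDual_injective

section

variable (hs : PreservesO0 b θ)

/-- The isomorphism `M ≅ N^⋆` in the principal block given by a non-degenerate contravariant
pairing. -/
def contragredientIso {M N : O0 b} {B : M.obj →ₗ[ℂ] Module.Dual ℂ N.obj}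
    (hB : IsContragredient θ B) : M ≅ (star hs).obj (.op N) :=
  (IsO0 b).isoMk (isoOfBijective (hB.toDualHom M.isBounded.weight)
    (hB.bijective M.isBounded N.isBounded))

lemma isContragredient_evalPairing (M : O0 b) : IsContragredient θ (evalPairing hs M) :=
  (isContragredient_eval M.isBounded.weight θ).flip

variable (hD : ActsOnO0 b (verma b 0)) (hN : ActsOnO0 b (dualVerma b θ 0))

lemma isContragredient_pairingG {M N : O0 b} {B : M.obj →ₗ[ℂ] Module.Dual ℂ N.obj}
    (hB : IsContragredient θ B) : IsContragredient θ (pairingG hD hN B) :=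
  (isContragredient_pairing (isBounded_verma 0).weight hB).proj0 (hN.splits M) (hD.splits N)
    fun _ _ => rfl

lemma pairing_adjoint {M M' N N' : GMod g} {B : M →ₗ[ℂ] Module.Dual ℂ N}
    {B' : M' →ₗ[ℂ] Module.Dual ℂ N'} {f : M ⟶ M'} {f' : N' ⟶ N}
    (h : ∀ m n, B' (f.hom m) n = B m (f'.hom n)) (t : GMod.tensor (dualVerma b θ 0) M)
    (s : GMod.tensor (verma b 0) N') :
    pairing b θ B' ((GMod.tensorMap (𝟙 _) f).hom t) s =
      pairing b θ B t ((GMod.tensorMap (𝟙 _) f').hom s) := by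
  induction t using TensorProduct.induction_on with
  | zero => rw [map_zero, map_zero, map_zero]; rfl
  | add t t' ht ht' => rw [map_add, map_add, map_add, LinearMap.add_apply, ht, ht']; rfl
  | tmul φ m =>
    induction s using TensorProduct.induction_on with
    | zero => rw [map_zero, map_zero, map_zero]
    | add s s' hs hs' => rw [map_add, map_add, map_add, hs, hs']
    | tmul a n =>
      change eval φ a * B' (f.hom m) n = eval φ a * B m (f'.hom n)
      rw [h]

/-- Both functors act by restricting `id ⊗ f`, so adjointness on the full tensor products restricts.
The general `B` and `B'` let the statement be iterated. -/
lemma pairingG_adjoint {M M' N N' : O0 b} {B : M.obj →ₗ[ℂ] Module.Dual ℂ N.obj}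
    {B' : M'.obj →ₗ[ℂ] Module.Dual ℂ N'.obj} {f : M ⟶ M'} {f' : N' ⟶ N}
    (h : ∀ m n, B' (f.hom.hom m) n = B m (f'.hom.hom n)) (x : ((G hN).obj M).obj)
    (y : ((G hD).obj N').obj) :
    pairingG hD hN B' (((G hN).map f).hom.hom x) y =
      pairingG hD hN B x (((G hD).map f').hom.hom y) :=
  pairing_adjoint h _ _

lemma evalPairing_adjoint {M M' : O0 b} (f : M ⟶ M') (m : M.obj)
    (φ : ((star hs).obj (.op M')).obj) :
    evalPairing hs M' (f.hom.hom m) φ =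
      evalPairing hs M m (((star hs).map f.op).hom.hom φ) := rfl

/-- The natural isomorphism `M ≅ M^⋆⋆`. -/
def doubleDualIso : 𝟭 (O0 b) ≅ (star hs).rightOp ⋙ star hs :=
  NatIso.ofComponents (fun M => contragredientIso hs (isContragredient_evalPairing hs M))
    fun f => rfl

/-- The natural isomorphism `G_{∇(0)} M ≅ (G_{Δ(0)} M^⋆)^⋆`. -/
def dualIso : G hN ≅ (star hs).rightOp ⋙ (G hD).op ⋙ star hs :=
  NatIso.ofComponents
    (fun M => contragredientIso hs (N := (G hD).obj ((star hs).obj (.op M)))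
      (isContragredient_pairingG hD hN (isContragredient_evalPairing hs M)))
    fun {M M'} f => by
      refine ObjectProperty.hom_ext _ (GMod.hom_ext fun x => eval_injective (θ := θ) ?_)
      refine LinearMap.ext fun y => ?_
      exact pairingG_adjoint hD hN (evalPairing_adjoint hs f) x y

/-- The natural isomorphism `G_{∇(0)} G_{∇(0)} M ≅ (G_{Δ(0)} G_{Δ(0)} M^⋆)^⋆`. -/
def dualIso₂ : G hN ⋙ G hN ≅ (star hs).rightOp ⋙ (G hD ⋙ G hD).op ⋙ star hs :=
  NatIso.ofComponents
    (fun M => contragredientIso hs (N := (G hD).obj ((G hD).obj ((star hs).obj (.op M))))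
      (isContragredient_pairingG hD hN
        (isContragredient_pairingG hD hN (isContragredient_evalPairing hs M))))
    fun {M M'} f => by
      refine ObjectProperty.hom_ext _ (GMod.hom_ext fun x => eval_injective (θ := θ) ?_)
      refine LinearMap.ext fun y => ?_
      exact pairingG_adjoint hD hN (pairingG_adjoint hD hN (evalPairing_adjoint hs f)) x y

/-- The multiplication `G_{∇(0)} G_{∇(0)} ⟶ G_{∇(0)}` dual to `delta`. -/
def mu : G hN ⋙ G hN ⟶ G hN :=
  (dualIso₂ hs hD hN).hom ≫
    Functor.whiskerLeft (star hs).rightOp (Functor.whiskerRight (NatTrans.op (delta hD)) (star hs)) ≫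
      (dualIso hs hD hN).inv

/-- The unit `𝟭 ⟶ G_{∇(0)}` dual to `epsilon`. -/
def eta : 𝟭 (O0 b) ⟶ G hN :=
  (doubleDualIso hs).hom ≫
    Functor.whiskerLeft (star hs).rightOp
      (Functor.whiskerRight (NatTrans.op (epsilon hD)) (star hs)) ≫
      (dualIso hs hD hN).inv

lemma mu_app_comp (M : O0 b) : (mu hs hD hN).app M ≫ (dualIso hs hD hN).hom.app M =
    (dualIso₂ hs hD hN).hom.app M ≫
      (star hs).map ((delta hD).app ((star hs).obj (.op M))).op := by
  rw [mu, NatTrans.comp_app, NatTrans.comp_app, Category.assoc, Category.assoc,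
    Iso.inv_hom_id_app, Category.comp_id]
  rfl

lemma eta_app_comp (M : O0 b) : (eta hs hD hN).app M ≫ (dualIso hs hD hN).hom.app M =
    (doubleDualIso hs).hom.app M ≫
      (star hs).map ((epsilon hD).app ((star hs).obj (.op M))).op := by
  rw [eta, NatTrans.comp_app, NatTrans.comp_app, Category.assoc, Category.assoc,
    Iso.inv_hom_id_app, Category.comp_id]
  rfl

/-- The morphism `N → M^⋆` given by a pairing of `M` and `N`. -/
def toStar {M N : O0 b} {B : M.obj →ₗ[ℂ] Module.Dual ℂ N.obj} (hB : IsContragredient θ B) :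
    N ⟶ (star hs).obj (.op M) :=
  (contragredientIso hs hB.flip).hom

lemma evalPairing_toStar {M N : O0 b} {B : M.obj →ₗ[ℂ] Module.Dual ℂ N.obj}
    (hB : IsContragredient θ B) (m : M.obj) (n : N.obj) :
    B m n = evalPairing hs M m ((toStar hs hB).hom.hom n) := rfl

/-- Every non-degenerate contravariant pairing is evaluation transported along `N → M^⋆`. This
carries identities known for `M^⋆` to any partner `N`. -/
lemma pairingG_eq_evalPairing {M N : O0 b} {B : M.obj →ₗ[ℂ] Module.Dual ℂ N.obj}
    (hB : IsContragredient θ B) (x : ((G hN).obj M).obj) (y : ((G hD).obj N).obj) :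
    pairingG hD hN B x y =
      pairingG hD hN (evalPairing hs M) x (((G hD).map (toStar hs hB)).hom.hom y) := by
  -- The identity is taken on the side of `M`, so only the second argument moves.
  have h := pairingG_adjoint hD hN (f := 𝟙 M) (f' := toStar hs hB) (B := evalPairing hs M) (B' := B)
    (evalPairing_toStar hs hB) x y
  rwa [(G hN).map_id] at h

lemma pairingG_pairingG_eq_evalPairing {M N : O0 b} {B : M.obj →ₗ[ℂ] Module.Dual ℂ N.obj}
    (hB : IsContragredient θ B) (x : ((G hN).obj ((G hN).obj M)).obj)
    (y : ((G hD).obj ((G hD).obj N)).obj) :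
    pairingG hD hN (pairingG hD hN B) x y =
      pairingG hD hN (pairingG hD hN (evalPairing hs M)) x
        (((G hD).map ((G hD).map (toStar hs hB))).hom.hom y) := by
  have h := pairingG_adjoint hD hN (f := 𝟙 _) (f' := (G hD).map (toStar hs hB))
    (B := pairingG hD hN (evalPairing hs M)) (B' := pairingG hD hN B)
    (pairingG_eq_evalPairing hs hD hN hB) x y
  rwa [(G hN).map_id] at h

/-- For the evaluation pairing this is how `mu` was defined, and naturality of `delta` along
`toStar` extends it to every `B`. The generality is needed in the monad laws, where `G M` is paired
with `G_{Δ(0)} M^⋆` instead of with its own dual. -/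
lemma pairingG_mu {M N : O0 b} {B : M.obj →ₗ[ℂ] Module.Dual ℂ N.obj}
    (hB : IsContragredient θ B) (x : ((G hN).obj ((G hN).obj M)).obj) (y : ((G hD).obj N).obj) :
    pairingG hD hN B (((mu hs hD hN).app M).hom.hom x) y =
      pairingG hD hN (pairingG hD hN B) x (((delta hD).app N).hom.hom y) := by
  have hnat := congrArg (fun f => f.hom.hom y) ((delta hD).naturality (toStar hs hB))
  have hmu := congrArg (fun f => eval (θ := θ) (f.hom.hom x)
    (((G hD).map (toStar hs hB)).hom.hom y)) (mu_app_comp hs hD hN M)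
  rw [pairingG_eq_evalPairing hs hD hN hB, pairingG_pairingG_eq_evalPairing hs hD hN hB]
  refine hmu.trans ?_
  exact congrArg (pairingG hD hN (pairingG hD hN (evalPairing hs M)) x) hnat

lemma pairingG_eta {M N : O0 b} {B : M.obj →ₗ[ℂ] Module.Dual ℂ N.obj}
    (hB : IsContragredient θ B) (m : M.obj) (y : ((G hD).obj N).obj) :
    pairingG hD hN B (((eta hs hD hN).app M).hom.hom m) y =
      B m (((epsilon hD).app N).hom.hom y) := by
  have hnat := congrArg (fun f => f.hom.hom y) ((epsilon hD).naturality (toStar hs hB))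
  have heta := congrArg (fun f => eval (θ := θ) (f.hom.hom m)
    (((G hD).map (toStar hs hB)).hom.hom y)) (eta_app_comp hs hD hN M)
  rw [pairingG_eq_evalPairing hs hD hN hB]
  refine heta.trans ?_
  exact congrArg (evalPairing hs M m) hnat

lemma eq_of_pairingG {M N P : O0 b} {B : M.obj →ₗ[ℂ] Module.Dual ℂ N.obj}
    (hB : IsContragredient θ B) {f f' : P ⟶ (G hN).obj M}
    (h : ∀ x y, pairingG hD hN B (f.hom.hom x) y = pairingG hD hN B (f'.hom.hom x) y) : f = f' := by
  refine ObjectProperty.hom_ext _ (GMod.hom_ext fun x => ?_)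
  rw [← sub_eq_zero]
  refine (isContragredient_pairingG hD hN hB).left _ fun y => ?_
  rw [map_sub, LinearMap.sub_apply, h, sub_self]

/-- By non-degeneracy it is enough to compare pairings with `G_{Δ(0)} M^⋆`. Moving each map across
turns every law into the corresponding comonad law at `M^⋆`. -/
theorem isMonad : IsMonad (G hN) (mu hs hD hN) (eta hs hD hN) where
  assoc M := by
    have hB := isContragredient_evalPairing hs M
    refine eq_of_pairingG hD hN hB fun x y => ?_
    change pairingG hD hN (evalPairing hs M) (((mu hs hD hN).app M).hom.hom
        (((G hN).map ((mu hs hD hN).app M)).hom.hom x)) y =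
      pairingG hD hN (evalPairing hs M) (((mu hs hD hN).app M).hom.hom
        (((mu hs hD hN).app ((G hN).obj M)).hom.hom x)) y
    rw [pairingG_mu hs hD hN hB, pairingG_mu hs hD hN hB,
      pairingG_mu hs hD hN (isContragredient_pairingG hD hN hB),
      pairingG_adjoint hD hN (pairingG_mu hs hD hN hB)]
    exact congrArg (fun f => pairingG hD hN (pairingG hD hN (pairingG hD hN (evalPairing hs M))) x
      (f.hom.hom y)) ((isComonad hD).coassoc ((star hs).obj (.op M)))
  left_unit M := by
    have hB := isContragredient_evalPairing hs M
    refine eq_of_pairingG hD hN hB fun x y => ?_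
    change pairingG hD hN (evalPairing hs M) (((mu hs hD hN).app M).hom.hom
        (((eta hs hD hN).app ((G hN).obj M)).hom.hom x)) y = pairingG hD hN (evalPairing hs M) x y
    rw [pairingG_mu hs hD hN hB, pairingG_eta hs hD hN (isContragredient_pairingG hD hN hB)]
    exact congrArg (fun f => pairingG hD hN (evalPairing hs M) x (f.hom.hom y))
      ((isComonad hD).left_counit ((star hs).obj (.op M)))
  right_unit M := by
    have hB := isContragredient_evalPairing hs M
    refine eq_of_pairingG hD hN hB fun x y => ?_
    change pairingG hD hN (evalPairing hs M) (((mu hs hD hN).app M).hom.hom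
        (((G hN).map ((eta hs hD hN).app M)).hom.hom x)) y = pairingG hD hN (evalPairing hs M) x y
    rw [pairingG_mu hs hD hN hB, pairingG_adjoint hD hN (pairingG_eta hs hD hN hB)]
    exact congrArg (fun f => pairingG hD hN (evalPairing hs M) x (f.hom.hom y))
      ((isComonad hD).right_counit ((star hs).obj (.op M)))

lemma mu_surjective (M : O0 b) : Function.Surjective ((mu hs hD hN).app M).hom.hom := fun x =>
  ⟨((eta hs hD hN).app ((G hN).obj M)).hom.hom x,
    congrArg (fun f => f.hom.hom x) ((isMonad hs hD hN).left_unit M)⟩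

/-- If the unit kills `m`, adjointness makes `m` orthogonal to the image of the counit at `M^⋆`,
which is everything. -/
lemma eta_injective (M : O0 b) : Function.Injective ((eta hs hD hN).app M).hom.hom := by
  have hB := isContragredient_evalPairing hs M
  refine (injective_iff_map_eq_zero _).mpr fun m hm => hB.left m fun φ => ?_
  obtain ⟨y, rfl⟩ := epsilon_surjective hD ((star hs).obj (.op M)) φ
  refine (pairingG_eta hs hD hN hB m y).symm.trans ?_
  rw [hm, map_zero, LinearMap.zero_apply]

end

end Semisimple

end CategoryO

end

/-! ### The theorem. -/

open CategoryO in
theorem theorem4p2 {g : Type u} [LieRing g] [LieAlgebra ℂ g] [FiniteDimensional ℂ g]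
    [LieAlgebra.IsSemisimple ℂ g] (H : LieSubalgebra ℂ g) [H.IsCartanSubalgebra]
    (b : (LieAlgebra.IsKilling.rootSystem H).Base) :
    -- the functor `G_{Δ(0)}` is defined on the principal block
    ∃ hD : ActsOnO0 b (verma b 0),
      -- it is a comonad with the comultiplication and counit induced by `D` and `E`
      IsComonad (G hD) (delta hD) (epsilon hD) ∧
      (∀ M : O0 b, Function.Injective ((delta hD).app M).hom.hom) ∧
      (∀ M : O0 b, Function.Surjective ((epsilon hD).app M).hom.hom) ∧
      -- dually, for the duality given by a Chevalley anti-automorphism, which preserves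
      -- the principal block, the functor `G_{∇(0)}` is defined on the principal block
      ∀ θ : ChevalleyAntiAut H,
        ∃ (hN : ActsOnO0 b (dualVerma b θ 0)) (hs : PreservesO0 b θ)
          -- the canonical isomorphisms `M ≅ M^⋆⋆`, `G_{∇(0)} M ≅ (G_{Δ(0)} M^⋆)^⋆` and
          -- `G_{∇(0)} G_{∇(0)} M ≅ (G_{Δ(0)} G_{Δ(0)} M^⋆)^⋆`
          (ev : 𝟭 (O0 b) ≅ (star hs).rightOp ⋙ star hs)
          (κ : G hN ≅ (star hs).rightOp ⋙ (G hD).op ⋙ star hs)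
          (κ₂ : G hN ⋙ G hN ≅ (star hs).rightOp ⋙ (G hD ⋙ G hD).op ⋙ star hs)
          (μ : G hN ⋙ G hN ⟶ G hN) (η : 𝟭 (O0 b) ⟶ G hN),
          (∀ M x, eval ((ev.hom.app M).hom.hom x) = evalPairing hs M x) ∧
          (∀ M x, eval ((κ.hom.app M).hom.hom x) =
            pairingG hD hN (evalPairing hs M) x) ∧
          (∀ M x, eval ((κ₂.hom.app M).hom.hom x) =
            pairingG hD hN
              (pairingG hD hN (evalPairing hs M)) x) ∧
          -- under which the multiplication and the unit are `(delta_{M^⋆})^⋆` and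
          -- `(epsilon_{M^⋆})^⋆`
          (∀ M, μ.app M ≫ κ.hom.app M =
            κ₂.hom.app M ≫ (star hs).map ((delta hD).app ((star hs).obj (.op M))).op) ∧
          (∀ M, η.app M ≫ κ.hom.app M =
            ev.hom.app M ≫ (star hs).map ((epsilon hD).app ((star hs).obj (.op M))).op) ∧
          IsMonad (G hN) μ η ∧
          (∀ M : O0 b, Function.Surjective (μ.app M).hom.hom) ∧
          (∀ M : O0 b, Function.Injective (η.app M).hom.hom) := by
  refine ⟨actsOnO0_verma, isComonad _, delta_injective _, epsilon_surjective _, fun θ => ?_⟩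
  exact ⟨actsOnO0_dualVerma θ, preservesO0 θ, doubleDualIso _, dualIso _ _ _, dualIso₂ _ _ _,
    mu _ _ _, eta _ _ _, fun _ _ => rfl, fun _ _ => rfl, fun _ _ => rfl, mu_app_comp _ _ _,
    eta_app_comp _ _ _, isMonad _ _ _, mu_surjective _ _ _, eta_injective _ _ _⟩
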